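/- **Setting (utility maximization with prices of information, additive values).** Let $V$ be a finite set of $n$ elements. Element $i\in V$ has a non-negative random value $X_i$ of finite mean with a known law and a probing price $\pi_i\ge 0$; the $X_i$ are independent. Let $\mathcal F\subseteq 2^V$ be a downward-closed family with $\emptyset\in\mathcal F$. A policy adaptively probes elements: probing $i$ reveals $X_i$ and costs $\pi_i$ (paid once). It then stops and selects a set $\mathbb I\in\mathcal F$ of probed elements. Policies may be randomized, with randomness independent of the $X_i$. Their expected utility is $$\mathbb E\Big[\sum_{i\in\mathbb I}X_i-\sum_{i\in\mathrm{Probed}}\pi_i\Big].$$ For $\alpha\ge 1$, an $\alpha$-approximation is an algorithm that always selects a feasible set of probed elements and whose expected utility is at least $1/\alpha$ times the expected utility of every randomized adaptive policy. **Model of computation.** "Efficient" means: a single program, independent of the instance, for a probing real RAM (natural-number and real cells, exact real arithmetic and comparisons without rounding, fair random bits, and an instruction that probes an element), whose number of executed steps is always bounded by a fixed polynomial in the number of elements plus the total length of the tables below. The prices are part of the input. The law of each $X_i$ is known to the program in one of two ways: as an explicit finite table of values and probabilities, or, for an arbitrary law, through a unit-cost oracle that for $c>0$ returns the solution $t$ of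 $\mathbb E[(X_i-t)^+]=c$. The family $\mathcal F$ is a *$k$-system* ($k\ge1$) if for all $Y\subseteq V$ and all inclusion-maximal members $A,B$ of $\{S\in\mathcal F: S\subseteq Y\}$ we have $|A|\le k|B|$. **Theorem.** 1. ($k$-system.) There is an efficient algorithm, with access to $\mathcal F$ through a feasibility oracle, that is a $k$-approximation for every $k\ge 1$ and every $k$-system $\mathcal F$. 2. (Knapsack.) There is an efficient randomized algorithm that, given a knapsack size $B\ge 0$ and known item sizes $0\le s_i\le B$, is a $2$-approximation for $\mathcal F=\{S\subseteq V:\sum_{i\in S}s_i\le B\}$. 3. (Matroid.) There is an efficient algorithm, with access to an independence oracle, that is optimal among all randomized adaptive policies (a $1$-approximation) when $\mathcal F$ is the family of independent sets of a matroid. 4. (Matching.) There is an efficient algorithm that, given a finite simple graph by the end points of its edges, is a $2$-approximation when $V$ is the edge set of the graph and $\mathcal F$ is the family of its matchings. -/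

import Mathlib

open MeasureTheory

noncomputable section

namespace PriceOfInfo

/-! ## Instances of utility maximization with prices of information -/

/-- How the law of one element value is known to an algorithm: either through an explicit finite
table of pairs `(value, probability)`, or, for an arbitrary law on `ℝ`, through an oracle
(see `excessInverse`). -/
inductive KnownLaw where
  | table (rows : List (ℝ × ℝ))
  | oracle (μ : Measure ℝ)

/-- The law itself. -/
def KnownLaw.law : KnownLaw → Measure ℝ
  | .table rows => (rows.map fun r => ENNReal.ofReal r.2 • Measure.dirac r.1).sum
  | .oracle μ => μ

/-- The rows of the explicit table (none if the law is only available through the oracle). -/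
def KnownLaw.rows : KnownLaw → List (ℝ × ℝ)
  | .table rows => rows
  | .oracle _ => []

/-- For a probability law `μ` with finite mean and `c > 0`, this is the unique `t` with
`𝔼[(X - t)⁺] = c`, where `X ∼ μ`. -/
def excessInverse (μ : Measure ℝ) (c : ℝ) : ℝ :=
  sInf {t : ℝ | ∫ x, max (x - t) 0 ∂μ ≤ c}

/-- The answer of the oracle of an element; for an element with an explicit table there is no
oracle and the answer is void. -/
def KnownLaw.answer : KnownLaw → ℝ → ℝ
  | .table _, _ => 0
  | .oracle μ, c => excessInverse μ c

/-- The stochastic data on `n` elements: the laws of the independent non-negative values `X i`,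
of finite mean, and the non-negative probing prices. -/
structure Market (n : ℕ) where
  dist : Fin n → KnownLaw
  price : Fin n → ℝ
  price_nonneg : ∀ i, 0 ≤ price i
  rows_nonneg : ∀ i, ∀ r ∈ (dist i).rows, 0 ≤ r.1 ∧ 0 ≤ r.2
  isProb : ∀ i, IsProbabilityMeasure (dist i).law
  value_nonneg : ∀ i, ∀ᵐ x ∂(dist i).law, 0 ≤ x
  value_integrable : ∀ i, Integrable (fun x : ℝ => x) (dist i).law

namespace Market

variable {n : ℕ}

/-- The joint law of the independent values `X i`. -/
def joint (P : Market n) : Measure (Fin n → ℝ) :=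
  Measure.pi fun i => (P.dist i).law

/-- The size of the input: number of elements plus total number of table rows. -/
def size (P : Market n) : ℕ :=
  n + ∑ i, (P.dist i).rows.length

/-- The utility, for the additive value function, of probing `A` and selecting `I` when the
values are `x`. -/
def utility (P : Market n) (x : Fin n → ℝ) (A I : Finset (Fin n)) : ℝ :=
  ∑ i ∈ I, x i - ∑ i ∈ A, P.price i

end Market

/-! ## Arbitrary adaptive policies (no computational restriction) -/

/-- An adaptive policy is a decision tree: it either halts with a selected set, or probes an
element and continues depending on the value that it sees. -/
inductive Policy (n : ℕ) where
  | halt (I : Finset (Fin n))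
  | probe (i : Fin n) (next : ℝ → Policy n)

/-- Run a policy on the values `x`, where `A` has been probed already; the result consists of the
set of all probed elements and the selected set. -/
def Policy.run {n : ℕ} (x : Fin n → ℝ) :
    Policy n → Finset (Fin n) → Finset (Fin n) × Finset (Fin n)
  | .halt I, A => (A, I)
  | .probe i next, A => Policy.run x (next (x i)) (insert i A)

/-- A randomized policy `T` (with random seed in `Ω`) is admissible for the constraint `F` if it
always selects a feasible set of probed elements, and its outcome is measurable. -/
def Admissible {n : ℕ} (F : Set (Finset (Fin n))) {Ω : Type} [MeasurableSpace Ω]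
    (T : Ω → Policy n) : Prop :=
  (∀ θ x, ((T θ).run x ∅).2 ⊆ ((T θ).run x ∅).1 ∧ ((T θ).run x ∅).2 ∈ F) ∧
  ∀ o : Finset (Fin n) × Finset (Fin n),
    MeasurableSet {z : Ω × (Fin n → ℝ) | (T z.1).run z.2 ∅ = o}

/-- Expected utility of a randomized policy whose seed has law `ν`, independent of the values. -/
def policyUtility {n : ℕ} (P : Market n) {Ω : Type} [MeasurableSpace Ω] (ν : Measure Ω)
    (T : Ω → Policy n) : ℝ :=
  ∫ z : Ω × (Fin n → ℝ), P.utility z.2 ((T z.1).run z.2 ∅).1 ((T z.1).run z.2 ∅).2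
    ∂(ν.prod P.joint)

/-! ## Algorithms: programs for a probing real RAM

The memory holds cells with a natural number, and cells with a real number. A cell has an address
`(a, i, j)`, where `a` is fixed in the program and `i`, `j` are computed. There is addition
and truncated subtraction of natural numbers, and exact arithmetic and comparison of real numbers
(no rounding, no constants except natural numbers). Each executed command costs one step.
All loops are counting loops, so every program terminates. The value of an element enters the
memory only when the element is probed. -/

inductive NatExpr where
  | lit (k : ℕ)
  | cell (a : ℕ) (i j : NatExpr)
  | add (e f : NatExpr)
  | sub (e f : NatExpr)

inductive RealExpr where
  | lit (k : ℕ)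
  | cell (a : ℕ) (i j : NatExpr)
  | add (e f : RealExpr)
  | sub (e f : RealExpr)
  | mul (e f : RealExpr)
  | div (e f : RealExpr)

inductive Test where
  | natLe (e f : NatExpr)
  | realLe (e f : RealExpr)
  | not (b : Test)
  | and (b c : Test)

/-- Programs.
* `setNat a i j e` and `setReal a i j e` assign to the cell `(a, i, j)`;
* `loop a e c` runs `c` for `0, 1, …, e - 1` in the natural-number cell `(a, 0, 0)`;
* `probe a i` probes element `i` and writes its value to the real cell `(a, i, 0)`;
* `select i` puts element `i` into the selected set;
* `flip a` writes a fair random bit to the natural-number cell `(a, 0, 0)`;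
* `askLaw a i e` writes the answer of the oracle of element `i`, at the real number `e`, to the
  real cell `(a, 0, 0)`;
* `askFeasible a b` asks the feasibility oracle about the set of all elements `i` with a non-zero
  natural number in cell `(b, i, 0)`, and writes the answer (`1` for yes, `0` for no) to the
  natural-number cell `(a, 0, 0)`. -/
inductive Program where
  | skip
  | setNat (a : ℕ) (i j : NatExpr) (e : NatExpr)
  | setReal (a : ℕ) (i j : NatExpr) (e : RealExpr)
  | seq (c d : Program)
  | ite (b : Test) (c d : Program)
  | loop (a : ℕ) (e : NatExpr) (c : Program)
  | probe (a : ℕ) (i : NatExpr)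
  | select (i : NatExpr)
  | flip (a : ℕ)
  | askLaw (a : ℕ) (i : NatExpr) (e : RealExpr)
  | askFeasible (a b : ℕ)

structure State (n : ℕ) where
  natMem : ℕ → ℕ → ℕ → ℕ
  realMem : ℕ → ℕ → ℕ → ℝ
  probed : Finset (Fin n)
  selected : Finset (Fin n)
  flips : ℕ
  steps : ℕ

namespace State

variable {n : ℕ}

def tick (s : State n) : State n := { s with steps := s.steps + 1 }

def writeNat (s : State n) (a i j v : ℕ) : State n :=
  { s with natMem := fun a' i' j' => if a' = a ∧ i' = i ∧ j' = j then v else s.natMem a' i' j' }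

def writeReal (s : State n) (a i j : ℕ) (v : ℝ) : State n :=
  { s with realMem := fun a' i' j' => if a' = a ∧ i' = i ∧ j' = j then v else s.realMem a' i' j' }

end State

variable {n : ℕ}

def NatExpr.eval (s : State n) : NatExpr → ℕ
  | .lit k => k
  | .cell a i j => s.natMem a (i.eval s) (j.eval s)
  | .add e f => e.eval s + f.eval s
  | .sub e f => e.eval s - f.eval s

def RealExpr.eval (s : State n) : RealExpr → ℝ
  | .lit k => (k : ℝ)
  | .cell a i j => s.realMem a (i.eval s) (j.eval s)
  | .add e f => e.eval s + f.eval s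
  | .sub e f => e.eval s - f.eval s
  | .mul e f => e.eval s * f.eval s
  | .div e f => e.eval s / f.eval s

def Test.holds (s : State n) : Test → Prop
  | .natLe e f => e.eval s ≤ f.eval s
  | .realLe e f => e.eval s ≤ f.eval s
  | .not b => ¬ b.holds s
  | .and b c => b.holds s ∧ c.holds s

/-- `repeatFor f m s` is `f (m - 1) (… (f 1 (f 0 s)))`. -/
def repeatFor {α : Type} (f : ℕ → α → α) : ℕ → α → α
  | 0, s => s
  | m + 1, s => f m (repeatFor f m s)

/-- The world in which a program runs: the laws behind their oracles, the feasibility oracle,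
the random bits, and the realized values. -/
structure World (n : ℕ) where
  dist : Fin n → KnownLaw
  feasible : Set (Finset (Fin n))
  bits : ℕ → Bool
  values : Fin n → ℝ

open Classical in
/-- Execution of a program, with its number of steps. -/
def Program.exec (w : World n) : Program → State n → State n
  | .skip, s => s.tick
  | .setNat a i j e, s => (s.writeNat a (i.eval s) (j.eval s) (e.eval s)).tick
  | .setReal a i j e, s => (s.writeReal a (i.eval s) (j.eval s) (e.eval s)).tick
  | .seq c d, s => Program.exec w d (Program.exec w c s)
  | .ite b c d, s => if b.holds s then Program.exec w c s.tick else Program.exec w d s.tick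
  | .loop a e c, s =>
      repeatFor (fun t s' => Program.exec w c (s'.writeNat a 0 0 t).tick) (e.eval s) s.tick
  | .probe a i, s =>
      if h : i.eval s < n then
        { (s.writeReal a (i.eval s) 0 (w.values ⟨i.eval s, h⟩)).tick with
          probed := insert ⟨i.eval s, h⟩ s.probed }
      else s.tick
  | .select i, s =>
      if h : i.eval s < n then { s.tick with selected := insert ⟨i.eval s, h⟩ s.selected }
      else s.tick
  | .flip a, s =>
      { (s.writeNat a 0 0 (w.bits s.flips).toNat).tick with flips := s.flips + 1 }
  | .askLaw a i e, s =>
      if h : i.eval s < n then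
        (s.writeReal a 0 0 ((w.dist ⟨i.eval s, h⟩).answer (e.eval s))).tick
      else s.tick
  | .askFeasible a b, s =>
      (s.writeNat a 0 0
        (if Finset.univ.filter (fun i : Fin n => s.natMem b i 0 ≠ 0) ∈ w.feasible
          then 1 else 0)).tick

/-- Extend a vector by zeros. -/
def pad {α : Type} [Zero α] (f : Fin n → α) (i : ℕ) : α :=
  if h : i < n then f ⟨i, h⟩ else 0

/-- What an algorithm is told about the constraint: access to a feasibility oracle, and vectors of
natural and of real numbers. -/
structure Description (n : ℕ) where
  feasible : Set (Finset (Fin n))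
  nats : ℕ → ℕ → ℕ
  reals : ℕ → ℕ → ℝ

/-- The initial state. The natural-number cells hold `n` in `(0, 0, 0)`, the number of rows in the
table of element `i` in `(1, i, 0)`, and the description of the constraint in `(2, ·, 0)`,
`(3, ·, 0)`, …; the real cells hold the price of element `i` in `(0, i, 0)`, its table in
`(1, i, j)` (values) and `(2, i, j)` (probabilities), and the description of the constraint in
`(3, ·, 0)`, `(4, ·, 0)`, …. All other cells hold `0`. -/
def startState (P : Market n) (D : Description n) : State n where
  natMem
    | 0, 0, 0 => n
    | 1, i, 0 => pad (fun v => (P.dist v).rows.length) i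
    | a + 2, i, 0 => D.nats a i
    | _, _, _ => 0
  realMem
    | 0, i, 0 => pad P.price i
    | 1, i, j => pad (fun v => ((P.dist v).rows.getD j (0, 0)).1) i
    | 2, i, j => pad (fun v => ((P.dist v).rows.getD j (0, 0)).2) i
    | a + 3, i, 0 => D.reals a i
    | _, _, _ => 0
  probed := ∅
  selected := ∅
  flips := 0
  steps := 0

/-- The final state of a program, for given random bits and given values. -/
def Program.final (p : Program) (P : Market n) (D : Description n) (ω : ℕ → Bool)
    (x : Fin n → ℝ) : State n :=
  p.exec ⟨P.dist, D.feasible, ω, x⟩ (startState P D)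

/-- The law of an infinite sequence of independent fair bits. -/
def fairBits : Measure (ℕ → Bool) :=
  Measure.infinitePi fun _ => (PMF.uniformOfFintype Bool).toMeasure

/-- The utility that a program achieves, for given random bits and given values. -/
def Program.utility (p : Program) (P : Market n) (D : Description n)
    (z : (ℕ → Bool) × (Fin n → ℝ)) : ℝ :=
  P.utility z.2 (p.final P D z.1 z.2).probed (p.final P D z.1 z.2).selected

/-- On the market `P` with feasible sets `F`, which are described to the program by `D`, the
program always selects a feasible set of probed elements, within the time bound `N`, and
its expected utility is at least a `1 / α` fraction of that of every randomized adaptive policy. -/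
def Program.Approximates (p : Program) (P : Market n) (F : Set (Finset (Fin n)))
    (D : Description n) (α : ℝ) (N : ℕ) : Prop :=
  (∀ ω x,
    (p.final P D ω x).selected ⊆ (p.final P D ω x).probed ∧
    (p.final P D ω x).selected ∈ F ∧
    (p.final P D ω x).steps ≤ N) ∧
  Integrable (p.utility P D) (fairBits.prod P.joint) ∧
  ∀ (Ω : Type) [MeasurableSpace Ω] (ν : Measure Ω) [IsProbabilityMeasure ν]
    (T : Ω → Policy n), Admissible F T →
      (1 / α) * policyUtility P ν T ≤ ∫ z, p.utility P D z ∂(fairBits.prod P.joint)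

/-! ## Packing constraints -/

/-- `F` is a `k`-system: any two maximal independent subsets `A`, `B` of the same set `Y` satisfy
`|A| ≤ k |B|`. -/
def IsKSystem (F : Set (Finset (Fin n))) (k : ℝ) : Prop :=
  ∀ Y A B : Finset (Fin n), Maximal (fun S => S ∈ F ∧ S ⊆ Y) A →
    Maximal (fun S => S ∈ F ∧ S ⊆ Y) B → (A.card : ℝ) ≤ k * B.card

/-- A constraint that is given by a feasibility oracle. -/
def byOracle (F : Set (Finset (Fin n))) : Description n where
  feasible := F
  nats _ _ := 0
  reals _ _ := 0

/-- The independent sets of a matroid. -/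
def matroidSets (M : Matroid (Fin n)) : Set (Finset (Fin n)) :=
  {I | M.Indep (I : Set (Fin n))}

/-- The sets of items that fit into a knapsack of size `B`. -/
def knapsackSets (B : ℝ) (size : Fin n → ℝ) : Set (Finset (Fin n)) :=
  {I | ∑ i ∈ I, size i ≤ B}

/-- The knapsack size `B` and the item sizes, without a feasibility oracle. -/
def knapsackDescription (B : ℝ) (size : Fin n → ℝ) : Description n where
  feasible := ∅
  nats _ _ := 0
  reals
    | 0, 0 => B
    | 1, i => pad size i
    | _, _ => 0

/-- The matchings of a graph whose edges are numbered by `e`. -/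
def matchingSets {m : ℕ} {G : SimpleGraph (Fin m)} (e : Fin n ≃ G.edgeSet) :
    Set (Finset (Fin n)) :=
  {I | ∀ i ∈ I, ∀ j ∈ I, i ≠ j → ∀ v, ¬ (v ∈ (e i : Sym2 (Fin m)) ∧ v ∈ (e j : Sym2 (Fin m)))}

/-- The two end points of each edge, without a feasibility oracle. -/
def graphDescription {m : ℕ} (u v : Fin n → Fin m) : Description n where
  feasible := ∅
  nats
    | 0, i => pad (fun l => (u l : ℕ)) i
    | 1, i => pad (fun l => (v l : ℕ)) i
    | _, _ => 0
  reals _ _ := 0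

end PriceOfInfo

end

open PriceOfInfo

/-! Give each element of positive price its grade τᵢ, the number with 𝔼[(Xᵢ − τᵢ)⁺] = πᵢ, and cap
its value: Yᵢ = min(Xᵢ, τᵢ). A free element keeps Yᵢ = Xᵢ. In both cases 𝔼[Xᵢ − Yᵢ] = πᵢ. The
decision to probe i does not depend on Xᵢ, so paying the price costs as much in expectation as
giving up Xᵢ − Yᵢ on every probed element. Expected utility therefore equals the expected sum of Yᵢ
over selected elements, minus that of Xᵢ − Yᵢ ≥ 0 over probed but unselected ones
(`integral_utility`). Hence no policy earns more than the expectation of max over O ∈ F of ∑ Yᵢ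
(`policyUtility_le`), while a program that selects every probed element with Yᵢ < Xᵢ earns exactly
its capped sum (`Program.approximates_of_capped`). What remains is a pointwise approximation of the
maximal capped sum by such a program.

Greedy selection can be run in this way. Every element has an index, which is its grade before
probing and its value if it was probed without being selected. Each round takes the largest positive
ratio of index to weight and discards the element if it does not fit. Otherwise the element is
probed; it is selected if its value reaches the index, and else its index drops to the value. The
selected set is then greedy for the ratios of Yᵢ to the weights (`greedyProgram_exec`), after at
most 2n rounds.

For a k-system with unit weights, the selected elements with Yᵢ ≥ t form a maximal feasible subset
of {Yᵢ ≥ t}; comparing cardinalities and integrating over t gives the factor k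
(`IsGreedy.sum_le_of_isKSystem`). Matroids are 1-systems and matchings are 2-systems. For a
knapsack, the optimum is at most the greedy sum by density plus the best single item
(`IsGreedy.sum_le_of_knapsack`). A fair coin, flipped before any probing, chooses which of the two
to pursue, and this gives the factor 2.

On the machine side, loops bounded by input cells give polynomial time
(`Tame.exists_polynomial_time`), executions are measurable (`MeasurableState.exec`), and the grade
of a finite table is computable as a maximum of ratios over its rows (`gradeProgram_exec`). -/

noncomputable section

namespace PriceOfInfo

variable {n : ℕ}

/-! ## Field access -/

namespace State

variable (s : State n) (a i j v : ℕ) (r : ℝ)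

@[simp] theorem tick_natMem : s.tick.natMem = s.natMem := rfl
@[simp] theorem tick_realMem : s.tick.realMem = s.realMem := rfl
@[simp] theorem tick_probed : s.tick.probed = s.probed := rfl
@[simp] theorem tick_selected : s.tick.selected = s.selected := rfl
@[simp] theorem tick_steps : s.tick.steps = s.steps + 1 := rfl
@[simp] theorem writeNat_realMem : (s.writeNat a i j v).realMem = s.realMem := rfl
@[simp] theorem writeNat_probed : (s.writeNat a i j v).probed = s.probed := rfl
@[simp] theorem writeNat_selected : (s.writeNat a i j v).selected = s.selected := rfl
@[simp] theorem writeNat_steps : (s.writeNat a i j v).steps = s.steps := rfl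
@[simp] theorem writeReal_natMem : (s.writeReal a i j r).natMem = s.natMem := rfl
@[simp] theorem writeReal_probed : (s.writeReal a i j r).probed = s.probed := rfl
@[simp] theorem writeReal_selected : (s.writeReal a i j r).selected = s.selected := rfl
@[simp] theorem writeReal_steps : (s.writeReal a i j r).steps = s.steps := rfl

theorem writeNat_natMem (a' i' j' : ℕ) : (s.writeNat a i j v).natMem a' i' j' =
    if a' = a ∧ i' = i ∧ j' = j then v else s.natMem a' i' j' := rfl

theorem writeReal_realMem (a' i' j' : ℕ) : (s.writeReal a i j r).realMem a' i' j' =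
    if a' = a ∧ i' = i ∧ j' = j then r else s.realMem a' i' j' := rfl

theorem writeNat_natMem_of_ne {a a' : ℕ} (h : a' ≠ a) :
    (s.writeNat a i j v).natMem a' = s.natMem a' := by
  funext i' j'
  simp [writeNat_natMem, h]

theorem writeReal_realMem_of_ne {a a' : ℕ} (h : a' ≠ a) :
    (s.writeReal a i j r).realMem a' = s.realMem a' := by
  funext i' j'
  simp [writeReal_realMem, h]

end State

/-! ### Loop invariants -/

theorem repeatFor_induct {α : Type} {f : ℕ → α → α} {I : ℕ → α → Prop} {m : ℕ} {s : α}
    (h0 : I 0 s) (hs : ∀ t s', t < m → I t s' → I (t + 1) (f t s')) :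
    I m (repeatFor f m s) := by
  induction m with
  | zero => exact h0
  | succ m ih =>
    exact hs m _ (Nat.lt_succ_self m) (ih fun t s' ht => hs t s' (ht.trans (Nat.lt_succ_self m)))

namespace Program

theorem exec_loop_induct {w : World n} {a : ℕ} {e : NatExpr} {c : Program} {s : State n}
    (I : ℕ → State n → Prop) (h0 : I 0 s.tick)
    (hs : ∀ t s', t < e.eval s → I t s' → I (t + 1) (c.exec w (s'.writeNat a 0 0 t).tick)) :
    I (e.eval s) (Program.exec w (.loop a e c) s) := by
  simp only [Program.exec]
  exact repeatFor_induct h0 hs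

/-! ## Frame properties -/

/-- The program may write to natural-number cells in region `a`. -/
def WritesNat (a : ℕ) : Program → Prop
  | .setNat b _ _ _ => a = b
  | .seq c d => WritesNat a c ∨ WritesNat a d
  | .ite _ c d => WritesNat a c ∨ WritesNat a d
  | .loop b _ c => a = b ∨ WritesNat a c
  | .flip b => a = b
  | .askFeasible b _ => a = b
  | _ => False

/-- The program may write to real cells in region `a`. -/
def WritesReal (a : ℕ) : Program → Prop
  | .setReal b _ _ _ => a = b
  | .seq c d => WritesReal a c ∨ WritesReal a d
  | .ite _ c d => WritesReal a c ∨ WritesReal a d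
  | .loop _ _ c => WritesReal a c
  | .probe b _ => a = b
  | .askLaw b _ _ => a = b
  | _ => False

/-- The program contains no instruction that probes or selects an element. -/
def Silent : Program → Prop
  | .seq c d => Silent c ∧ Silent d
  | .ite _ c d => Silent c ∧ Silent d
  | .loop _ _ c => Silent c
  | .probe _ _ => False
  | .select _ => False
  | _ => True

theorem exec_natMem {w : World n} {a : ℕ} {p : Program} (h : ¬ p.WritesNat a) (s : State n) :
    (p.exec w s).natMem a = s.natMem a := by
  induction p generalizing s with
  | setNat b i j e => exact s.writeNat_natMem_of_ne _ _ _ h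
  | seq c d ihc ihd =>
    simp only [WritesNat, not_or] at h
    simp only [exec]
    rw [ihd h.2, ihc h.1]
  | ite b c d ihc ihd =>
    simp only [WritesNat, not_or] at h
    simp only [exec]
    split_ifs
    · rw [ihc h.1]; rfl
    · rw [ihd h.2]; rfl
  | loop b e c ih =>
    simp only [WritesNat, not_or] at h
    refine exec_loop_induct (fun _ s' => s'.natMem a = s.natMem a) rfl fun t s' _ hs => ?_
    rw [ih h.2, State.tick_natMem, State.writeNat_natMem_of_ne _ _ _ _ h.1, hs]
  | flip b => exact s.writeNat_natMem_of_ne _ _ _ h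
  | askFeasible b c => exact s.writeNat_natMem_of_ne _ _ _ h
  | probe b i => simp only [exec]; split_ifs <;> rfl
  | select i => simp only [exec]; split_ifs <;> rfl
  | askLaw b i e => simp only [exec]; split_ifs <;> rfl
  | skip => rfl
  | setReal => rfl

theorem exec_realMem {w : World n} {a : ℕ} {p : Program} (h : ¬ p.WritesReal a) (s : State n) :
    (p.exec w s).realMem a = s.realMem a := by
  induction p generalizing s with
  | setReal b i j e => exact s.writeReal_realMem_of_ne _ _ _ h
  | seq c d ihc ihd =>
    simp only [WritesReal, not_or] at h
    simp only [exec]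
    rw [ihd h.2, ihc h.1]
  | ite b c d ihc ihd =>
    simp only [WritesReal, not_or] at h
    simp only [exec]
    split_ifs
    · rw [ihc h.1]; rfl
    · rw [ihd h.2]; rfl
  | loop b e c ih =>
    refine exec_loop_induct (fun _ s' => s'.realMem a = s.realMem a) rfl fun t s' _ hs => ?_
    rw [ih h, State.tick_realMem, State.writeNat_realMem, hs]
  | probe b i =>
    simp only [exec]
    split_ifs
    · exact s.writeReal_realMem_of_ne _ _ _ h
    · rfl
  | askLaw b i e =>
    simp only [exec]
    split_ifs
    · exact s.writeReal_realMem_of_ne _ _ _ h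
    · rfl
  | select i => simp only [exec]; split_ifs <;> rfl
  | skip => rfl
  | setNat => rfl
  | flip => rfl
  | askFeasible => rfl

theorem Silent.exec_eq {w : World n} {p : Program} (h : p.Silent) (s : State n) :
    (p.exec w s).probed = s.probed ∧ (p.exec w s).selected = s.selected := by
  induction p generalizing s with
  | seq c d ihc ihd =>
    simp only [exec]
    rw [(ihd h.2 _).1, (ihd h.2 _).2]
    exact ihc h.1 s
  | ite b c d ihc ihd =>
    simp only [exec]
    split_ifs
    · exact ihc h.1 _
    · exact ihd h.2 _
  | loop b e c ih =>
    refine exec_loop_induct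
      (fun _ s' => s'.probed = s.probed ∧ s'.selected = s.selected) ⟨rfl, rfl⟩ fun t s' _ hs => ?_
    rw [(ih h _).1, (ih h _).2]
    exact hs
  | probe b i => exact h.elim
  | select i => exact h.elim
  | askLaw b i e => simp only [exec]; split_ifs <;> exact ⟨rfl, rfl⟩
  | skip => exact ⟨rfl, rfl⟩
  | setNat => exact ⟨rfl, rfl⟩
  | setReal => exact ⟨rfl, rfl⟩
  | flip => exact ⟨rfl, rfl⟩
  | askFeasible => exact ⟨rfl, rfl⟩

/-! ## Polynomial time -/

end Program

/-- The value of the expression is controlled by the input cells in regions `0` and `1`. -/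
def NatExpr.IsInput : NatExpr → Prop
  | .lit _ => True
  | .cell a _ _ => a ≤ 1
  | .add e f => e.IsInput ∧ f.IsInput
  | .sub e _ => e.IsInput

theorem NatExpr.IsInput.exists_bound {e : NatExpr} (h : e.IsInput) :
    ∃ K, ∀ (n : ℕ) (s : State n) (N : ℕ), (∀ a ≤ 1, ∀ i j, s.natMem a i j ≤ N) →
      e.eval s ≤ K * (N + 1) := by
  induction e with
  | lit k => exact ⟨k, fun n s N _ => Nat.le_mul_of_pos_right k N.succ_pos⟩
  | cell a i j => exact ⟨1, fun n s N hN => (hN a h _ _).trans (by omega)⟩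
  | add e f ihe ihf =>
    obtain ⟨K, hK⟩ := ihe h.1
    obtain ⟨L, hL⟩ := ihf h.2
    refine ⟨K + L, fun n s N hN => ?_⟩
    simp only [NatExpr.eval, add_mul]
    exact add_le_add (hK n s N hN) (hL n s N hN)
  | sub e f ihe ihf =>
    obtain ⟨K, hK⟩ := ihe h
    exact ⟨K, fun n s N hN => (Nat.sub_le _ _).trans (hK n s N hN)⟩

namespace Program

/-- All loops are bounded by input cells, which are never overwritten. -/
def Tame : Program → Prop
  | .setNat a _ _ _ => 2 ≤ a
  | .seq c d => Tame c ∧ Tame d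
  | .ite _ c d => Tame c ∧ Tame d
  | .loop a e c => 2 ≤ a ∧ e.IsInput ∧ Tame c
  | .flip a => 2 ≤ a
  | .askFeasible a _ => 2 ≤ a
  | _ => True

theorem Tame.not_writesNat {p : Program} (h : p.Tame) {a : ℕ} (ha : a ≤ 1) : ¬ p.WritesNat a := by
  induction p with
  | setNat b i j e => simp only [Tame] at h; simp only [WritesNat]; omega
  | seq c d ihc ihd => exact not_or.2 ⟨ihc h.1, ihd h.2⟩
  | ite b c d ihc ihd => exact not_or.2 ⟨ihc h.1, ihd h.2⟩
  | loop b e c ih =>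
    refine not_or.2 ⟨?_, ih h.2.2⟩
    have := h.1
    omega
  | flip b => simp only [Tame] at h; simp only [WritesNat]; omega
  | askFeasible b c => simp only [Tame] at h; simp only [WritesNat]; omega
  | _ => simp [WritesNat]

/-- Regions `0` and `1` are never written, so a bound `N` on them persists throughout the run. Each
loop then makes at most a constant times `N + 1` iterations, and nesting loops adds up the
exponents. -/
theorem Tame.exists_steps_le {p : Program} (h : p.Tame) :
    ∃ C d, ∀ (n : ℕ) (w : World n) (s : State n) (N : ℕ),
      (∀ a ≤ 1, ∀ i j, s.natMem a i j ≤ N) →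
        (p.exec w s).steps ≤ s.steps + C * (N + 1) ^ d := by
  have hmono : ∀ (N d e : ℕ), (N + 1) ^ d ≤ (N + 1) ^ (d + e) := fun N d e =>
    Nat.pow_le_pow_right N.succ_pos (Nat.le_add_right d e)
  induction p with
  | seq c d ihc ihd =>
    obtain ⟨C, k, hC⟩ := ihc h.1
    obtain ⟨D, l, hD⟩ := ihd h.2
    refine ⟨C + D, k + l, fun n w s N hN => ?_⟩
    have h1 := hC n w s N hN
    have h2 := hD n w (c.exec w s) N fun a ha i j => by
      rw [exec_natMem (h.1.not_writesNat ha)]; exact hN a ha i j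
    have h3 := Nat.mul_le_mul_left C (hmono N k l)
    have h4 := Nat.mul_le_mul_left D (hmono N l k)
    rw [add_comm l k] at h4
    simp only [exec, add_mul]
    omega
  | ite b c d ihc ihd =>
    obtain ⟨C, k, hC⟩ := ihc h.1
    obtain ⟨D, l, hD⟩ := ihd h.2
    refine ⟨1 + C + D, k + l, fun n w s N hN => ?_⟩
    have h1 := hC n w s.tick N hN
    have h2 := hD n w s.tick N hN
    have h3 := Nat.mul_le_mul_left C (hmono N k l)
    have h4 := Nat.mul_le_mul_left D (hmono N l k)
    have h5 : 1 ≤ (N + 1) ^ (k + l) := Nat.one_le_pow _ _ N.succ_pos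
    rw [add_comm l k] at h4
    simp only [exec, add_mul]
    simp only [State.tick_steps] at h1 h2
    split_ifs <;> omega
  | loop b e c ih =>
    obtain ⟨C, d, hC⟩ := ih h.2.2
    obtain ⟨K, hK⟩ := h.2.1.exists_bound
    refine ⟨1 + K * (1 + C), d + 1, fun n w s N hN => ?_⟩
    have key := exec_loop_induct (w := w) (a := b) (e := e) (c := c) (s := s)
      (fun t s' => (∀ a ≤ 1, ∀ i j, s'.natMem a i j ≤ N) ∧
        s'.steps ≤ s.steps + 1 + t * ((1 + C) * (N + 1) ^ d)) ⟨hN, by simp⟩ fun t s' _ hs => by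
        have hN' : ∀ a ≤ 1, ∀ i j, ((s'.writeNat b 0 0 t).tick).natMem a i j ≤ N := by
          intro a ha i j
          have hb := h.1
          rw [State.tick_natMem, State.writeNat_natMem_of_ne _ _ _ _ (by omega)]
          exact hs.1 a ha i j
        refine ⟨fun a ha i j => ?_, ?_⟩
        · rw [exec_natMem (h.2.2.not_writesNat ha)]
          exact hN' a ha i j
        · have h1 := hC n w _ N hN'
          have h5 : 1 ≤ (N + 1) ^ d := Nat.one_le_pow _ _ N.succ_pos
          simp only [State.tick_steps, State.writeNat_steps] at h1
          have h2 := hs.2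
          simp only [add_mul, one_mul] at h2 ⊢
          omega
    have h1 : e.eval s * ((1 + C) * (N + 1) ^ d) ≤ K * (1 + C) * (N + 1) ^ (d + 1) :=
      calc e.eval s * ((1 + C) * (N + 1) ^ d)
          ≤ (K * (N + 1)) * ((1 + C) * (N + 1) ^ d) := Nat.mul_le_mul_right _ (hK n s N hN)
        _ = K * (1 + C) * (N + 1) ^ (d + 1) := by ring
    have h5 : 1 ≤ (N + 1) ^ (d + 1) := Nat.one_le_pow _ _ N.succ_pos
    have h6 := key.2
    rw [add_mul 1, one_mul]
    omega
  | probe b i =>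
    exact ⟨1, 0, fun n w s N _ => by simp only [exec]; split_ifs <;> simp [State.tick]⟩
  | select i => exact ⟨1, 0, fun n w s N _ => by simp only [exec]; split_ifs <;> simp [State.tick]⟩
  | askLaw b i e =>
    exact ⟨1, 0, fun n w s N _ => by simp only [exec]; split_ifs <;> simp [State.tick]⟩
  | _ => exact ⟨1, 0, fun n w s N _ => by simp [exec, State.tick]⟩

theorem Tame.exists_polynomial_time {p : Program} (h : p.Tame) :
    ∃ C d, ∀ (n : ℕ) (P : Market n) (D : Description n) (ω : ℕ → Bool) (x : Fin n → ℝ),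
      (p.final P D ω x).steps ≤ C * (P.size + 1) ^ d := by
  obtain ⟨C, d, hC⟩ := h.exists_steps_le
  refine ⟨C, d, fun n P D ω x => ?_⟩
  have := hC n ⟨P.dist, D.feasible, ω, x⟩ (startState P D) P.size fun a ha i j => by
    interval_cases a
    · rcases i with _ | i <;> rcases j with _ | j <;> simp [startState, Market.size]
    · rcases j with _ | j
      · simp only [startState, pad]
        split_ifs with hi
        · have := Finset.single_le_sum (f := fun i => (P.dist i).rows.length)
            (fun _ _ => Nat.zero_le _) (Finset.mem_univ (⟨i, hi⟩ : Fin n))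
          rw [Market.size]
          omega
        · simp
      · simp [startState]
  simpa [final, startState] using this

/-! ## The decision to probe an element does not depend on its value -/

theorem probed_subset_exec (w : World n) (p : Program) (s : State n) :
    s.probed ⊆ (p.exec w s).probed := by
  induction p generalizing s with
  | seq c d ihc ihd => exact (ihc s).trans (ihd _)
  | ite b c d ihc ihd =>
    simp only [exec]
    split_ifs
    · exact ihc s.tick
    · exact ihd s.tick
  | loop b e c ih =>
    exact exec_loop_induct (fun _ s' => s.probed ⊆ s'.probed) (Finset.Subset.refl _)
      fun t s' _ hs => hs.trans (ih (s'.writeNat b 0 0 t).tick)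
  | probe b i =>
    simp only [exec]
    split_ifs
    · exact Finset.subset_insert _ _
    · exact Finset.Subset.refl _
  | select i => simp only [exec]; split_ifs <;> exact Finset.Subset.refl _
  | askLaw b i e => simp only [exec]; split_ifs <;> exact Finset.Subset.refl _
  | _ => exact Finset.Subset.refl _

/-- Two runs whose worlds differ only in the value of `i` stay identical until `i` is probed. After
that, `i` remains probed in both, since probed sets only grow. -/
theorem exec_eq_or_probed (w : World n) (v : Fin n → ℝ) (i : Fin n)
    (hv : ∀ j, j ≠ i → v j = w.values j) (p : Program) (s : State n) :
    p.exec { w with values := v } s = p.exec w s ∨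
      (i ∈ (p.exec { w with values := v } s).probed ∧ i ∈ (p.exec w s).probed) := by
  induction p generalizing s with
  | seq c d ihc ihd =>
    simp only [exec]
    rcases ihc s with h | h
    · rw [h]; exact ihd _
    · exact Or.inr ⟨probed_subset_exec _ _ _ h.1, probed_subset_exec _ _ _ h.2⟩
  | ite b c d ihc ihd =>
    simp only [exec]
    split_ifs
    · exact ihc _
    · exact ihd _
  | loop b e c ih =>
    simp only [exec]
    generalize e.eval s = m
    induction m with
    | zero => exact Or.inl rfl
    | succ m ihm =>
      simp only [repeatFor]
      rcases ihm with h | h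
      · rw [h]; exact ih _
      · exact Or.inr ⟨probed_subset_exec _ _ _ h.1, probed_subset_exec _ _ _ h.2⟩
  | probe b j =>
    simp only [exec]
    split_ifs with hj
    · by_cases hji : (⟨j.eval s, hj⟩ : Fin n) = i
      · right
        rw [hji]
        simp
      · left
        rw [hv _ hji]
    · exact Or.inl rfl
  | _ => exact Or.inl rfl

theorem mem_probed_final_update (p : Program) (P : Market n) (D : Description n) (ω : ℕ → Bool)
    (x : Fin n → ℝ) (i : Fin n) (v : ℝ) :
    i ∈ (p.final P D ω (Function.update x i v)).probed ↔ i ∈ (p.final P D ω x).probed := by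
  rcases exec_eq_or_probed ⟨P.dist, D.feasible, ω, x⟩ (Function.update x i v) i
    (fun j hj => Function.update_of_ne hj _ _) p (startState P D) with h | h
  · simp only [final]
    rw [h]
  · exact iff_of_true h.1 h.2

end Program

/-! ## Measurability of executions -/

/-- Computed addresses and loop counts take countably many values, so measurability may be checked
with each of them held fixed. -/
theorem measurable_apply_countable {Z β : Type} [MeasurableSpace Z] [MeasurableSpace β]
    {m : Z → ℕ} (hm : Measurable m) {g : ℕ → Z → β} (hg : ∀ k, Measurable (g k)) :
    Measurable fun z => g (m z) z :=
  (measurable_from_prod_countable_right (f := fun q : ℕ × Z => g q.1 q.2) hg).comp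
    (hm.prodMk measurable_id)

/-- A state that depends measurably on a parameter. -/
structure MeasurableState {Z : Type} [MeasurableSpace Z] (s : Z → State n) : Prop where
  natMem : ∀ a i j, Measurable fun z => (s z).natMem a i j
  realMem : ∀ a i j, Measurable fun z => (s z).realMem a i j
  probed : ∀ i, Measurable fun z => i ∈ (s z).probed
  selected : ∀ i, Measurable fun z => i ∈ (s z).selected
  flips : Measurable fun z => (s z).flips

namespace MeasurableState

variable {Z : Type} [MeasurableSpace Z] {s t : Z → State n}

theorem apply_countable {m : Z → ℕ} (hm : Measurable m) {g : ℕ → Z → State n}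
    (hg : ∀ k, MeasurableState (g k)) : MeasurableState fun z => g (m z) z where
  natMem a i j :=
    measurable_apply_countable hm (g := fun k z => (g k z).natMem a i j) fun k => (hg k).natMem a i j
  realMem a i j :=
    measurable_apply_countable hm (g := fun k z => (g k z).realMem a i j)
      fun k => (hg k).realMem a i j
  probed i :=
    measurable_apply_countable hm (g := fun k z => i ∈ (g k z).probed) fun k => (hg k).probed i
  selected i :=
    measurable_apply_countable hm (g := fun k z => i ∈ (g k z).selected) fun k => (hg k).selected i
  flips := measurable_apply_countable hm (g := fun k z => (g k z).flips) fun k => (hg k).flips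

open Classical in
theorem ite {b : Z → Prop} (hb : MeasurableSet {z | b z}) (hs : MeasurableState s)
    (ht : MeasurableState t) : MeasurableState fun z => if b z then s z else t z where
  natMem a i j := by
    simp only [apply_ite State.natMem, ite_apply]
    exact Measurable.ite hb (hs.natMem a i j) (ht.natMem a i j)
  realMem a i j := by
    simp only [apply_ite State.realMem, ite_apply]
    exact Measurable.ite hb (hs.realMem a i j) (ht.realMem a i j)
  probed i := by
    have : (fun z => i ∈ (if b z then s z else t z).probed) =
        fun z => if b z then i ∈ (s z).probed else i ∈ (t z).probed := by
      funext z; split_ifs <;> rfl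
    rw [this]
    exact Measurable.ite hb (hs.probed i) (ht.probed i)
  selected i := by
    have : (fun z => i ∈ (if b z then s z else t z).selected) =
        fun z => if b z then i ∈ (s z).selected else i ∈ (t z).selected := by
      funext z; split_ifs <;> rfl
    rw [this]
    exact Measurable.ite hb (hs.selected i) (ht.selected i)
  flips := by
    simp only [apply_ite State.flips]
    exact Measurable.ite hb hs.flips ht.flips

theorem tick (hs : MeasurableState s) : MeasurableState fun z => (s z).tick :=
  ⟨hs.natMem, hs.realMem, hs.probed, hs.selected, hs.flips⟩

theorem writeNat (hs : MeasurableState s) (a : ℕ) {i j v : Z → ℕ} (hi : Measurable i)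
    (hj : Measurable j) (hv : Measurable v) :
    MeasurableState fun z => (s z).writeNat a (i z) (j z) (v z) :=
  apply_countable hi (g := fun i z => (s z).writeNat a i (j z) (v z)) fun i =>
    apply_countable hj (g := fun j z => (s z).writeNat a i j (v z)) fun j =>
      { hs with
        natMem := fun a' i' j' => by
          simp only [State.writeNat_natMem]
          split_ifs
          exacts [hv, hs.natMem a' i' j'] }

theorem writeReal (hs : MeasurableState s) (a : ℕ) {i j : Z → ℕ} {v : Z → ℝ} (hi : Measurable i)
    (hj : Measurable j) (hv : Measurable v) :
    MeasurableState fun z => (s z).writeReal a (i z) (j z) (v z) :=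
  apply_countable hi (g := fun i z => (s z).writeReal a i (j z) (v z)) fun i =>
    apply_countable hj (g := fun j z => (s z).writeReal a i j (v z)) fun j =>
      { hs with
        realMem := fun a' i' j' => by
          simp only [State.writeReal_realMem]
          split_ifs
          exacts [hv, hs.realMem a' i' j'] }

theorem natEval (hs : MeasurableState s) (e : NatExpr) : Measurable fun z => e.eval (s z) := by
  induction e with
  | lit k => exact measurable_const
  | cell a i j ihi ihj =>
    exact measurable_apply_countable ihi (g := fun i z => (s z).natMem a i (j.eval (s z))) fun i =>
      measurable_apply_countable ihj (g := fun j z => (s z).natMem a i j) fun j => hs.natMem a i j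
  | add e f ihe ihf => exact ihe.add ihf
  | sub e f ihe ihf =>
    exact (Measurable.of_discrete (f := fun q : ℕ × ℕ => q.1 - q.2)).comp (ihe.prodMk ihf)

theorem realEval (hs : MeasurableState s) (e : RealExpr) : Measurable fun z => e.eval (s z) := by
  induction e with
  | lit k => exact measurable_const
  | cell a i j =>
    exact measurable_apply_countable (hs.natEval i)
      (g := fun i z => (s z).realMem a i (j.eval (s z))) fun i =>
      measurable_apply_countable (hs.natEval j) (g := fun j z => (s z).realMem a i j) fun j =>
        hs.realMem a i j
  | add e f ihe ihf => exact ihe.add ihf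
  | sub e f ihe ihf => exact ihe.sub ihf
  | mul e f ihe ihf => exact ihe.mul ihf
  | div e f ihe ihf => exact ihe.div ihf

theorem holds (hs : MeasurableState s) (b : Test) : MeasurableSet {z | b.holds (s z)} := by
  induction b with
  | natLe e f => exact measurableSet_le (hs.natEval e) (hs.natEval f)
  | realLe e f => exact measurableSet_le (hs.realEval e) (hs.realEval f)
  | not b ih => exact ih.compl
  | and b c ihb ihc => exact ihb.inter ihc

theorem exec {w : Z → World n} {dist : Fin n → KnownLaw} {F : Set (Finset (Fin n))}
    (hd : ∀ z, (w z).dist = dist) (hF : ∀ z, (w z).feasible = F)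
    (ha : ∀ i, Measurable (dist i).answer) (hb : ∀ k, Measurable fun z => (w z).bits k)
    (hv : ∀ i, Measurable fun z => (w z).values i) (p : Program) (hs : MeasurableState s) :
    MeasurableState fun z => p.exec (w z) (s z) := by
  induction p generalizing s with
  | skip => exact hs.tick
  | setNat a i j e => exact (hs.writeNat a (hs.natEval i) (hs.natEval j) (hs.natEval e)).tick
  | setReal a i j e => exact (hs.writeReal a (hs.natEval i) (hs.natEval j) (hs.realEval e)).tick
  | seq c d ihc ihd => exact ihd (ihc hs)
  | ite b c d ihc ihd =>
    simp only [Program.exec]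
    exact ite (hs.holds b) (ihc hs.tick) (ihd hs.tick)
  | loop a e c ih =>
    simp only [Program.exec]
    refine apply_countable (hs.natEval e) (g := fun m z => repeatFor
      (fun t s' => c.exec (w z) (s'.writeNat a 0 0 t).tick) m (s z).tick) fun m => ?_
    induction m with
    | zero => exact hs.tick
    | succ m ihm =>
      exact ih (ihm.writeNat a measurable_const measurable_const measurable_const).tick
  | probe a i =>
    refine apply_countable (hs.natEval i) (g := fun k z => if h : k < n then
      { ((s z).writeReal a k 0 ((w z).values ⟨k, h⟩)).tick with
          probed := insert ⟨k, h⟩ (s z).probed } else (s z).tick) fun k => ?_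
    by_cases h : k < n
    · simp only [h, dif_pos]
      have := (hs.writeReal a (measurable_const (a := k)) (measurable_const (a := 0)) (hv ⟨k, h⟩)).tick
      exact { this with
        probed := fun j => by
          simp only [Finset.mem_insert]
          by_cases hj : j = ⟨k, h⟩
          · simp [hj]
          · simpa [hj] using hs.probed j }
    · simp only [h, dif_neg, not_false_eq_true]
      exact hs.tick
  | select i =>
    refine apply_countable (hs.natEval i) (g := fun k z => if h : k < n then
      { (s z).tick with selected := insert ⟨k, h⟩ (s z).selected } else (s z).tick) fun k => ?_
    by_cases h : k < n
    · simp only [h, dif_pos]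
      exact { hs.tick with
        selected := fun j => by
          simp only [Finset.mem_insert]
          by_cases hj : j = ⟨k, h⟩
          · simp [hj]
          · simpa [hj] using hs.selected j }
    · simp only [h, dif_neg, not_false_eq_true]
      exact hs.tick
  | flip a =>
    have hbit : Measurable fun z => ((w z).bits (s z).flips).toNat :=
      (Measurable.of_discrete (f := Bool.toNat)).comp
        (measurable_apply_countable hs.flips (g := fun k z => (w z).bits k) hb)
    have := (hs.writeNat a (measurable_const (a := 0)) (measurable_const (a := 0)) hbit).tick
    exact { this with flips := hs.flips.add_const 1 }
  | askLaw a i e =>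
    refine apply_countable (hs.natEval i) (g := fun k z => if h : k < n then
      ((s z).writeReal a 0 0 (((w z).dist ⟨k, h⟩).answer (e.eval (s z)))).tick
        else (s z).tick) fun k => ?_
    by_cases h : k < n
    · simp only [h, dif_pos, hd]
      exact (hs.writeReal a measurable_const measurable_const ((ha _).comp (hs.realEval e))).tick
    · simp only [h, dif_neg, not_false_eq_true]
      exact hs.tick
  | askFeasible a b =>
    -- Only finitely many sets can be queried, and each query is a measurable event; nothing is
    -- needed about the family behind the oracle.
    have hset : ∀ (T : Finset (Fin n)), MeasurableSet
        {z | Finset.univ.filter (fun i : Fin n => (s z).natMem b i 0 ≠ 0) = T} := by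
      intro T
      have : {z | Finset.univ.filter (fun i : Fin n => (s z).natMem b i 0 ≠ 0) = T} =
          ⋂ i : Fin n, {z | (s z).natMem b i 0 ≠ 0 ↔ i ∈ T} := by
        ext z
        simp [Finset.ext_iff]
      rw [this]
      refine MeasurableSet.iInter fun i => ?_
      exact (hs.natMem b i 0) (MeasurableSet.of_discrete (s := {k : ℕ | k ≠ 0 ↔ i ∈ T}))
    refine (hs.writeNat a measurable_const measurable_const ?_).tick
    refine Measurable.ite ?_ measurable_const measurable_const
    have : {z | Finset.univ.filter (fun i : Fin n => (s z).natMem b i 0 ≠ 0) ∈ (w z).feasible} =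
        ⋃ T ∈ F, {z | Finset.univ.filter (fun i : Fin n => (s z).natMem b i 0 ≠ 0) = T} := by
      ext z
      simp [hF]
    rw [this]
    exact MeasurableSet.biUnion (Set.to_countable F) fun T _ => hset T

end MeasurableState

/-! ## Expected excess and grades -/

section Excess

open Filter Topology

variable {μ : Measure ℝ}

theorem integrable_excess [IsFiniteMeasure μ] (h : Integrable (fun x : ℝ => x) μ) (t : ℝ) :
    Integrable (fun x => max (x - t) 0) μ :=
  (h.sub (integrable_const t)).pos_part

theorem excess_anti [IsFiniteMeasure μ] (h : Integrable (fun x : ℝ => x) μ) :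
    Antitone fun t => ∫ x, max (x - t) 0 ∂μ := fun s t hst =>
  integral_mono (integrable_excess h t) (integrable_excess h s) fun x =>
    max_le_max (by simp only; linarith) le_rfl

/-- Moving the threshold by δ moves each (x − t)⁺ by at most |δ|, so the expected excess is
1-Lipschitz. -/
theorem continuous_excess [IsProbabilityMeasure μ] (h : Integrable (fun x : ℝ => x) μ) :
    Continuous fun t => ∫ x, max (x - t) 0 ∂μ := by
  refine (LipschitzWith.of_le_add fun s t => ?_).continuous
  calc ∫ x, max (x - s) 0 ∂μ ≤ ∫ x, (max (x - t) 0 + dist s t) ∂μ := by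
        refine integral_mono (integrable_excess h s)
          ((integrable_excess h t).add (integrable_const _)) fun x => ?_
        simp only [Real.dist_eq]
        have h1 := neg_abs_le (s - t)
        have h2 := abs_nonneg (s - t)
        have h3 := le_max_left (x - t) 0
        have h4 := le_max_right (x - t) 0
        exact max_le (by linarith) (by linarith)
    _ = ∫ x, max (x - t) 0 ∂μ + dist s t := by
        rw [integral_add (integrable_excess h t) (integrable_const _)]
        simp

theorem tendsto_excess_atTop [IsProbabilityMeasure μ] (h : Integrable (fun x : ℝ => x) μ) :
    Tendsto (fun t => ∫ x, max (x - t) 0 ∂μ) atTop (𝓝 0) := by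
  have := tendsto_integral_filter_of_dominated_convergence (μ := μ) (l := atTop)
    (F := fun t x => max (x - t) 0) (f := fun _ => (0 : ℝ)) (fun x => |x|)
    (Eventually.of_forall fun t => (integrable_excess h t).aestronglyMeasurable)
    ((eventually_ge_atTop 0).mono fun t ht => Eventually.of_forall fun x => by
      rw [Real.norm_eq_abs, abs_of_nonneg (le_max_right _ _)]
      exact max_le (by linarith [le_abs_self x]) (abs_nonneg x))
    h.abs
    (Eventually.of_forall fun x => tendsto_const_nhds.congr' <|
      (eventually_ge_atTop x).mono fun t ht => (max_eq_right (by linarith)).symm)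
  simpa using this

theorem sub_le_excess [IsProbabilityMeasure μ] (h : Integrable (fun x : ℝ => x) μ) (t : ℝ) :
    (∫ x, x ∂μ) - t ≤ ∫ x, max (x - t) 0 ∂μ := by
  have : ∫ x, (x - t) ∂μ ≤ ∫ x, max (x - t) 0 ∂μ :=
    integral_mono (h.sub (integrable_const t)) (integrable_excess h t) fun x => le_max_left _ _
  rw [integral_sub h (integrable_const t)] at this
  simpa using this

theorem bddBelow_excess_le [IsProbabilityMeasure μ] (h : Integrable (fun x : ℝ => x) μ) (c : ℝ) :
    BddBelow {t : ℝ | ∫ x, max (x - t) 0 ∂μ ≤ c} :=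
  ⟨(∫ x, x ∂μ) - c, fun t ht => by
    have h1 := sub_le_excess h t
    have h2 : ∫ x, max (x - t) 0 ∂μ ≤ c := ht
    linarith⟩

theorem excess_excessInverse_le [IsProbabilityMeasure μ] (h : Integrable (fun x : ℝ => x) μ)
    {c : ℝ} (hc : 0 < c) : ∫ x, max (x - excessInverse μ c) 0 ∂μ ≤ c := by
  have hne : {t : ℝ | ∫ x, max (x - t) 0 ∂μ ≤ c}.Nonempty :=
    (((tendsto_excess_atTop h).eventually (gt_mem_nhds hc)).exists).imp fun t ht => le_of_lt ht
  exact (isClosed_le (continuous_excess h) continuous_const).csInf_mem hne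
    (bddBelow_excess_le h c)

/-- To the left of the infimum the excess is larger than `c`; continuity carries `c ≤ excess` over
to the infimum itself. -/
theorem excess_excessInverse [IsProbabilityMeasure μ] (h : Integrable (fun x : ℝ => x) μ)
    {c : ℝ} (hc : 0 < c) : ∫ x, max (x - excessInverse μ c) 0 ∂μ = c := by
  refine le_antisymm (excess_excessInverse_le h hc) ?_
  refine ge_of_tendsto ((continuous_excess h).continuousWithinAt
    (s := Set.Iio (excessInverse μ c)) (x := excessInverse μ c)) ?_
  filter_upwards [self_mem_nhdsWithin] with t ht
  by_contra! hlt
  exact absurd (csInf_le (bddBelow_excess_le h c) hlt.le) (not_le.2 ht)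

theorem excessInverse_le_iff [IsProbabilityMeasure μ] (h : Integrable (fun x : ℝ => x) μ)
    {c : ℝ} (hc : 0 < c) (t : ℝ) : excessInverse μ c ≤ t ↔ ∫ x, max (x - t) 0 ∂μ ≤ c :=
  ⟨fun ht => (excess_anti h ht).trans (excess_excessInverse_le h hc),
    fun ht => csInf_le (bddBelow_excess_le h c) ht⟩

/-- A program may ask its oracle at a real number computed from random values, so the answer has to
be measurable in the query. -/
theorem measurable_excessInverse [IsProbabilityMeasure μ] (h : Integrable (fun x : ℝ => x) μ) :
    Measurable (excessInverse μ) := by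
  refine measurable_of_Iic fun t => ?_
  -- Split by the sign of `c`. The Galois-type equivalence handles `c > 0`; the single point `c = 0`
  -- is measurable whatever happens there; for `c < 0` the set of thresholds is empty and its `sInf`
  -- is `0` by convention.
  have : excessInverse μ ⁻¹' Set.Iic t =
      (Set.Ioi 0 ∩ Set.Ici (∫ x, max (x - t) 0 ∂μ)) ∪
        (({0} ∩ excessInverse μ ⁻¹' Set.Iic t) ∪ (Set.Iio 0 ∩ {_c | 0 ≤ t})) := by
    ext c
    simp only [Set.mem_preimage, Set.mem_Iic, Set.mem_union, Set.mem_inter_iff, Set.mem_Ioi,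
      Set.mem_Ici, Set.mem_singleton_iff, Set.mem_Iio, Set.mem_ofPred_eq]
    rcases lt_trichotomy c 0 with hc | hc | hc
    · have : {t : ℝ | ∫ x, max (x - t) 0 ∂μ ≤ c} = ∅ :=
        Set.eq_empty_of_forall_notMem fun s hs =>
          absurd (le_trans (integral_nonneg fun x => le_max_right (x - s) 0) hs) (not_le.2 hc)
      have h0 : excessInverse μ c = 0 := by rw [excessInverse, this, Real.sInf_empty]
      simp [h0, hc, hc.ne, hc.not_gt]
    · simp [hc]
    · simp [hc, hc.ne', hc.not_gt, excessInverse_le_iff h hc]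
  rw [this]
  exact (measurableSet_Ioi.inter measurableSet_Ici).union
    (((Set.countable_singleton 0).mono Set.inter_subset_left).measurableSet.union
      (measurableSet_Iio.inter (MeasurableSet.const _)))

end Excess

theorem integral_table (rows : List (ℝ × ℝ)) (hrows : ∀ r ∈ rows, 0 ≤ r.2) (f : ℝ → ℝ) :
    Integrable f (KnownLaw.table rows).law ∧
      ∫ x, f x ∂(KnownLaw.table rows).law = (rows.map fun r => r.2 * f r.1).sum := by
  induction rows with
  | nil => simp [KnownLaw.law]
  | cons r rows ih =>
    have hr := hrows r List.mem_cons_self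
    have ih := ih fun r' hr' => hrows r' (List.mem_cons_of_mem _ hr')
    have hlaw : (KnownLaw.table (r :: rows)).law =
        ENNReal.ofReal r.2 • Measure.dirac r.1 + (KnownLaw.table rows).law := by
      simp [KnownLaw.law]
    have hd : Integrable f (ENNReal.ofReal r.2 • Measure.dirac r.1) :=
      (integrable_dirac (by simp)).smul_measure ENNReal.ofReal_ne_top
    rw [hlaw]
    refine ⟨hd.add_measure ih.1, ?_⟩
    rw [integral_add_measure hd ih.1, integral_smul_measure, integral_dirac, ih.2]
    simp [ENNReal.toReal_ofReal hr]

namespace Market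

variable (P : Market n)

instance (i : Fin n) : IsProbabilityMeasure (P.dist i).law := P.isProb i

instance : IsProbabilityMeasure P.joint := by
  unfold joint; infer_instance

/-- The grade of an element: the price is the expected excess of the value over the grade. -/
def grade (i : Fin n) : ℝ := excessInverse (P.dist i).law (P.price i)

/-- The value of an element, capped by its grade (an element without price has no grade). -/
def capped (i : Fin n) (v : ℝ) : ℝ := if P.price i ≤ 0 then v else min v (P.grade i)

variable {P}

theorem capped_le (i : Fin n) (v : ℝ) : P.capped i v ≤ v := by
  unfold capped
  split_ifs
  exacts [le_rfl, min_le_left _ _]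

theorem integrable_capped (i : Fin n) : Integrable (P.capped i) (P.dist i).law := by
  unfold capped
  split_ifs
  · exact P.value_integrable i
  · exact (P.value_integrable i).inf (integrable_const _)

/-- For a positive price, v − min(v, τ) = (v − τ)⁺, whose mean is the price by the choice of the
grade τ. For a free element both sides vanish. -/
theorem integral_sub_capped (i : Fin n) :
    ∫ v, (v - P.capped i v) ∂(P.dist i).law = P.price i := by
  unfold capped
  split_ifs with h
  · simp [le_antisymm h (P.price_nonneg i)]
  · rw [← excess_excessInverse (P.value_integrable i) (not_le.1 h)]
    refine integral_congr_ae (Filter.Eventually.of_forall fun v => ?_)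
    simp only [grade]
    rcases le_total v (excessInverse (P.dist i).law (P.price i)) with h | h
    · rw [min_eq_left h, max_eq_right (by linarith), sub_self]
    · rw [min_eq_right h, max_eq_left (by linarith)]

theorem measurable_answer (i : Fin n) : Measurable (P.dist i).answer := by
  have h1 := P.isProb i
  have h2 := P.value_integrable i
  cases h : P.dist i with
  | table rows => exact measurable_const
  | oracle μ =>
    rw [h] at h1 h2
    exact @measurable_excessInverse μ h1 h2

end Market

/-! ## Expected utility in terms of capped values -/

/-- Resampling one coordinate independently does not change a product law; this is checked on boxes.
-/
theorem measurePreserving_update {μ : Fin n → Measure ℝ} [∀ i, IsProbabilityMeasure (μ i)]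
    (i : Fin n) :
    MeasurePreserving (fun q : (Fin n → ℝ) × ℝ => Function.update q.1 i q.2)
      ((Measure.pi μ).prod (μ i)) (Measure.pi μ) := by
  have hm : Measurable fun q : (Fin n → ℝ) × ℝ => Function.update q.1 i q.2 := by
    refine measurable_pi_iff.2 fun j => ?_
    by_cases h : j = i
    · subst h
      simpa using measurable_snd
    · simp only [Function.update_of_ne h]
      exact (measurable_pi_apply j).comp measurable_fst
  refine ⟨hm, (Measure.pi_eq fun s hs => ?_).symm⟩
  rw [Measure.map_apply hm (MeasurableSet.univ_pi hs)]
  have : (fun q : (Fin n → ℝ) × ℝ => Function.update q.1 i q.2) ⁻¹' Set.univ.pi s =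
      (Set.univ.pi (Function.update s i Set.univ)) ×ˢ s i := by
    ext ⟨x, y⟩
    simp only [Set.mem_preimage, Set.mem_univ_pi, Set.mem_prod]
    constructor
    · refine fun h => ⟨fun j => ?_, by simpa using h i⟩
      by_cases hj : j = i
      · subst hj; simp
      · simpa [hj] using h j
    · rintro ⟨h1, h2⟩ j
      by_cases hj : j = i
      · subst hj; simpa using h2
      · simpa [hj] using h1 j
  rw [this, Measure.prod_prod, Measure.pi_pi, ← Finset.mul_prod_erase _ _ (Finset.mem_univ i),
    ← Finset.mul_prod_erase _ _ (Finset.mem_univ i), Function.update_self, measure_univ, one_mul,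
    mul_comm]
  congr 1
  refine Finset.prod_congr rfl fun j hj => ?_
  rw [Function.update_of_ne (Finset.ne_of_mem_erase hj)]

theorem sum_mem_eq_sum_indicator {Ω : Type} (A : Ω × (Fin n → ℝ) → Finset (Fin n)) (g : Fin n → ℝ → ℝ) :
    (fun z => ∑ i ∈ A z, g i (z.2 i)) =
      fun z => ∑ i, {z | i ∈ A z}.indicator (fun z => g i (z.2 i)) z := by
  funext z
  simp only [Set.indicator_apply, Set.mem_ofPred_eq]
  rw [Finset.sum_ite_mem, Finset.univ_inter]

section Accounting

variable {Ω : Type} [MeasurableSpace Ω] (ν : Measure Ω) [IsProbabilityMeasure ν] (P : Market n)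

theorem measurePreserving_prod_update (i : Fin n) :
    MeasurePreserving
      (fun q : (Ω × (Fin n → ℝ)) × ℝ => (q.1.1, Function.update q.1.2 i q.2))
      ((ν.prod P.joint).prod (P.dist i).law) (ν.prod P.joint) :=
  ((MeasurePreserving.id ν).prod (measurePreserving_update i)).comp
    (measurePreserving_prodAssoc ν P.joint (P.dist i).law)

theorem measurePreserving_value (i : Fin n) :
    MeasurePreserving (fun z : Ω × (Fin n → ℝ) => z.2 i) (ν.prod P.joint) (P.dist i).law :=
  (measurePreserving_eval (fun i => (P.dist i).law) i).comp measurePreserving_snd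

variable {A I : Ω × (Fin n → ℝ) → Finset (Fin n)} {g : Fin n → ℝ → ℝ}

theorem integrable_sum_mem (hA : ∀ i, MeasurableSet {z | i ∈ A z})
    (hg : ∀ i, Integrable (g i) (P.dist i).law) :
    Integrable (fun z => ∑ i ∈ A z, g i (z.2 i)) (ν.prod P.joint) := by
  rw [sum_mem_eq_sum_indicator]
  exact integrable_finsetSum _ fun i _ =>
    ((measurePreserving_value ν P i).integrable_comp_of_integrable (hg i)).indicator (hA i)

/-- Replacing coordinate `i` by a fresh copy preserves the joint law and, by `hup`, the event `i ∈ A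
z`. That event is therefore independent of the fresh value, which may be replaced by its mean. -/
theorem integral_sum_mem_of_update (hA : ∀ i, MeasurableSet {z | i ∈ A z})
    (hup : ∀ θ x i v, i ∈ A (θ, Function.update x i v) ↔ i ∈ A (θ, x))
    (hg : ∀ i, Integrable (g i) (P.dist i).law) :
    ∫ z, ∑ i ∈ A z, g i (z.2 i) ∂(ν.prod P.joint) =
      ∫ z, ∑ i ∈ A z, ∫ v, g i v ∂(P.dist i).law ∂(ν.prod P.joint) := by
  rw [sum_mem_eq_sum_indicator, sum_mem_eq_sum_indicator A fun i _ => ∫ v, g i v ∂(P.dist i).law,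
    integral_finsetSum, integral_finsetSum]
  · refine Finset.sum_congr rfl fun i _ => ?_
    have hint : Integrable ({z | i ∈ A z}.indicator fun z => g i (z.2 i)) (ν.prod P.joint) :=
      ((measurePreserving_value ν P i).integrable_comp_of_integrable (hg i)).indicator (hA i)
    have hmap := measurePreserving_prod_update ν P i
    rw [← hmap.map_eq] at hint
    conv_lhs => rw [← hmap.map_eq]
    rw [integral_map hmap.measurable.aemeasurable hint.aestronglyMeasurable]
    -- After resampling, the integrand is a product of a function of the old point and a function of
    -- the fresh value.
    have : (fun q : (Ω × (Fin n → ℝ)) × ℝ =>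
        {z | i ∈ A z}.indicator (fun z => g i (z.2 i)) (q.1.1, Function.update q.1.2 i q.2)) =
        fun q => {z | i ∈ A z}.indicator (fun _ => (1 : ℝ)) q.1 * g i q.2 := by
      funext q
      by_cases h : i ∈ A q.1
      · simp [Set.indicator, hup, h]
      · simp [Set.indicator, hup, h]
    rw [this, integral_prod_mul, ← integral_mul_const]
    refine integral_congr_ae (Filter.Eventually.of_forall fun z => ?_)
    by_cases h : i ∈ A z <;> simp [h]
  · exact fun i _ => (integrable_const _).indicator (hA i)
  · exact fun i _ =>
      ((measurePreserving_value ν P i).integrable_comp_of_integrable (hg i)).indicator (hA i)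

theorem integrable_utility (hA : ∀ i, MeasurableSet {z | i ∈ A z})
    (hI : ∀ i, MeasurableSet {z | i ∈ I z}) :
    Integrable (fun z => P.utility z.2 (A z) (I z)) (ν.prod P.joint) :=
  (integrable_sum_mem (g := fun _ v => v) ν P hI P.value_integrable).sub
    (integrable_sum_mem (g := fun i _ => P.price i) ν P hA fun _ => integrable_const _)

/-- The prices of the probed elements are exchanged for the bonuses `z.2 i - P.capped i (z.2 i)`,
which have the same expectation. On selected elements the bonus cancels against the value and leaves
the capped value; on the others it is a loss. -/
theorem integral_utility (hA : ∀ i, MeasurableSet {z | i ∈ A z})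
    (hI : ∀ i, MeasurableSet {z | i ∈ I z})
    (hup : ∀ θ x i v, i ∈ A (θ, Function.update x i v) ↔ i ∈ A (θ, x)) (hIA : ∀ z, I z ⊆ A z) :
    ∫ z, P.utility z.2 (A z) (I z) ∂(ν.prod P.joint) =
      ∫ z, (∑ i ∈ I z, P.capped i (z.2 i) - ∑ i ∈ A z \ I z, (z.2 i - P.capped i (z.2 i)))
        ∂(ν.prod P.joint) := by
  have hbonus : ∀ i, Integrable (fun v => v - P.capped i v) (P.dist i).law := fun i =>
    (P.value_integrable i).sub (Market.integrable_capped i)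
  have key := integral_sum_mem_of_update ν P hA hup hbonus
  simp only [Market.integral_sub_capped] at key
  have h1 := integrable_sum_mem (g := fun _ v => v) ν P hI P.value_integrable
  have h2 := integrable_sum_mem (g := fun i _ => P.price i) ν P hA fun _ => integrable_const _
  have h3 := integrable_sum_mem ν P hA hbonus
  unfold Market.utility
  rw [integral_sub h1 h2, ← key, ← integral_sub h1 h3]
  refine integral_congr_ae (Filter.Eventually.of_forall fun z => ?_)
  simp only
  rw [← Finset.sum_sdiff (hIA z)]
  simp only [Finset.sum_sub_distrib]
  ring

theorem integral_utility_le (hA : ∀ i, MeasurableSet {z | i ∈ A z})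
    (hI : ∀ i, MeasurableSet {z | i ∈ I z})
    (hup : ∀ θ x i v, i ∈ A (θ, Function.update x i v) ↔ i ∈ A (θ, x)) (hIA : ∀ z, I z ⊆ A z) :
    ∫ z, P.utility z.2 (A z) (I z) ∂(ν.prod P.joint) ≤
      ∫ z, ∑ i ∈ I z, P.capped i (z.2 i) ∂(ν.prod P.joint) := by
  rw [integral_utility ν P hA hI hup hIA]
  have hbonus : ∀ i, Integrable (fun v => v - P.capped i v) (P.dist i).law := fun i =>
    (P.value_integrable i).sub (Market.integrable_capped i)
  have h1 := integrable_sum_mem ν P hI (g := P.capped) Market.integrable_capped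
  have h2 := integrable_sum_mem (A := fun z => A z \ I z) ν P (fun i => by
    simp only [Finset.mem_sdiff]
    exact (hA i).inter (hI i).compl) hbonus
  exact integral_mono (h1.sub h2) h1 fun z => sub_le_self _ <|
    Finset.sum_nonneg fun i _ => sub_nonneg.2 (Market.capped_le _ _)

end Accounting

/-! ## The benchmark -/

open Classical in
/-- The largest capped value of a feasible set. -/
def Market.optimum (P : Market n) (F : Set (Finset (Fin n))) (x : Fin n → ℝ) : ℝ :=
  (insert ∅ (Finset.univ.filter (· ∈ F))).sup' (Finset.insert_nonempty _ _)
    fun O => ∑ i ∈ O, P.capped i (x i)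

theorem Market.le_optimum (P : Market n) {F : Set (Finset (Fin n))} {O : Finset (Fin n)}
    (hO : O ∈ F) (x : Fin n → ℝ) : ∑ i ∈ O, P.capped i (x i) ≤ P.optimum F x := by
  classical
  exact Finset.le_sup' (fun O => ∑ i ∈ O, P.capped i (x i))
    (Finset.mem_insert_of_mem (Finset.mem_filter.2 ⟨Finset.mem_univ O, hO⟩))

theorem Market.optimum_le (P : Market n) {F : Set (Finset (Fin n))} (h0 : ∅ ∈ F) {x : Fin n → ℝ}
    {r : ℝ} (h : ∀ O ∈ F, ∑ i ∈ O, P.capped i (x i) ≤ r) : P.optimum F x ≤ r := by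
  classical
  refine Finset.sup'_le _ _ fun O hO => h O ?_
  rcases Finset.mem_insert.1 hO with rfl | hO
  exacts [h0, (Finset.mem_filter.1 hO).2]

theorem Market.integrable_sum_capped (P : Market n) (O : Finset (Fin n)) :
    Integrable (fun x : Fin n → ℝ => ∑ i ∈ O, P.capped i (x i)) P.joint :=
  integrable_finsetSum _ fun i _ =>
    (measurePreserving_eval (fun i => (P.dist i).law) i).integrable_comp_of_integrable
      (Market.integrable_capped i)

theorem Market.integrable_optimum (P : Market n) (F : Set (Finset (Fin n))) :
    Integrable (P.optimum F) P.joint := by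
  classical
  unfold Market.optimum
  have : ∀ (S : Finset (Finset (Fin n))) (hS : S.Nonempty), Integrable
      (fun x => S.sup' hS fun O => ∑ i ∈ O, P.capped i (x i)) P.joint := by
    intro S hS
    induction hS using Finset.Nonempty.cons_induction with
    | singleton O => simpa using P.integrable_sum_capped O
    | cons O S hO hS ih =>
      simp only [Finset.sup'_cons hS]
      exact (P.integrable_sum_capped O).sup ih
  exact this _ _

/-! ## Adaptive policies against the benchmark -/

theorem Policy.subset_run (x : Fin n → ℝ) (t : Policy n) (A : Finset (Fin n)) :
    A ⊆ (t.run x A).1 := by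
  induction t generalizing A with
  | halt I => exact Finset.Subset.refl _
  | probe j next ih => exact (Finset.subset_insert j A).trans (ih (x j) (insert j A))

theorem Policy.mem_run_update (x : Fin n → ℝ) (i : Fin n) (v : ℝ) (t : Policy n)
    (A : Finset (Fin n)) :
    i ∈ (t.run (Function.update x i v) A).1 ↔ i ∈ (t.run x A).1 := by
  induction t generalizing A with
  | halt I => exact Iff.rfl
  | probe j next ih =>
    simp only [Policy.run]
    by_cases hj : j = i
    · subst hj
      exact iff_of_true (Policy.subset_run _ _ _ (Finset.mem_insert_self _ _))
        (Policy.subset_run _ _ _ (Finset.mem_insert_self _ _))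
    · rw [Function.update_of_ne hj]
      exact ih _ _

theorem integral_snd_eq {Ω : Type} [MeasurableSpace Ω] (ν : Measure Ω) [IsProbabilityMeasure ν]
    (P : Market n) {f : (Fin n → ℝ) → ℝ} (hf : Integrable f P.joint) :
    Integrable (fun z : Ω × (Fin n → ℝ) => f z.2) (ν.prod P.joint) ∧
      ∫ z : Ω × (Fin n → ℝ), f z.2 ∂(ν.prod P.joint) = ∫ x, f x ∂P.joint :=
  ⟨measurePreserving_snd.integrable_comp_of_integrable hf, by
    rw [integral_fun_snd]; simp⟩

/-- The benchmark bound: a decision tree decides to probe `i` without using its value, and the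
capped value of its feasible selection is at most the pointwise optimum. -/
theorem policyUtility_le (P : Market n) {F : Set (Finset (Fin n))} {Ω : Type} [MeasurableSpace Ω]
    (ν : Measure Ω) [IsProbabilityMeasure ν] {T : Ω → Policy n} (hT : Admissible F T) :
    policyUtility P ν T ≤ ∫ x, P.optimum F x ∂P.joint := by
  have hmeas : ∀ Q : Finset (Fin n) × Finset (Fin n) → Prop,
      MeasurableSet {z : Ω × (Fin n → ℝ) | Q ((T z.1).run z.2 ∅)} := by
    intro Q
    have : {z : Ω × (Fin n → ℝ) | Q ((T z.1).run z.2 ∅)} =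
        ⋃ o ∈ {o | Q o}, {z : Ω × (Fin n → ℝ) | (T z.1).run z.2 ∅ = o} := by
      ext z
      simp
    rw [this]
    exact MeasurableSet.biUnion (Set.to_countable _) fun o _ => hT.2 o
  have hI := fun i => hmeas fun o => i ∈ o.2
  refine (integral_utility_le ν P (fun i => hmeas fun o => i ∈ o.1) hI
    (fun θ x i v => Policy.mem_run_update x i v (T θ) ∅) (fun z => (hT.1 z.1 z.2).1)).trans ?_
  obtain ⟨h1, h2⟩ := integral_snd_eq ν P (P.integrable_optimum F)
  rw [← h2]
  exact integral_mono (integrable_sum_mem ν P hI Market.integrable_capped) h1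
    fun z => P.le_optimum (hT.1 z.1 z.2).2 z.2

/-! ## Programs against the benchmark -/

instance : IsProbabilityMeasure fairBits := by
  unfold fairBits; infer_instance

theorem measurableState_startState (P : Market n) (D : Description n) {Z : Type}
    [MeasurableSpace Z] : MeasurableState fun _ : Z => startState P D :=
  ⟨fun _ _ _ => measurable_const, fun _ _ _ => measurable_const, fun _ => measurable_const,
    fun _ => measurable_const, measurable_const⟩

theorem Program.measurableState_final (p : Program) (P : Market n) (D : Description n) :
    MeasurableState fun z : (ℕ → Bool) × (Fin n → ℝ) => p.final P D z.1 z.2 :=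
  MeasurableState.exec (dist := P.dist) (F := D.feasible) (fun _ => rfl) (fun _ => rfl)
    Market.measurable_answer (fun k => (measurable_pi_apply k).comp measurable_fst)
    (fun i => (measurable_pi_apply i).comp measurable_snd) p (measurableState_startState P D)

theorem Program.integrable_capped_selected (p : Program) (P : Market n) (D : Description n) :
    Integrable (fun z => ∑ i ∈ (p.final P D z.1 z.2).selected, P.capped i (z.2 i))
      (fairBits.prod P.joint) :=
  integrable_sum_mem (A := fun z => (p.final P D z.1 z.2).selected) fairBits P
    (fun i => measurableSet_setOfPred.2 ((p.measurableState_final P D).selected i))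
    Market.integrable_capped

/-- Under `hfrugal` the loss term of `integral_utility` vanishes, so the program collects exactly
its capped sum. What is left to prove for each constraint is `hopt`, which mentions neither prices
nor policies. -/
theorem Program.approximates_of_capped {p : Program} {P : Market n} {F : Set (Finset (Fin n))}
    {D : Description n} {α : ℝ} {N : ℕ} (hα : 0 < α)
    (hsub : ∀ ω x, (p.final P D ω x).selected ⊆ (p.final P D ω x).probed)
    (hF : ∀ ω x, (p.final P D ω x).selected ∈ F)
    (hN : ∀ ω x, (p.final P D ω x).steps ≤ N)
    (hfrugal : ∀ ω x, ∀ i ∈ (p.final P D ω x).probed, P.capped i (x i) < x i →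
      i ∈ (p.final P D ω x).selected)
    (hopt : ∫ x, P.optimum F x ∂P.joint ≤
      α * ∫ z, ∑ i ∈ (p.final P D z.1 z.2).selected, P.capped i (z.2 i)
        ∂(fairBits.prod P.joint)) :
    p.Approximates P F D α N := by
  have hm := p.measurableState_final P D
  have hA : ∀ i, MeasurableSet {z : (ℕ → Bool) × (Fin n → ℝ) |
      i ∈ (p.final P D z.1 z.2).probed} := fun i => measurableSet_setOfPred.2 (hm.probed i)
  have hI : ∀ i, MeasurableSet {z : (ℕ → Bool) × (Fin n → ℝ) |
      i ∈ (p.final P D z.1 z.2).selected} := fun i => measurableSet_setOfPred.2 (hm.selected i)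
  refine ⟨fun ω x => ⟨hsub ω x, hF ω x, hN ω x⟩, integrable_utility fairBits P hA hI, ?_⟩
  intro Ω _ ν _ T hT
  have h1 := policyUtility_le P ν hT
  have h2 : ∫ z, p.utility P D z ∂(fairBits.prod P.joint) =
      ∫ z, ∑ i ∈ (p.final P D z.1 z.2).selected, P.capped i (z.2 i) ∂(fairBits.prod P.joint) := by
    refine (integral_utility fairBits P hA hI
      (fun ω x i v => p.mem_probed_final_update P D ω x i v) (fun z => hsub z.1 z.2)).trans ?_
    refine integral_congr_ae (Filter.Eventually.of_forall fun z => ?_)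
    refine (sub_eq_self).2 (Finset.sum_eq_zero fun i hi => ?_)
    rw [Finset.mem_sdiff] at hi
    have := mt (hfrugal z.1 z.2 i hi.1) hi.2
    linarith [Market.capped_le (P := P) i (z.2 i)]
  rw [h2, one_div_mul_eq_div, div_le_iff₀' hα]
  exact h1.trans hopt

/-! ## Reasoning about runs -/

attribute [simp] Program.exec NatExpr.eval RealExpr.eval Test.holds Program.WritesNat
  Program.WritesReal Program.Silent

namespace Program

/-- The state `s'` agrees with `s` wherever the program `p` cannot make a change. -/
structure Frame (p : Program) (s s' : State n) : Prop where
  natMem : ∀ a, ¬ p.WritesNat a → s'.natMem a = s.natMem a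
  realMem : ∀ a, ¬ p.WritesReal a → s'.realMem a = s.realMem a
  probed : p.Silent → s'.probed = s.probed
  selected : p.Silent → s'.selected = s.selected

theorem exec_frame (w : World n) (p : Program) (s : State n) : p.Frame s (p.exec w s) :=
  ⟨fun _ h => exec_natMem h s, fun _ h => exec_realMem h s, fun h => (h.exec_eq s).1,
    fun h => (h.exec_eq s).2⟩

/-- Loop induction in which untouched regions come for free: the invariant only has to speak about
cells that the body changes. -/
theorem exec_loop_frame_induct {w : World n} {a : ℕ} {e : NatExpr} {c : Program} {s : State n}
    {m : ℕ} (hm : e.eval s = m) (I : ℕ → State n → Prop) (h0 : I 0 s.tick)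
    (hs : ∀ t s', t < m → Frame (.loop a e c) s s' → I t s' →
      I (t + 1) (c.exec w (s'.writeNat a 0 0 t).tick)) :
    I m (Program.exec w (.loop a e c) s) := by
  subst hm
  refine (exec_loop_induct (fun t s' => Frame (.loop a e c) s s' ∧ I t s')
    ⟨⟨fun _ _ => rfl, fun _ _ => rfl, fun _ => rfl, fun _ => rfl⟩, h0⟩
    fun t s' ht h => ⟨?_, hs t s' ht h.1 h.2⟩).2
  have h1 := exec_frame w c (s'.writeNat a 0 0 t).tick
  refine ⟨fun b hb => ?_, fun b hb => ?_, fun hb => ?_, fun hb => ?_⟩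
  · rw [h1.natMem b fun h => hb (Or.inr h), State.tick_natMem,
      State.writeNat_natMem_of_ne _ _ _ _ fun h => hb (Or.inl h), h.1.natMem b hb]
  · rw [h1.realMem b hb]; exact h.1.realMem b hb
  · rw [h1.probed hb]; exact h.1.probed hb
  · rw [h1.selected hb]; exact h.1.selected hb

end Program

/-- The natural-number cell `(a, i, 0)`. -/
abbrev NatExpr.entry (a : ℕ) (i : NatExpr) : NatExpr := .cell a i (.lit 0)

/-- The natural-number cell `(a, 0, 0)`. -/
abbrev NatExpr.var (a : ℕ) : NatExpr := .cell a (.lit 0) (.lit 0)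

/-- The real cell `(a, i, 0)`. -/
abbrev RealExpr.entry (a : ℕ) (i : NatExpr) : RealExpr := .cell a i (.lit 0)

/-- The real cell `(a, 0, 0)`. -/
abbrev RealExpr.var (a : ℕ) : RealExpr := .cell a (.lit 0) (.lit 0)

/-- Assignment to the natural-number cell `(a, 0, 0)`. -/
abbrev Program.setNatVar (a : ℕ) (e : NatExpr) : Program := .setNat a (.lit 0) (.lit 0) e

/-- Assignment to the real cell `(a, 0, 0)`. -/
abbrev Program.setRealVar (a : ℕ) (e : RealExpr) : Program := .setReal a (.lit 0) (.lit 0) e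

/-! ## The grade of a finite table -/

/-- The probability of the rows whose value is at least that of row `k`. -/
def tailMass (v p : ℕ → ℝ) (m k : ℕ) : ℝ := ∑ j ∈ Finset.range m, if v k ≤ v j then p j else 0

/-- The expected value over the rows whose value is at least that of row `k`. -/
def tailValue (v p : ℕ → ℝ) (m k : ℕ) : ℝ :=
  ∑ j ∈ Finset.range m, if v k ≤ v j then p j * v j else 0

section Table

variable {v p : ℕ → ℝ} {m k : ℕ}

theorem tailMass_nonneg (hp : ∀ j, 0 ≤ p j) : 0 ≤ tailMass v p m k :=
  Finset.sum_nonneg fun j _ => by split_ifs; exacts [hp j, le_rfl]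

theorem tailValue_eq_zero (hp : ∀ j, 0 ≤ p j) (h : tailMass v p m k = 0) :
    tailValue v p m k = 0 := by
  rw [tailMass, Finset.sum_eq_zero_iff_of_nonneg fun j _ => by
    split_ifs; exacts [hp j, le_rfl]] at h
  refine Finset.sum_eq_zero fun j hj => ?_
  have := h j hj
  split_ifs at this ⊢ with hk
  · rw [this, zero_mul]
  · rfl

/-- A tail may contain rows with `v j < t` and omit rows with `v j > t`; either only lowers its sum
below that of the positive parts. -/
theorem tailValue_sub_le (hp : ∀ j, 0 ≤ p j) (t : ℝ) :
    tailValue v p m k - t * tailMass v p m k ≤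
      ∑ j ∈ Finset.range m, p j * max (v j - t) 0 := by
  rw [tailValue, tailMass, Finset.mul_sum, ← Finset.sum_sub_distrib]
  refine Finset.sum_le_sum fun j _ => ?_
  split_ifs
  · nlinarith [mul_le_mul_of_nonneg_left (le_max_left (v j - t) 0) (hp j)]
  · simpa using mul_nonneg (hp j) (le_max_right (v j - t) 0)

/-- The rows with value above `g` form a tail, namely that of their lowest row `k`, and for this `k`
the excess equals the tail expression. The previous lemma is the converse direction: the excess is
the maximum of the tail expressions and `0`. -/
theorem excess_le_of_tail {c g : ℝ} (hc : 0 ≤ c)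
    (h : ∀ k < m, tailValue v p m k - c ≤ g * tailMass v p m k) :
    ∑ j ∈ Finset.range m, p j * max (v j - g) 0 ≤ c := by
  by_cases hne : ((Finset.range m).filter fun j => g < v j).Nonempty
  · obtain ⟨k, hk, hmin⟩ := Finset.exists_min_image _ v hne
    rw [Finset.mem_filter, Finset.mem_range] at hk
    have : ∑ j ∈ Finset.range m, p j * max (v j - g) 0 =
        tailValue v p m k - g * tailMass v p m k := by
      rw [tailValue, tailMass, Finset.mul_sum, ← Finset.sum_sub_distrib]
      refine Finset.sum_congr rfl fun j hj => ?_
      split_ifs with hkj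
      · rw [max_eq_left (by linarith)]; ring
      · have : v j ≤ g := by
          by_contra! hlt
          exact hkj (hmin j (Finset.mem_filter.2 ⟨hj, hlt⟩))
        rw [max_eq_right (by linarith)]; simp
    rw [this]
    linarith [h k hk.1]
  · rw [Finset.not_nonempty_iff_eq_empty, Finset.filter_eq_empty_iff] at hne
    rw [Finset.sum_eq_zero fun j hj => ?_]
    · exact hc
    · rw [max_eq_right (by linarith [not_lt.1 (hne hj)]), mul_zero]

end Table

/-- The value in row `j` of the table of an element. -/
def Market.rowValue (P : Market n) (i : Fin n) (j : ℕ) : ℝ := ((P.dist i).rows.getD j (0, 0)).1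

/-- The probability in row `j` of the table of an element. -/
def Market.rowProb (P : Market n) (i : Fin n) (j : ℕ) : ℝ := ((P.dist i).rows.getD j (0, 0)).2

namespace Market

variable (P : Market n) (i : Fin n)

theorem row_nonneg (j : ℕ) : 0 ≤ P.rowValue i j ∧ 0 ≤ P.rowProb i j := by
  unfold rowValue rowProb
  rcases lt_or_ge j (P.dist i).rows.length with h | h
  · rw [List.getD_eq_getElem _ _ h]
    exact P.rows_nonneg i _ (List.getElem_mem h)
  · rw [List.getD_eq_default _ _ h]
    simp

theorem integral_rows (h : (P.dist i).rows ≠ []) (f : ℝ → ℝ) :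
    ∫ x, f x ∂(P.dist i).law =
      ∑ j ∈ Finset.range (P.dist i).rows.length, P.rowProb i j * f (P.rowValue i j) := by
  have hr := P.rows_nonneg i
  unfold rowProb rowValue
  cases hd : P.dist i with
  | oracle μ => simp [hd, KnownLaw.rows] at h
  | table rows =>
    rw [hd] at hr
    rw [(integral_table rows (fun r hr' => (hr r hr').2) f).2]
    simp only [KnownLaw.rows]
    rw [← Fin.sum_univ_getElem, Finset.sum_range]
    simp only [List.getElem_map]
    refine Fintype.sum_equiv (finCongr (by simp)) _ _ fun j => ?_
    simp only [finCongr_apply, Fin.val_cast]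
    rw [List.getD_eq_getElem _ _ (by simpa using j.2)]

/-- An empty table has total mass `0` and is no probability law, so an element without rows has an
oracle. -/
theorem grade_of_rows_eq_nil (h : (P.dist i).rows = []) :
    (P.dist i).answer (P.price i) = P.grade i := by
  unfold grade
  have hp := P.isProb i
  cases hd : P.dist i with
  | oracle μ => rfl
  | table rows =>
    rw [hd] at h hp
    simp only [KnownLaw.rows] at h
    subst h
    have := hp.measure_univ
    simp [KnownLaw.law] at this

/-- Since the mean is non-negative, the excess at `t` is at least `-t`. This makes minus the price a
valid starting value for the search of the grade. -/
theorem neg_price_le (h : (P.dist i).rows ≠ []) {t : ℝ}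
    (ht : ∑ j ∈ Finset.range (P.dist i).rows.length,
      P.rowProb i j * max (P.rowValue i j - t) 0 ≤ P.price i) : 0 - P.price i ≤ t := by
  rw [← P.integral_rows i h fun x => max (x - t) 0] at ht
  have h1 := sub_le_excess (P.value_integrable i) t
  have h2 := integral_nonneg_of_ae (P.value_nonneg i)
  linarith

theorem grade_eq_of_tail (h : (P.dist i).rows ≠ []) {g : ℝ}
    (hlow : ∀ t, ∑ j ∈ Finset.range (P.dist i).rows.length,
      P.rowProb i j * max (P.rowValue i j - t) 0 ≤ P.price i → g ≤ t)
    (hup : ∀ k < (P.dist i).rows.length,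
      tailValue (P.rowValue i) (P.rowProb i) (P.dist i).rows.length k - P.price i ≤
        g * tailMass (P.rowValue i) (P.rowProb i) (P.dist i).rows.length k) :
    g = P.grade i := by
  refine (IsLeast.csInf_eq ⟨?_, fun t ht => hlow t ?_⟩).symm
  · change ∫ x, max (x - g) 0 ∂(P.dist i).law ≤ P.price i
    rw [P.integral_rows i h fun x => max (x - g) 0]
    exact excess_le_of_tail (P.price_nonneg i) hup
  · rw [← P.integral_rows i h fun x => max (x - t) 0]
    exact ht

end Market

/-! ## Computing grades -/

/-- Adds the mass and the value of the rows above row `(8, 0, 0)` of the table of element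
`(7, 0, 0)` to the real cells `(10, 0, 0)` and `(11, 0, 0)`. -/
def tailProgram : Program :=
  .loop 9 (.entry 1 (.var 7))
    (.ite (.realLe (.cell 1 (.var 7) (.var 8)) (.cell 1 (.var 7) (.var 9)))
      (.seq (.setRealVar 10 (.add (.var 10) (.cell 2 (.var 7) (.var 9))))
        (.setRealVar 11 (.add (.var 11)
          (.mul (.cell 2 (.var 7) (.var 9)) (.cell 1 (.var 7) (.var 9))))))
      .skip)

/-- Raises the real cell `(9, 0, 0)` to the ratio of the cells `(11, 0, 0)` and `(10, 0, 0)`. -/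
def raiseProgram : Program :=
  .ite (.realLe (.var 11) (.mul (.var 9) (.var 10))) .skip (.setRealVar 9 (.div (.var 11) (.var 10)))

/-- Takes row `(8, 0, 0)` into account for the grade of element `(7, 0, 0)`. -/
def rowProgram : Program :=
  .seq (.setRealVar 10 (.lit 0))
    (.seq (.setRealVar 11 (.sub (.lit 0) (.entry 0 (.var 7)))) (.seq tailProgram raiseProgram))

/-- Writes the grade of element `(7, 0, 0)` to the real cell `(9, 0, 0)`. -/
def gradeProgram : Program :=
  .ite (.natLe (.entry 1 (.var 7)) (.lit 0))
    (.askLaw 9 (.var 7) (.entry 0 (.var 7)))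
    (.seq (.setRealVar 9 (.sub (.lit 0) (.entry 0 (.var 7))))
      (.loop 8 (.entry 1 (.var 7)) rowProgram))

theorem tailProgram_exec (w : World n) (s : State n) {i m k : ℕ} {v p : ℕ → ℝ}
    (hi : s.natMem 7 0 0 = i) (hm : s.natMem 1 i 0 = m) (hk : s.natMem 8 0 0 = k)
    (hv : s.realMem 1 i = v) (hp : s.realMem 2 i = p) :
    (tailProgram.exec w s).realMem 10 0 0 = s.realMem 10 0 0 + tailMass v p m k ∧
      (tailProgram.exec w s).realMem 11 0 0 = s.realMem 11 0 0 + tailValue v p m k := by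
  refine Program.exec_loop_frame_induct (m := m) (by simp [hi, hm])
    (fun t s' =>
      s'.realMem 10 0 0 = s.realMem 10 0 0 +
        ∑ j ∈ Finset.range t, (if v k ≤ v j then p j else 0) ∧
      s'.realMem 11 0 0 = s.realMem 11 0 0 +
        ∑ j ∈ Finset.range t, (if v k ≤ v j then p j * v j else 0)) (by simp)
    fun t s' _ hf hI => ?_
  have h7 : s'.natMem 7 0 0 = i := by rw [hf.natMem 7 (by simp), hi]
  have h8 : s'.natMem 8 0 0 = k := by rw [hf.natMem 8 (by simp), hk]
  have h1 : s'.realMem 1 i = v := by rw [hf.realMem 1 (by simp), hv]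
  have h2 : s'.realMem 2 i = p := by rw [hf.realMem 2 (by simp), hp]
  simp only [Finset.sum_range_succ, ← add_assoc, ← hI.1, ← hI.2]
  simp [State.writeNat_natMem, h7, h8, h1]
  split_ifs <;> simp [State.writeReal_realMem, h1, h2]

theorem rowProgram_exec (w : World n) (s : State n) {i m k : ℕ} {v p : ℕ → ℝ} {c g : ℝ}
    (hi : s.natMem 7 0 0 = i) (hm : s.natMem 1 i 0 = m) (hk : s.natMem 8 0 0 = k)
    (hc : s.realMem 0 i 0 = c) (hv : s.realMem 1 i = v) (hp : s.realMem 2 i = p)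
    (hg : s.realMem 9 0 0 = g) :
    (rowProgram.exec w s).realMem 9 0 0 =
      if tailValue v p m k - c ≤ g * tailMass v p m k then g
      else (tailValue v p m k - c) / tailMass v p m k := by
  have key : ∀ s1 : State n, s1.natMem 7 0 0 = i → s1.natMem 1 i 0 = m → s1.natMem 8 0 0 = k →
      s1.realMem 1 i = v → s1.realMem 2 i = p → s1.realMem 9 0 0 = g →
      s1.realMem 10 0 0 = 0 → s1.realMem 11 0 0 = - c →
      (raiseProgram.exec w (tailProgram.exec w s1)).realMem 9 0 0 =
        if tailValue v p m k - c ≤ g * tailMass v p m k then g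
        else (tailValue v p m k - c) / tailMass v p m k := by
    intro s1 g7 gm g8 g1 g2 g9 g10 g11
    obtain ⟨t10, t11⟩ := tailProgram_exec w s1 g7 gm g8 g1 g2
    have t9 : (tailProgram.exec w s1).realMem 9 0 0 = g := by
      rw [Program.exec_realMem (by simp [tailProgram]), g9]
    rw [g10, zero_add] at t10
    rw [g11, neg_add_eq_sub] at t11
    simp only [raiseProgram, Program.exec, Test.holds, RealExpr.eval, NatExpr.eval, t9, t10, t11]
    split_ifs <;> simp [State.writeReal_realMem, t9, t10, t11]
  simp only [rowProgram, Program.exec]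
  refine key _ ?_ ?_ ?_ ?_ ?_ ?_ ?_ ?_
  · simp [hi]
  · simp [hm]
  · simp [hk]
  · rw [← hv]; funext j; simp [State.writeReal_realMem]
  · rw [← hp]; funext j; simp [State.writeReal_realMem]
  · simp [State.writeReal_realMem, hg]
  · simp [State.writeReal_realMem]
  · simp [State.writeReal_realMem, hi, hc]

theorem gradeProgram_exec {P : Market n} {w : World n} (hw : w.dist = P.dist) (s : State n)
    (i : Fin n) (hi : s.natMem 7 0 0 = i) (hm : s.natMem 1 i 0 = (P.dist i).rows.length)
    (hprice : s.realMem 0 i 0 = P.price i) (hv : s.realMem 1 i = P.rowValue i)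
    (hp : s.realMem 2 i = P.rowProb i) :
    (gradeProgram.exec w s).realMem 9 0 0 = P.grade i := by
  by_cases hr : (P.dist i).rows = []
  · simp [gradeProgram, hi, hm, hr, State.writeReal_realMem, hw, hprice, P.grade_of_rows_eq_nil]
  · have hr' : (P.dist i).rows.length ≠ 0 := by simpa using hr
    have key : ∀ s1 : State n, s1.natMem 7 0 0 = i →
        s1.natMem 1 i 0 = (P.dist i).rows.length → s1.realMem 0 i 0 = P.price i →
        s1.realMem 1 i = P.rowValue i → s1.realMem 2 i = P.rowProb i →
        s1.realMem 9 0 0 = 0 - P.price i →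
        (Program.exec w (.loop 8 (.entry 1 (.var 7)) rowProgram) s1).realMem 9 0 0 =
          P.grade i := by
      intro s1 g7 gm g0 g1 g2 g9
      -- Cell `9` stays below every threshold whose excess is at most the price, and it satisfies
      -- the tail inequality of each row already treated. After all rows, these two facts identify
      -- it as the least such threshold.
      have hI := Program.exec_loop_frame_induct (w := w) (a := 8) (e := .entry 1 (.var 7))
        (c := rowProgram) (s := s1) (m := (P.dist i).rows.length) (by simp [g7, gm])
        (fun t s' =>
          (∀ τ, ∑ j ∈ Finset.range (P.dist i).rows.length,
            P.rowProb i j * max (P.rowValue i j - τ) 0 ≤ P.price i → s'.realMem 9 0 0 ≤ τ) ∧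
          ∀ k < t, tailValue (P.rowValue i) (P.rowProb i) (P.dist i).rows.length k - P.price i ≤
            s'.realMem 9 0 0 * tailMass (P.rowValue i) (P.rowProb i) (P.dist i).rows.length k)
        ⟨fun τ hτ => by simpa [g9] using P.neg_price_le i hr hτ, by simp⟩
        fun t s' ht hf hI => by
          have hpn := fun j => (P.row_nonneg i j).2
          have hrow := rowProgram_exec w (s'.writeNat 8 0 0 t).tick (i := i) (k := t)
            (m := (P.dist i).rows.length) (v := P.rowValue i) (p := P.rowProb i) (c := P.price i)
            (g := s'.realMem 9 0 0)
            (by simp [State.writeNat_natMem, hf.natMem 7 (by simp [rowProgram, tailProgram,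
              raiseProgram]), g7])
            (by simp [State.writeNat_natMem, hf.natMem 1 (by simp [rowProgram, tailProgram,
              raiseProgram]), gm])
            (by simp [State.writeNat_natMem])
            (by simp [hf.realMem 0 (by simp [rowProgram, tailProgram, raiseProgram]), g0])
            (by simp [hf.realMem 1 (by simp [rowProgram, tailProgram, raiseProgram]), g1])
            (by simp [hf.realMem 2 (by simp [rowProgram, tailProgram, raiseProgram]), g2]) rfl
          by_cases hle : tailValue (P.rowValue i) (P.rowProb i) (P.dist i).rows.length t -
              P.price i ≤ s'.realMem 9 0 0 *
                tailMass (P.rowValue i) (P.rowProb i) (P.dist i).rows.length t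
          · rw [if_pos hle] at hrow
            rw [hrow]
            refine ⟨hI.1, fun k hk => ?_⟩
            rcases Nat.lt_succ_iff_lt_or_eq.1 hk with hk | rfl
            exacts [hI.2 k hk, hle]
          · rw [if_neg hle] at hrow
            rw [hrow]
            push Not at hle
            -- The division is safe: a tail of mass `0` also has value `0`, and then the inequality
            -- for that row already holds since the price is non-negative.
            have hpos : 0 < tailMass (P.rowValue i) (P.rowProb i) (P.dist i).rows.length t := by
              refine lt_of_le_of_ne (tailMass_nonneg hpn) fun h0 => ?_
              rw [tailValue_eq_zero hpn h0.symm, ← h0] at hle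
              linarith [P.price_nonneg i]
            refine ⟨fun τ hτ => ?_, fun k hk => ?_⟩
            · rw [div_le_iff₀ hpos]
              have := tailValue_sub_le (v := P.rowValue i) (k := t)
                (m := (P.dist i).rows.length) hpn τ
              linarith
            · rcases Nat.lt_succ_iff_lt_or_eq.1 hk with hk | rfl
              · refine (hI.2 k hk).trans (mul_le_mul_of_nonneg_right ?_ (tailMass_nonneg hpn))
                rw [le_div_iff₀ hpos]
                exact hle.le
              · rw [div_mul_cancel₀ _ hpos.ne']
      exact P.grade_eq_of_tail i hr hI.1 hI.2
    simp only [gradeProgram, Program.exec, Test.holds, NatExpr.eval, hi, hm, Nat.le_zero, hr',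
      if_false]
    refine key _ ?_ ?_ ?_ ?_ ?_ ?_
    · simp [hi]
    · simp [hm]
    · simp [State.writeReal_realMem, hprice]
    · rw [← hv]; funext j; simp [State.writeReal_realMem]
    · rw [← hp]; funext j; simp [State.writeReal_realMem]
    · simp [State.writeReal_realMem, hi, hprice]

/-! ## The greedy program -/

/-- Initial status and index of every element: an element without price is probed (status `1`,
index its value); any other element is not probed yet (status `2`, index its grade). -/
def setupProgram : Program :=
  .loop 7 (.var 0)
    (.ite (.realLe (.entry 0 (.var 7)) (.lit 0))
      (.seq (.probe 7 (.var 7))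
        (.seq (.setReal 8 (.var 7) (.lit 0) (.entry 7 (.var 7)))
          (.setNat 4 (.var 7) (.lit 0) (.lit 1))))
      (.seq gradeProgram
        (.seq (.setReal 8 (.var 7) (.lit 0) (.var 9)) (.setNat 4 (.var 7) (.lit 0) (.lit 2)))))

/-- Finds an element of non-zero status whose ratio of index and weight is positive and largest;
the answer is `n` if there is none. -/
def argmaxProgram : Program :=
  .seq (.setNatVar 11 (.var 0))
    (.loop 12 (.var 0)
      (.ite (.and (.natLe (.lit 1) (.entry 4 (.var 12)))
          (.not (.realLe (.mul (.entry 8 (.var 12)) (.entry 5 (.var 11)))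
            (.mul (.entry 8 (.var 11)) (.entry 5 (.var 12))))))
        (.setNatVar 11 (.var 12)) .skip))

/-- Probes the element `(11, 0, 0)`, and selects it unless its value is below its index. -/
def acceptProgram : Program :=
  .seq (.probe 7 (.var 11))
    (.ite (.realLe (.entry 8 (.var 11)) (.entry 7 (.var 11)))
      (.seq (.select (.var 11)) (.setNat 4 (.var 11) (.lit 0) (.lit 0)))
      (.seq (.setReal 8 (.var 11) (.lit 0) (.entry 7 (.var 11)))
        (.seq (.setNat 4 (.var 11) (.lit 0) (.lit 1)) (.setNat 5 (.var 11) (.lit 0) (.lit 0)))))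

/-- Discards the element `(11, 0, 0)`. -/
def discardProgram : Program :=
  .seq (.setNat 5 (.var 11) (.lit 0) (.lit 0)) (.setNat 4 (.var 11) (.lit 0) (.lit 0))

/-- Processes the element `(11, 0, 0)`, where `check` decides feasibility. -/
def processProgram (check : Program) : Program :=
  .ite (.natLe (.add (.var 11) (.lit 1)) (.var 0))
    (.seq (.setNat 5 (.var 11) (.lit 0) (.lit 1))
      (.seq check (.ite (.natLe (.lit 1) (.var 6)) acceptProgram discardProgram)))
    .skip

/-- The greedy program for a given feasibility check. -/
def greedyProgram (check : Program) : Program :=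
  .seq setupProgram
    (.loop 10 (.add (.var 0) (.var 0)) (.seq argmaxProgram (processProgram check)))

/-! ### The invariant of the greedy loop and its preservation -/

/-- The states agree on the description of the instance. -/
def SameInput (s s' : State n) : Prop :=
  (∀ a ≤ 3, s'.natMem a = s.natMem a) ∧ ∀ a ≤ 6, s'.realMem a = s.realMem a

theorem SameInput.refl (s : State n) : SameInput s s := ⟨fun _ _ => rfl, fun _ _ => rfl⟩

theorem SameInput.trans {s s' s'' : State n} (h : SameInput s s') (h' : SameInput s' s'') :
    SameInput s s'' :=
  ⟨fun a ha => (h'.1 a ha).trans (h.1 a ha), fun a ha => (h'.2 a ha).trans (h.2 a ha)⟩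

theorem Program.Frame.sameInput {p : Program} {s s' : State n} (h : p.Frame s s')
    (hN : ∀ a ≤ 3, ¬ p.WritesNat a) (hR : ∀ a ≤ 6, ¬ p.WritesReal a) : SameInput s s' :=
  ⟨fun a ha => h.natMem a (hN a ha), fun a ha => h.realMem a (hR a ha)⟩

/-- The state contains the market `P`, and the weights `wt` of its elements. -/
structure Loaded (P : Market n) (wt : Fin n → ℝ) (s : State n) : Prop where
  count : s.natMem 0 0 0 = n
  rows : ∀ i : Fin n, s.natMem 1 i 0 = (P.dist i).rows.length
  price : ∀ i : Fin n, s.realMem 0 i 0 = P.price i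
  rowValue : ∀ i : Fin n, s.realMem 1 i = P.rowValue i
  rowProb : ∀ i : Fin n, s.realMem 2 i = P.rowProb i
  weight : ∀ i : Fin n, s.realMem 5 i 0 = wt i
  sentinel : s.realMem 5 n 0 = 1

theorem Loaded.congr {P : Market n} {wt : Fin n → ℝ} {s s' : State n} (h : Loaded P wt s)
    (hs : SameInput s s') : Loaded P wt s' where
  count := by rw [hs.1 0 (by simp), h.count]
  rows i := by rw [hs.1 1 (by simp), h.rows]
  price i := by rw [hs.2 0 (by simp), h.price]
  rowValue i := by rw [hs.2 1 (by simp), h.rowValue]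
  rowProb i := by rw [hs.2 2 (by simp), h.rowProb]
  weight i := by rw [hs.2 5 (by simp), h.weight]
  sentinel := by rw [hs.2 5 (by simp), h.sentinel]

/-- The program `check` decides whether the chosen set belongs to `F`. -/
structure Checks (w : World n) (b : State n) (F : Set (Finset (Fin n))) (check : Program) :
    Prop where
  answer : ∀ (s : State n) (S : Finset (Fin n)), SameInput b s →
    (∀ i : Fin n, s.natMem 5 i 0 ≠ 0 ↔ i ∈ S) → ((check.exec w s).natMem 6 0 0 ≠ 0 ↔ S ∈ F)
  silent : check.Silent
  writesNat : ∀ a, check.WritesNat a → a = 6 ∨ 13 ≤ a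
  writesReal : ∀ a, check.WritesReal a → 12 ≤ a

/-- The invariant of the greedy program. -/
structure Invariant (P : Market n) (x : Fin n → ℝ) (F : Set (Finset (Fin n))) (wt : Fin n → ℝ)
    (b s : State n) : Prop where
  input : SameInput b s
  sentinel : s.realMem 8 n 0 = 0
  chosen : ∀ i : Fin n, s.natMem 5 i 0 ≠ 0 ↔ i ∈ s.selected
  subset : s.selected ⊆ s.probed
  feasible : s.selected ∈ F
  status_le : ∀ i : Fin n, s.natMem 4 i 0 ≤ 2
  capped_le : ∀ i : Fin n, P.capped i (x i) ≤ s.realMem 8 i 0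
  closed : ∀ i : Fin n, s.natMem 4 i 0 = 2 →
    0 < P.price i ∧ s.realMem 8 i 0 = P.grade i
  opened : ∀ i : Fin n, s.natMem 4 i 0 = 1 → s.realMem 8 i 0 = x i ∧ x i ≤ P.capped i (x i)
  done : ∀ i ∈ s.selected, s.natMem 4 (i : ℕ) 0 = 0
  frugal : ∀ i ∈ s.probed, P.capped i (x i) < x i → i ∈ s.selected
  pos : ∀ j ∈ s.selected, 0 < P.capped j (x j)
  dominated : ∀ j ∈ s.selected, ∀ i : Fin n, s.natMem 4 i 0 ≠ 0 →
    s.realMem 8 i 0 * wt j ≤ P.capped j (x j) * wt i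
  blocked : ∀ i : Fin n, i ∉ s.selected → s.natMem 4 i 0 = 0 →
    insert i (s.selected.filter fun j =>
      P.capped i (x i) * wt j ≤ P.capped j (x j) * wt i) ∉ F

section Greedy

variable {P : Market n} {x : Fin n → ℝ} {F : Set (Finset (Fin n))} {wt : Fin n → ℝ} {w : World n}
  {b : State n} {check : Program}

/-- Initially nothing is selected and no status is `0`, so the greedy conditions are vacuous. Only
free elements have been probed, and their capped values are their values; for the others the grade
bounds the capped value. -/
theorem setupProgram_exec (hw : w.dist = P.dist) (hx : w.values = x) (hL : Loaded P wt b)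
    (h0 : ∅ ∈ F) (h5 : ∀ i : Fin n, b.natMem 5 i 0 = 0) (h8 : b.realMem 8 n 0 = 0)
    (hp : b.probed = ∅) (hs : b.selected = ∅) :
    Invariant P x F wt b (setupProgram.exec w b) := by
  have key := Program.exec_loop_frame_induct (w := w) (a := 7) (e := .var 0)
    (c := .ite (.realLe (.entry 0 (.var 7)) (.lit 0))
      (.seq (.probe 7 (.var 7))
        (.seq (.setReal 8 (.var 7) (.lit 0) (.entry 7 (.var 7)))
          (.setNat 4 (.var 7) (.lit 0) (.lit 1))))
      (.seq gradeProgram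
        (.seq (.setReal 8 (.var 7) (.lit 0) (.var 9)) (.setNat 4 (.var 7) (.lit 0) (.lit 2)))))
    (s := b) (m := n) (by simp [hL.count])
    (fun t s => s.selected = ∅ ∧ (∀ i ∈ s.probed, P.price i ≤ 0) ∧ s.realMem 8 n 0 = 0 ∧
      ∀ i : Fin n, (i : ℕ) < t →
        (P.price i ≤ 0 ∧ i ∈ s.probed ∧ s.natMem 4 i 0 = 1 ∧ s.realMem 8 i 0 = x i) ∨
        (0 < P.price i ∧ s.natMem 4 i 0 = 2 ∧ s.realMem 8 i 0 = P.grade i))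
    (by simp [hs, hp, h8]) fun t s ht hf hI => by
      have hin : SameInput b s := hf.sameInput
        (fun a ha => by simp [gradeProgram, rowProgram, tailProgram, raiseProgram]; omega)
        (fun a ha => by simp [gradeProgram, rowProgram, tailProgram, raiseProgram]; omega)
      have hLs := hL.congr hin
      obtain ⟨i, rfl⟩ : ∃ i : Fin n, (i : ℕ) = t := ⟨⟨t, ht⟩, rfl⟩
      obtain ⟨I1, I2, I3, I4⟩ := hI
      have hin : (i : ℕ) ≠ n := i.2.ne
      rw [Program.exec]
      split_ifs with hprice
      · have hprice : P.price i ≤ 0 := by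
          simpa [State.writeNat_natMem, hLs.price] using hprice
        simp only [Program.exec, NatExpr.eval, State.tick_natMem, State.writeNat_natMem, and_self,
          if_true, i.2, dif_pos, RealExpr.eval, State.writeReal_natMem]
        refine ⟨by simpa using I1, fun j hj => ?_, by simp [State.writeReal_realMem, hin.symm, I3],
          fun j hj => ?_⟩
        · simp only [State.tick_probed, State.writeNat_probed, State.writeReal_probed,
            Finset.mem_insert] at hj
          rcases hj with rfl | hj
          exacts [hprice, I2 j hj]
        · rcases Nat.lt_succ_iff_lt_or_eq.1 hj with hj | hj
          · have hne : (j : ℕ) ≠ i := hj.ne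
            rcases I4 j hj with h | h
            · left
              simp [State.writeReal_realMem, hne, h]
            · right
              simp [State.writeReal_realMem, hne, h]
          · left
            obtain rfl : j = i := Fin.ext hj
            simp [State.writeReal_realMem, hprice, hx]
      · have hprice : 0 < P.price i := by
          simpa [State.writeNat_natMem, hLs.price] using hprice
        have key : ∀ s1 : State n, s1.natMem 7 0 0 = i → SameInput s s1 →
            s1.natMem 4 = s.natMem 4 → s1.realMem 8 = s.realMem 8 → s1.selected = s.selected →
            s1.probed = s.probed →
            let s2 := gradeProgram.exec w s1
            s2.natMem 7 0 0 = i ∧ s2.natMem 4 = s.natMem 4 ∧ s2.realMem 8 = s.realMem 8 ∧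
              s2.selected = s.selected ∧ s2.probed = s.probed ∧
              s2.realMem 9 0 0 = P.grade i := by
          intro s1 g7 gin g4 g8 gs gp
          have hf := Program.exec_frame w gradeProgram s1
          have hL1 := hLs.congr gin
          refine ⟨?_, ?_, ?_, ?_, ?_, gradeProgram_exec hw s1 i g7 (hL1.rows i) (hL1.price i)
            (hL1.rowValue i) (hL1.rowProb i)⟩
          · rw [hf.natMem 7 (by simp [gradeProgram, rowProgram, tailProgram, raiseProgram]), g7]
          · rw [hf.natMem 4 (by simp [gradeProgram, rowProgram, tailProgram, raiseProgram]), g4]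
          · rw [hf.realMem 8 (by simp [gradeProgram, rowProgram, tailProgram, raiseProgram]), g8]
          · rw [hf.selected (by simp [gradeProgram, rowProgram, tailProgram, raiseProgram]), gs]
          · rw [hf.probed (by simp [gradeProgram, rowProgram, tailProgram, raiseProgram]), gp]
        obtain ⟨g7, g4, g8, gs, gp, g9⟩ := key (s.writeNat 7 0 0 i).tick.tick
          (by simp [State.writeNat_natMem])
          ⟨fun a ha => by
            rw [State.tick_natMem, State.tick_natMem,
              State.writeNat_natMem_of_ne _ _ _ _ (by omega)], fun a ha => rfl⟩
          (by funext i j; simp [State.writeNat_natMem]) rfl rfl rfl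
        simp only [Program.exec, NatExpr.eval, State.tick_natMem, g7, RealExpr.eval, g9,
          State.writeReal_natMem]
        refine ⟨by simpa [gs] using I1, fun j hj => I2 j (by simpa [gp] using hj),
          by simp [State.writeReal_realMem, hin.symm, g8, I3], fun j hj => ?_⟩
        rcases Nat.lt_succ_iff_lt_or_eq.1 hj with hj | hj
        · have hne : (j : ℕ) ≠ i := hj.ne
          rcases I4 j hj with h | h
          · left
            simp [State.writeNat_natMem, State.writeReal_realMem, hne, h, g4, g8, gp]
          · right
            simp [State.writeNat_natMem, State.writeReal_realMem, hne, h, g4, g8]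
        · right
          obtain rfl : j = i := Fin.ext hj
          simp [State.writeNat_natMem, State.writeReal_realMem, hprice]
  have hf := Program.exec_frame w setupProgram b
  obtain ⟨I1, I2, I3, I4⟩ := key
  change (setupProgram.exec w b).selected = ∅ at I1
  change ∀ i ∈ (setupProgram.exec w b).probed, P.price i ≤ 0 at I2
  change (setupProgram.exec w b).realMem 8 n 0 = 0 at I3
  have I4 : ∀ i : Fin n,
    (P.price i ≤ 0 ∧ i ∈ (setupProgram.exec w b).probed ∧
      (setupProgram.exec w b).natMem 4 i 0 = 1 ∧ (setupProgram.exec w b).realMem 8 i 0 = x i) ∨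
    (0 < P.price i ∧ (setupProgram.exec w b).natMem 4 i 0 = 2 ∧
      (setupProgram.exec w b).realMem 8 i 0 = P.grade i) := fun i => I4 i i.2
  refine ⟨hf.sameInput
        (fun a ha => by
          simp [setupProgram, gradeProgram, rowProgram, tailProgram, raiseProgram]; omega)
        (fun a ha => by
          simp [setupProgram, gradeProgram, rowProgram, tailProgram, raiseProgram]; omega),
    I3, fun i => ?_, ?_, ?_, fun i => ?_, fun i => ?_, fun i hi => ?_, fun i hi => ?_, ?_,
    fun i hi hlt => ?_, ?_, ?_, fun i _ hi => ?_⟩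
  · rw [hf.natMem 5 (by simp [setupProgram, gradeProgram, rowProgram, tailProgram, raiseProgram]),
      I1]
    simp [h5]
  · simp [I1]
  · rwa [I1]
  · rcases I4 i with h | h
    · rw [h.2.2.1]; simp
    · rw [h.2.1]
  · rcases I4 i with h | h
    · rw [h.2.2.2]; exact Market.capped_le _ _
    · rw [h.2.2, Market.capped, if_neg (not_le.2 h.1)]; exact min_le_right _ _
  · rcases I4 i with h | h
    · rw [h.2.2.1] at hi; simp at hi
    · exact ⟨h.1, h.2.2⟩
  · rcases I4 i with h | h
    · rw [h.2.2.2, Market.capped, if_pos h.1]; simp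
    · rw [h.2.1] at hi; simp at hi
  · simp [I1]
  · rw [Market.capped, if_pos (I2 i hi)] at hlt
    exact absurd hlt (lt_irrefl _)
  · simp [I1]
  · simp [I1]
  · rcases I4 i with h | h
    · rw [h.2.2.1] at hi; simp at hi
    · rw [h.2.1] at hi; simp at hi

/-- The sentinel `n`, with index `0` and weight `1`, is the initial champion, so the first element
to replace it must have positive index. Ratios are compared by cross multiplication, which treats a
positive index of weight `0` as an infinite ratio. -/
theorem argmaxProgram_exec (hwt : ∀ i, 0 ≤ wt i) (s : State n) (hL : Loaded P wt s)
    (h8 : s.realMem 8 n 0 = 0) :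
    ((argmaxProgram.exec w s).natMem 11 0 0 = n ∧
      ∀ i : Fin n, s.natMem 4 i 0 ≠ 0 → s.realMem 8 i 0 ≤ 0) ∨
    ∃ k : Fin n, (argmaxProgram.exec w s).natMem 11 0 0 = k ∧ s.natMem 4 k 0 ≠ 0 ∧
      0 < s.realMem 8 k 0 ∧
      ∀ i : Fin n, s.natMem 4 i 0 ≠ 0 →
        s.realMem 8 i 0 * wt k ≤ s.realMem 8 k 0 * wt i := by
  have key := Program.exec_loop_frame_induct (w := w) (a := 12) (e := .var 0)
    (c := .ite (.and (.natLe (.lit 1) (.entry 4 (.var 12)))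
          (.not (.realLe (.mul (.entry 8 (.var 12)) (.entry 5 (.var 11)))
            (.mul (.entry 8 (.var 11)) (.entry 5 (.var 12))))))
        (.setNatVar 11 (.var 12)) .skip)
    (s := (s.writeNat 11 0 0 n).tick) (m := n) (by simp [State.writeNat_natMem, hL.count])
    (fun t s' =>
      (s'.natMem 11 0 0 = n ∧
        ∀ i : Fin n, (i : ℕ) < t → s.natMem 4 i 0 ≠ 0 → s.realMem 8 i 0 ≤ 0) ∨
      ∃ k : Fin n, s'.natMem 11 0 0 = k ∧ s.natMem 4 k 0 ≠ 0 ∧ 0 < s.realMem 8 k 0 ∧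
        ∀ i : Fin n, (i : ℕ) < t → s.natMem 4 i 0 ≠ 0 →
          s.realMem 8 i 0 * wt k ≤ s.realMem 8 k 0 * wt i)
    (by simp [State.writeNat_natMem]) fun t s' ht hf hI => by
      obtain ⟨i, rfl⟩ : ∃ i : Fin n, (i : ℕ) = t := ⟨⟨t, ht⟩, rfl⟩
      have f4 : s'.natMem 4 = s.natMem 4 := by
        rw [hf.natMem 4 (by simp)]; funext a c; simp [State.writeNat_natMem]
      have f5 : s'.realMem 5 = s.realMem 5 := by
        rw [hf.realMem 5 (by simp)]; rfl
      have f8 : s'.realMem 8 = s.realMem 8 := by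
        rw [hf.realMem 8 (by simp)]; rfl
      rw [Program.exec]
      rcases hI with ⟨h11, hI⟩ | ⟨k, h11, hk, hkpos, hI⟩
      · split_ifs with hc
        · simp [State.writeNat_natMem, f4, f5, f8, h11, h8, hL.sentinel] at hc
          refine Or.inr ⟨i, by simp [State.writeNat_natMem], by omega, hc.2, fun j hj hj4 => ?_⟩
          rcases Nat.lt_succ_iff_lt_or_eq.1 hj with hj | hj
          · exact (mul_nonpos_of_nonpos_of_nonneg (hI j hj hj4) (hwt i)).trans
              (mul_nonneg hc.2.le (hwt j))
          · rw [Fin.ext hj]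
        · simp [State.writeNat_natMem, f4, f5, f8, h11, h8, hL.sentinel] at hc
          refine Or.inl ⟨by simp [State.writeNat_natMem, h11], fun j hj hj4 => ?_⟩
          rcases Nat.lt_succ_iff_lt_or_eq.1 hj with hj | hj
          · exact hI j hj hj4
          · rw [hj] at hj4 ⊢
            exact hc (Nat.one_le_iff_ne_zero.2 hj4)
      · split_ifs with hc
        · simp [State.writeNat_natMem, f4, f5, f8, h11, hL.weight] at hc
          have hipos : 0 < s.realMem 8 i 0 := by
            by_contra! hle
            exact absurd hc.2 (not_lt.2 ((mul_nonpos_of_nonpos_of_nonneg hle (hwt k)).trans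
              (mul_nonneg hkpos.le (hwt i))))
          refine Or.inr ⟨i, by simp [State.writeNat_natMem], by omega, hipos, fun j hj hj4 => ?_⟩
          rcases Nat.lt_succ_iff_lt_or_eq.1 hj with hj | hj
          · have h1 := hI j hj hj4
            -- Transitivity of cross-multiplied comparisons needs the middle weight to be positive.
            -- It is, because a champion of weight `0` and positive index is never strictly beaten.
            have hkw : 0 < wt k := by
              refine lt_of_le_of_ne (hwt k) fun h0 => ?_
              rw [← h0, mul_zero] at hc
              exact absurd hc.2 (not_lt.2 (mul_nonneg hkpos.le (hwt i)))
            have h2 : s.realMem 8 j 0 * wt i * wt k ≤ s.realMem 8 i 0 * wt j * wt k := by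
              nlinarith [mul_le_mul_of_nonneg_right h1 (hwt i),
                mul_le_mul_of_nonneg_right hc.2.le (hwt j)]
            exact le_of_mul_le_mul_right h2 hkw
          · rw [Fin.ext hj]
        · simp [State.writeNat_natMem, f4, f5, f8, h11, hL.weight] at hc
          refine Or.inr ⟨k, by simp [State.writeNat_natMem, h11], hk, hkpos, fun j hj hj4 => ?_⟩
          rcases Nat.lt_succ_iff_lt_or_eq.1 hj with hj | hj
          · exact hI j hj hj4
          · obtain rfl : j = i := Fin.ext hj
            exact hc (Nat.one_le_iff_ne_zero.2 hj4)
  have hexec : argmaxProgram.exec w s = Program.exec w (.loop 12 (.var 0)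
      (.ite (.and (.natLe (.lit 1) (.entry 4 (.var 12)))
          (.not (.realLe (.mul (.entry 8 (.var 12)) (.entry 5 (.var 11)))
            (.mul (.entry 8 (.var 11)) (.entry 5 (.var 12))))))
        (.setNatVar 11 (.var 12)) .skip)) (s.writeNat 11 0 0 n).tick := by
    rw [argmaxProgram, Program.exec, Program.exec]
    simp only [NatExpr.eval, hL.count]
  rw [hexec]
  rcases key with ⟨h, h'⟩ | ⟨k, h, h1, h2, h'⟩
  · exact Or.inl ⟨h, fun i => h' i i.2⟩
  · exact Or.inr ⟨k, h, h1, h2, fun i => h' i i.2⟩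

/-- The state `s'` results from `s` by a change that concerns element `i` only. -/
structure Effect (s s' : State n) (i : Fin n) (status : ℕ) (index : ℝ)
    (probed selected : Finset (Fin n)) : Prop where
  input : SameInput s s'
  status : ∀ j : ℕ, s'.natMem 4 j 0 = if j = i then status else s.natMem 4 j 0
  index : ∀ j : ℕ, s'.realMem 8 j 0 = if j = i then index else s.realMem 8 j 0
  probed : s'.probed = probed
  selected : s'.selected = selected
  chosen : ∀ j : Fin n, s'.natMem 5 j 0 ≠ 0 ↔ j ∈ s'.selected

/-- The three outcomes are acceptance, deferral with the index lowered to the value, and rejection.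
An element of status `1` is probed again when it is accepted; as the probed elements form a set, its
price is still paid once. -/
theorem processProgram_exec (hx : w.values = x) (hL : Loaded P wt b) (hC : Checks w b F check)
    {s : State n} (hs : SameInput b s)
    (h5 : ∀ i : Fin n, s.natMem 5 i 0 ≠ 0 ↔ i ∈ s.selected) {i : Fin n}
    (hi : s.natMem 11 0 0 = i) (his : i ∉ s.selected) :
    (insert i s.selected ∈ F ∧ s.realMem 8 i 0 ≤ x i ∧
      Effect s ((processProgram check).exec w s) i 0 (s.realMem 8 i 0) (insert i s.probed)
        (insert i s.selected)) ∨
    (insert i s.selected ∈ F ∧ x i < s.realMem 8 i 0 ∧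
      Effect s ((processProgram check).exec w s) i 1 (x i) (insert i s.probed) s.selected) ∨
    (insert i s.selected ∉ F ∧
      Effect s ((processProgram check).exec w s) i 0 (s.realMem 8 i 0) s.probed s.selected) := by
  have hif : (NatExpr.eval s (.add (.var 11) (.lit 1))) ≤ NatExpr.eval s (.var 0) := by
    simp [hi, (hL.congr hs).count]
  have key : ∀ s1 : State n, s1 = (s.tick.writeNat 5 i 0 1).tick →
      (processProgram check).exec w s =
        Program.exec w (.ite (.natLe (.lit 1) (.var 6)) acceptProgram discardProgram)
          (check.exec w s1) := by
    rintro _ rfl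
    rw [processProgram, Program.exec, Test.holds, if_pos hif, Program.exec, Program.exec,
      Program.exec]
    simp only [NatExpr.eval, State.tick_natMem, hi]
  obtain ⟨s1, hs1⟩ : ∃ s1 : State n, s1 = (s.tick.writeNat 5 i 0 1).tick := ⟨_, rfl⟩
  rw [key s1 hs1]
  have hin1 : SameInput s s1 := by
    rw [hs1]
    exact ⟨fun a ha => State.writeNat_natMem_of_ne _ _ _ _ (by omega), fun a ha => rfl⟩
  have hchosen1 : ∀ j : Fin n, s1.natMem 5 j 0 ≠ 0 ↔ j ∈ insert i s.selected := by
    intro j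
    rw [hs1, Finset.mem_insert, ← h5 j]
    by_cases hj : j = i
    · simp [State.writeNat_natMem, hj]
    · have : (j : ℕ) ≠ i := fun h => hj (Fin.ext h)
      simp [State.writeNat_natMem, hj, this]
  have hans := hC.answer s1 (insert i s.selected) (hs.trans hin1) hchosen1
  have hf := Program.exec_frame w check s1
  generalize check.exec w s1 = s2 at hans hf
  have hN : ∀ a, a ≠ 6 → a ≤ 12 → ¬ check.WritesNat a := fun a ha ha' h => by
    rcases hC.writesNat a h with h | h <;> omega
  have hR : ∀ a, a ≤ 11 → ¬ check.WritesReal a := fun a ha h => by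
    have := hC.writesReal a h
    omega
  have hin2 : SameInput s s2 := hin1.trans
    (hf.sameInput (fun a ha => hN a (by omega) (by omega)) fun a ha => hR a (by omega))
  have g11 : s2.natMem 11 0 0 = i := by
    rw [hf.natMem 11 (hN _ (by simp) (by simp)), hs1]; simp [State.writeNat_natMem, hi]
  have g4 : s2.natMem 4 = s.natMem 4 := by
    rw [hf.natMem 4 (hN _ (by simp) (by simp)), hs1]; funext a c; simp [State.writeNat_natMem]
  have g5 : s2.natMem 5 = s1.natMem 5 := hf.natMem 5 (hN _ (by simp) (by simp))
  have g8 : s2.realMem 8 = s.realMem 8 := by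
    rw [hf.realMem 8 (hR _ (by simp)), hs1]; rfl
  have gp : s2.probed = s.probed := by rw [hf.probed hC.silent, hs1]; rfl
  have gs : s2.selected = s.selected := by rw [hf.selected hC.silent, hs1]; rfl
  rw [← g5] at hchosen1
  -- The mark of `i` is set before the check, so that the check sees the enlarged set; deferral and
  -- rejection have to erase it again.
  have hdel : ∀ j : Fin n,
      (if (j : ℕ) = i then 0 else s2.natMem 5 j 0) ≠ 0 ↔ j ∈ s.selected := by
    intro j
    by_cases hj : j = i
    · simp [hj, his]
    · have : (j : ℕ) ≠ i := fun h => hj (Fin.ext h)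
      rw [if_neg this, hchosen1 j]
      simp [hj]
  by_cases hF : insert i s.selected ∈ F
  · have h6 : 1 ≤ s2.natMem 6 0 0 := Nat.one_le_iff_ne_zero.2 (hans.2 hF)
    have hprobe : Program.exec w (.probe 7 (.var 11)) s2.tick =
        { (s2.tick.writeReal 7 i 0 (x i)).tick with probed := insert i s2.probed } := by
      simp [g11, hx]
    rw [Program.exec, if_pos (by simpa using h6), acceptProgram, Program.exec, hprobe, Program.exec]
    split_ifs with hc
    · have hle : s.realMem 8 i 0 ≤ x i := by
        simpa [State.writeReal_realMem, g11, g8] using hc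
      refine Or.inl ⟨hF, hle, ?_⟩
      simp only [Program.exec, NatExpr.eval, State.tick_natMem, State.writeReal_natMem, g11, i.2,
        dif_pos]
      refine ⟨hin2.trans ⟨fun a ha => ?_, fun a ha => ?_⟩, fun j => ?_, fun j => ?_, ?_, ?_,
        fun j => ?_⟩
      · funext c d
        have : a ≠ 4 := by omega
        simp [State.writeNat_natMem, this]
      · funext c d
        have : a ≠ 7 := by omega
        simp [State.writeReal_realMem, this]
      · simp [State.writeNat_natMem, g4]
      · by_cases hj : j = i
        · simp [State.writeReal_realMem, g8, hj]
        · simp [State.writeReal_realMem, g8, hj]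
      · simp [gp]
      · simp [gs]
      · simpa [State.writeNat_natMem, gs] using hchosen1 j
    · have hlt : x i < s.realMem 8 i 0 := by
        simpa [State.writeReal_realMem, g11, g8] using hc
      refine Or.inr (Or.inl ⟨hF, hlt, ?_⟩)
      simp only [Program.exec, NatExpr.eval, RealExpr.eval, State.tick_natMem,
        State.writeReal_natMem, g11]
      refine ⟨hin2.trans ⟨fun a ha => ?_, fun a ha => ?_⟩, fun j => ?_, fun j => ?_, ?_, ?_,
        fun j => ?_⟩
      · funext c d
        have h4 : a ≠ 4 := by omega
        have h5 : a ≠ 5 := by omega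
        simp [State.writeNat_natMem, h4, h5]
      · funext c d
        have h7 : a ≠ 7 := by omega
        have h8 : a ≠ 8 := by omega
        simp [State.writeReal_realMem, h7, h8]
      · simp [State.writeNat_natMem, g4, g11]
      · by_cases hj : j = i
        · simp [State.writeReal_realMem, hj]
        · simp [State.writeReal_realMem, g8, hj]
      · simp [gp]
      · simp [gs]
      · simpa [State.writeNat_natMem, g11, gs] using hdel j
  · have h6 : ¬ 1 ≤ s2.natMem 6 0 0 := fun h => hF (hans.1 (Nat.one_le_iff_ne_zero.1 h))
    refine Or.inr (Or.inr ⟨hF, ?_⟩)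
    rw [Program.exec, if_neg (by simpa using h6)]
    simp only [NatExpr.eval, discardProgram, Program.exec, State.tick_natMem, g11]
    refine ⟨hin2.trans ⟨fun a ha => ?_, fun a ha => ?_⟩, fun j => ?_, fun j => ?_, ?_, ?_,
      fun j => ?_⟩
    · funext c d
      have h4 : a ≠ 4 := by omega
      have h5 : a ≠ 5 := by omega
      simp [State.writeNat_natMem, h4, h5]
    · rfl
    · simp [State.writeNat_natMem, g4, g11]
    · by_cases hj : j = i
      · simp [hj, g8]
      · simp [hj, g8]
    · simp [gp]
    · simp [gs]
    · simpa [State.writeNat_natMem, g11, gs] using hdel j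

namespace Invariant

variable {s s' : State n} {k : Fin n}

theorem not_mem_of_status (h : Invariant P x F wt b s) (hk : s.natMem 4 k 0 ≠ 0) :
    k ∉ s.selected := fun hks => hk (h.done k hks)

theorem congr (h : Invariant P x F wt b s) (hin : SameInput s s')
    (h4 : s'.natMem 4 = s.natMem 4) (h5 : s'.natMem 5 = s.natMem 5)
    (h8 : s'.realMem 8 = s.realMem 8) (hp : s'.probed = s.probed)
    (hs : s'.selected = s.selected) : Invariant P x F wt b s' := by
  refine ⟨h.input.trans hin, ?_, ?_, ?_, ?_, ?_, ?_, ?_, ?_, ?_, ?_, ?_, ?_, ?_⟩ <;>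
    simp only [h4, h5, h8, hp, hs]
  exacts [h.sentinel, h.chosen, h.subset, h.feasible, h.status_le, h.capped_le, h.closed, h.opened,
    h.done, h.frugal, h.pos, h.dominated, h.blocked]

/-- The index of an accepted element equals its capped value, so the maximality of its ratio gives
the new domination inequalities. Enlarging the selection keeps blocked elements blocked because `F`
is downward closed. -/
theorem accept (h : Invariant P x F wt b s) (hF : ∀ A ∈ F, ∀ B ⊆ A, B ∈ F)
    (hk : s.natMem 4 k 0 ≠ 0) (hpos : 0 < s.realMem 8 k 0)
    (hmax : ∀ i : Fin n, s.natMem 4 i 0 ≠ 0 → s.realMem 8 i 0 * wt k ≤ s.realMem 8 k 0 * wt i)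
    (hfeas : insert k s.selected ∈ F) (hle : s.realMem 8 k 0 ≤ x k)
    (he : Effect s s' k 0 (s.realMem 8 k 0) (insert k s.probed) (insert k s.selected)) :
    Invariant P x F wt b s' := by
  -- For an opened element the index is its value, which equals the capped value. For a closed one
  -- it is the grade, and the cap is effective because the value reaches the grade.
  have hcap : P.capped k (x k) = s.realMem 8 k 0 := by
    have h2 := h.status_le k
    have h3 : s.natMem 4 k 0 = 1 ∨ s.natMem 4 k 0 = 2 := by omega
    rcases h3 with h1 | h2
    · rw [(h.opened k h1).1]
      exact le_antisymm (Market.capped_le _ _) (h.opened k h1).2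
    · rw [(h.closed k h2).2] at hle ⊢
      rw [Market.capped, if_neg (not_le.2 (h.closed k h2).1), min_eq_right hle]
  have hidx : ∀ i : ℕ, s'.realMem 8 i 0 = s.realMem 8 i 0 := fun i => by
    rw [he.index]
    split_ifs with hi
    exacts [by rw [hi], rfl]
  have hst : ∀ i : Fin n, s'.natMem 4 i 0 ≠ 0 → s.natMem 4 i 0 ≠ 0 ∧
      s'.natMem 4 i 0 = s.natMem 4 i 0 := fun i hi => by
    rw [he.status] at hi ⊢
    split_ifs at hi ⊢ with h'
    exacts [absurd rfl hi, ⟨hi, rfl⟩]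
  refine ⟨h.input.trans he.input, ?_, ?_, ?_, ?_, fun i => ?_, fun i => ?_, fun i hi => ?_,
    fun i hi => ?_, fun i hi => ?_, fun i hi hlt => ?_, fun i hi => ?_, fun j hj i hi => ?_,
    fun i hi h0 => ?_⟩
  · rw [hidx, h.sentinel]
  · exact he.chosen
  · rw [he.selected, he.probed]; exact Finset.insert_subset_insert _ h.subset
  · rwa [he.selected]
  · rw [he.status]
    split_ifs
    exacts [Nat.zero_le _, h.status_le i]
  · rw [hidx]; exact h.capped_le i
  · rw [hidx]
    have := hst i (by omega)
    exact h.closed i (by omega)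
  · rw [hidx]
    have := hst i (by omega)
    exact h.opened i (by omega)
  · rw [he.selected, Finset.mem_insert] at hi
    rw [he.status]
    split_ifs with hik
    · rfl
    · exact h.done i (hi.resolve_left fun h' => hik (congrArg _ h'))
  · rw [he.probed, Finset.mem_insert] at hi
    rw [he.selected, Finset.mem_insert]
    exact hi.imp id fun hi => h.frugal i hi hlt
  · rw [he.selected, Finset.mem_insert] at hi
    rcases hi with rfl | hi
    · rwa [hcap]
    · exact h.pos i hi
  · rw [he.selected, Finset.mem_insert] at hj
    rw [hidx]
    rcases hj with rfl | hj
    · rw [hcap]; exact hmax i (hst i hi).1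
    · exact h.dominated j hj i (hst i hi).1
  · rw [he.selected, Finset.mem_insert, not_or] at hi
    rw [he.status, if_neg fun h' => hi.1 (Fin.ext h')] at h0
    rw [he.selected]
    exact fun hmem => h.blocked i hi.2 h0 (hF _ hmem _ (Finset.insert_subset_insert _
      (Finset.filter_subset_filter _ (Finset.subset_insert _ _))))

/-- Only a closed element can miss its index, as an opened one has its value as index. A value below
the grade is not capped, so leaving the probed element unselected loses nothing; and lowering an
index preserves domination. -/
theorem defer (h : Invariant P x F wt b s) (hwt : ∀ i, 0 ≤ wt i)
    (hk : s.natMem 4 k 0 ≠ 0) (hlt : x k < s.realMem 8 k 0)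
    (he : Effect s s' k 1 (x k) (insert k s.probed) s.selected) :
    Invariant P x F wt b s' ∧ s.natMem 4 k 0 = 2 := by
  have h2 : s.natMem 4 k 0 = 2 := by
    have h2 := h.status_le k
    by_contra hne
    exact absurd (h.opened k (by omega)).1 hlt.ne'
  have hcap : P.capped k (x k) = x k := by
    rw [(h.closed k h2).2] at hlt
    rw [Market.capped, if_neg (not_le.2 (h.closed k h2).1), min_eq_left hlt.le]
  have hks := h.not_mem_of_status hk
  refine ⟨⟨h.input.trans he.input, ?_, ?_, ?_, ?_, fun i => ?_, fun i => ?_, fun i hi => ?_,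
    fun i hi => ?_, fun i hi => ?_, fun i hi hy => ?_, ?_, fun j hj i hi => ?_,
    fun i hi h0 => ?_⟩, h2⟩
  · rw [he.index, if_neg k.2.ne', h.sentinel]
  · exact he.chosen
  · rw [he.selected, he.probed]; exact h.subset.trans (Finset.subset_insert _ _)
  · rw [he.selected]; exact h.feasible
  · rw [he.status]
    split_ifs
    exacts [by simp, h.status_le i]
  · rw [he.index]
    split_ifs with hi
    · rw [Fin.ext hi]; exact hcap.le
    · exact h.capped_le i
  · rw [he.status] at hi
    rw [he.index]
    split_ifs at hi ⊢
    · simp at hi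
    · exact h.closed i hi
  · rw [he.status] at hi
    rw [he.index]
    split_ifs at hi ⊢ with hik
    · rw [Fin.ext hik]; exact ⟨rfl, hcap.ge⟩
    · exact h.opened i hi
  · rw [he.selected] at hi
    rw [he.status]
    split_ifs with hik
    · rw [Fin.ext hik] at hi; exact absurd hi hks
    · exact h.done i hi
  · rw [he.probed, Finset.mem_insert] at hi
    rw [he.selected]
    rcases hi with rfl | hi
    · exact absurd hy (by rw [hcap]; exact lt_irrefl _)
    · exact h.frugal i hi hy
  · rw [he.selected]; exact h.pos
  · rw [he.selected] at hj
    rw [he.index]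
    rw [he.status] at hi
    split_ifs at hi ⊢ with hik
    · rw [Fin.ext hik]
      exact (mul_le_mul_of_nonneg_right hlt.le (hwt j)).trans (h.dominated j hj k hk)
    · exact h.dominated j hj i hi
  · rw [he.selected] at hi ⊢
    rw [he.status] at h0
    split_ifs at h0
    exact h.blocked i hi h0

/-- By domination every selected element has at least the ratio of the discarded one, even with the
index in place of the smaller capped value. The filter in `blocked` is thus the whole selection, and
the failed check is the required infeasibility. -/
theorem discard (h : Invariant P x F wt b s) (hwt : ∀ i, 0 ≤ wt i)
    (hk : s.natMem 4 k 0 ≠ 0) (hfeas : insert k s.selected ∉ F)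
    (he : Effect s s' k 0 (s.realMem 8 k 0) s.probed s.selected) :
    Invariant P x F wt b s' := by
  have hidx : ∀ i : ℕ, s'.realMem 8 i 0 = s.realMem 8 i 0 := fun i => by
    rw [he.index]
    split_ifs with hi
    exacts [by rw [hi], rfl]
  have hst : ∀ i : Fin n, s'.natMem 4 i 0 ≠ 0 → s.natMem 4 i 0 ≠ 0 ∧
      s'.natMem 4 i 0 = s.natMem 4 i 0 := fun i hi => by
    rw [he.status] at hi ⊢
    split_ifs at hi ⊢ with h'
    exacts [absurd rfl hi, ⟨hi, rfl⟩]
  refine ⟨h.input.trans he.input, ?_, ?_, ?_, ?_, fun i => ?_, fun i => ?_, fun i hi => ?_,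
    fun i hi => ?_, fun i hi => ?_, ?_, ?_, fun j hj i hi => ?_,
    fun i hi h0 => ?_⟩
  · rw [hidx, h.sentinel]
  · exact he.chosen
  · rw [he.selected, he.probed]; exact h.subset
  · rw [he.selected]; exact h.feasible
  · rw [he.status]
    split_ifs
    exacts [Nat.zero_le _, h.status_le i]
  · rw [hidx]; exact h.capped_le i
  · rw [hidx]
    have := hst i (by omega)
    exact h.closed i (by omega)
  · rw [hidx]
    have := hst i (by omega)
    exact h.opened i (by omega)
  · rw [he.selected] at hi
    rw [he.status]
    split_ifs
    exacts [rfl, h.done i hi]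
  · rw [he.selected, he.probed]; exact h.frugal
  · rw [he.selected]; exact h.pos
  · rw [he.selected] at hj
    rw [hidx]
    exact h.dominated j hj i (hst i hi).1
  · rw [he.selected] at hi ⊢
    rw [he.status] at h0
    by_cases hik : i = k
    · subst hik
      rwa [Finset.filter_true_of_mem fun j hj =>
        (mul_le_mul_of_nonneg_right (h.capped_le i) (hwt j)).trans (h.dominated j hj i hk)]
    · rw [if_neg fun h' => hik (Fin.ext h')] at h0
      exact h.blocked i hi h0

end Invariant

/-- The sum of the statuses is the potential of the loop: it is at most 2n and every effective round
lowers it. -/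
theorem Effect.sum_status_lt {s s' : State n} {k : Fin n} {v : ℕ} {r : ℝ} {A I : Finset (Fin n)}
    (he : Effect s s' k v r A I) (h : v < s.natMem 4 k 0) :
    ∑ i : Fin n, s'.natMem 4 i 0 < ∑ i : Fin n, s.natMem 4 i 0 := by
  refine Finset.sum_lt_sum (fun i _ => ?_) ⟨k, Finset.mem_univ k, ?_⟩
  · rw [he.status]
    split_ifs with hi
    · rw [hi]; exact h.le
    · exact le_rfl
  · rw [he.status, if_pos rfl]
    exact h

/-- The set `S` may result from selecting elements greedily, in the order of decreasing ratios of
the positive values `y` to the weights `wt`. -/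
structure IsGreedy (F : Set (Finset (Fin n))) (wt y : Fin n → ℝ) (S : Finset (Fin n)) : Prop where
  mem : S ∈ F
  pos : ∀ j ∈ S, 0 < y j
  blocked : ∀ i ∉ S, 0 < y i → insert i (S.filter fun j => y i * wt j ≤ y j * wt i) ∉ F

theorem greedyProgram_exec (hw : w.dist = P.dist) (hx : w.values = x) (hL : Loaded P wt b)
    (hwt : ∀ i, 0 ≤ wt i) (hC : Checks w b F check) (hF : ∀ A ∈ F, ∀ B ⊆ A, B ∈ F)
    (h0 : ∅ ∈ F) (h5 : ∀ i : Fin n, b.natMem 5 i 0 = 0) (h8 : b.realMem 8 n 0 = 0)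
    (hp : b.probed = ∅) (hs : b.selected = ∅) :
    let s := (greedyProgram check).exec w b
    IsGreedy F wt (fun i => P.capped i (x i)) s.selected ∧ s.selected ⊆ s.probed ∧
      ∀ i ∈ s.probed, P.capped i (x i) < x i → i ∈ s.selected := by
  have hsetup := setupProgram_exec hw hx hL h0 h5 h8 hp hs
  intro s
  -- This is the loop invariant at the last round `n + n`: either each round so far has lowered the
  -- potential, or no undecided element with positive index is left.
  have key : Invariant P x F wt b s ∧ (∑ i : Fin n, s.natMem 4 i 0 + (n + n) ≤ n + n ∨
      ∀ i : Fin n, s.natMem 4 i 0 ≠ 0 → s.realMem 8 i 0 ≤ 0) := by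
    refine Program.exec_loop_frame_induct (w := w) (a := 10) (e := .add (.var 0) (.var 0))
      (c := .seq argmaxProgram (processProgram check)) (s := setupProgram.exec w b) (m := n + n)
      (by simp [(hL.congr hsetup.input).count])
      (fun t s => Invariant P x F wt b s ∧ (∑ i : Fin n, s.natMem 4 i 0 + t ≤ n + n ∨
        ∀ i : Fin n, s.natMem 4 i 0 ≠ 0 → s.realMem 8 i 0 ≤ 0)) ⟨?_, Or.inl ?_⟩ ?_
    · exact hsetup.congr ⟨fun _ _ => rfl, fun _ _ => rfl⟩ rfl rfl rfl rfl rfl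
    · have := Finset.sum_le_card_nsmul Finset.univ
        (fun i : Fin n => (setupProgram.exec w b).natMem 4 i 0) 2 fun i _ => hsetup.status_le i
      simp only [Finset.card_univ, Fintype.card_fin, smul_eq_mul] at this
      simp only [State.tick_natMem]
      omega
    · rintro t s - - ⟨hI, hpot⟩
      rw [Program.exec]
      obtain ⟨s1, hs1⟩ : ∃ s1 : State n, s1 = (s.writeNat 10 0 0 t).tick := ⟨_, rfl⟩
      rw [← hs1]
      have h4 : s1.natMem 4 = s.natMem 4 := by
        rw [hs1, State.tick_natMem, State.writeNat_natMem_of_ne _ _ _ _ (by omega)]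
      have h8 : s1.realMem 8 = s.realMem 8 := by rw [hs1]; rfl
      have hI1 : Invariant P x F wt b s1 := by
        refine hI.congr ⟨fun a ha => ?_, fun a ha => ?_⟩ h4 ?_ h8 ?_ ?_
        · rw [hs1, State.tick_natMem, State.writeNat_natMem_of_ne _ _ _ _ (by omega)]
        · rw [hs1]; rfl
        · rw [hs1, State.tick_natMem, State.writeNat_natMem_of_ne _ _ _ _ (by omega)]
        · rw [hs1]; rfl
        · rw [hs1]; rfl
      rw [← h4, ← h8] at hpot
      clear hI h4 h8 hs1 s
      have harg := argmaxProgram_exec (w := w) hwt s1 (hL.congr hI1.input) hI1.sentinel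
      have hf := Program.exec_frame w argmaxProgram s1
      generalize argmaxProgram.exec w s1 = s2 at harg hf
      have h4 : s2.natMem 4 = s1.natMem 4 := hf.natMem 4 (by simp [argmaxProgram])
      have h8 : s2.realMem 8 = s1.realMem 8 := hf.realMem 8 (by simp [argmaxProgram])
      have hI2 : Invariant P x F wt b s2 := by
        refine hI1.congr (hf.sameInput (fun a ha => ?_) fun a ha => ?_) h4
          (hf.natMem 5 (by simp [argmaxProgram])) h8 (hf.probed (by simp [argmaxProgram]))
          (hf.selected (by simp [argmaxProgram]))
        · simp [argmaxProgram]; omega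
        · simp [argmaxProgram]
      rw [← h4, ← h8] at hpot harg
      clear hI1 h4 h8 hf s1
      rcases harg with ⟨h11, hnone⟩ | ⟨k, h11, hk, hkpos, hmax⟩
      · have : (processProgram check).exec w s2 = s2.tick.tick := by
          rw [processProgram, Program.exec, if_neg]
          · rfl
          · simp [h11, (hL.congr hI2.input).count]
        rw [this]
        exact ⟨hI2.congr ⟨fun _ _ => rfl, fun _ _ => rfl⟩ rfl rfl rfl rfl rfl, Or.inr hnone⟩
      · have hpot : ∑ i : Fin n, s2.natMem 4 i 0 + t ≤ n + n :=
          hpot.resolve_right fun h => absurd (h k hk) (not_le.2 hkpos)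
        rcases processProgram_exec hx hL hC hI2.input hI2.chosen h11
          (hI2.not_mem_of_status hk) with ⟨h1, h2, he⟩ | ⟨h1, h2, he⟩ | ⟨h1, he⟩
        · have := he.sum_status_lt (by omega)
          exact ⟨hI2.accept hF hk hkpos hmax h1 h2 he, Or.inl (by omega)⟩
        · have hd := hI2.defer hwt hk h2 he
          have := he.sum_status_lt (by omega)
          exact ⟨hd.1, Or.inl (by omega)⟩
        · have := he.sum_status_lt (by omega)
          exact ⟨hI2.discard hwt hk h1 he, Or.inl (by omega)⟩
  obtain ⟨hI, hpot⟩ := key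
  refine ⟨⟨hI.feasible, hI.pos, fun i hi hy => hI.blocked i hi ?_⟩, hI.subset, hI.frugal⟩
  -- An unselected element of positive capped value must have status `0`: the potential is
  -- exhausted, or else its index, which is at least the capped value, would be non-positive.
  by_contra hst
  rcases hpot with h | h
  · have : ∑ i : Fin n, s.natMem 4 i 0 = 0 := by omega
    exact hst (Finset.sum_eq_zero_iff.1 this i (Finset.mem_univ i))
  · exact absurd ((hI.capped_le i).trans (h i hst)) (not_le.2 hy)

end Greedy

/-! ## Greedy sets in packing families -/

theorem setIntegral_Ioc_indicator_Iic {v M : ℝ} (h0 : 0 ≤ v) (hM : v ≤ M) :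
    ∫ t in Set.Ioc 0 M, (Set.Iic v).indicator (fun _ => (1 : ℝ)) t = v := by
  rw [setIntegral_indicator measurableSet_Iic, Set.Ioc_inter_Iic, min_eq_right hM]
  simp [h0]

/-- Layer-cake formula: a sum of positive numbers is the integral over t > 0 of the number of terms
that are at least t. Terms of `O` that are not positive only help. -/
theorem sum_le_mul_sum_of_card_le {ι : Type*} {O S : Finset ι} {y : ι → ℝ} {k : ℝ}
    (hS : ∀ j ∈ S, 0 < y j)
    (h : ∀ t > 0, ((O.filter fun i => t ≤ y i).card : ℝ) ≤
      k * (S.filter fun i => t ≤ y i).card) :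
    ∑ i ∈ O, y i ≤ k * ∑ i ∈ S, y i := by
  classical
  obtain ⟨M, hM⟩ : ∃ M, ∀ i ∈ O ∪ S, y i ≤ M := by
    obtain ⟨M, hM⟩ := ((O ∪ S).image y).bddAbove
    exact ⟨M, fun i hi => hM (Finset.mem_image_of_mem y hi)⟩
  have hint : ∀ v : ℝ, IntegrableOn ((Set.Iic v).indicator fun _ => (1 : ℝ)) (Set.Ioc 0 M) :=
    fun v => (integrable_const (1 : ℝ)).indicator measurableSet_Iic
  have hlayer : ∀ T : Finset ι, (∀ i ∈ T, 0 < y i ∧ y i ≤ M) →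
      ∑ i ∈ T, y i = ∫ t in Set.Ioc 0 M, ((T.filter fun i => t ≤ y i).card : ℝ) := by
    intro T hT
    have : ∀ t : ℝ, ((T.filter fun i => t ≤ y i).card : ℝ) =
        ∑ i ∈ T, (Set.Iic (y i)).indicator (fun _ => (1 : ℝ)) t := by
      intro t
      rw [Finset.card_filter]
      push_cast
      exact Finset.sum_congr rfl fun i _ => by simp [Set.indicator_apply]
    simp only [this]
    rw [integral_finsetSum _ fun i _ => hint (y i)]
    exact Finset.sum_congr rfl fun i hi =>
      (setIntegral_Ioc_indicator_Iic (hT i hi).1.le (hT i hi).2).symm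
  have hcard : ∀ T : Finset ι,
      IntegrableOn (fun t => ((T.filter fun i => t ≤ y i).card : ℝ)) (Set.Ioc 0 M) := by
    intro T
    have : (fun t => ((T.filter fun i => t ≤ y i).card : ℝ)) =
        fun t => ∑ i ∈ T, (Set.Iic (y i)).indicator (fun _ => (1 : ℝ)) t := by
      funext t
      rw [Finset.card_filter]
      push_cast
      exact Finset.sum_congr rfl fun i _ => by simp [Set.indicator_apply]
    rw [this]
    exact integrable_finsetSum _ fun i _ => hint (y i)
  calc ∑ i ∈ O, y i ≤ ∑ i ∈ O.filter (0 < y ·), y i := by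
        rw [← Finset.sum_filter_add_sum_filter_not O (0 < y ·)]
        have : ∑ i ∈ O.filter (¬ 0 < y ·), y i ≤ 0 :=
          Finset.sum_nonpos fun i hi => not_lt.1 (Finset.mem_filter.1 hi).2
        linarith
    _ = ∫ t in Set.Ioc 0 M, (((O.filter (0 < y ·)).filter fun i => t ≤ y i).card : ℝ) :=
        hlayer _ fun i hi => ⟨(Finset.mem_filter.1 hi).2,
          hM i (Finset.mem_union_left _ (Finset.mem_filter.1 hi).1)⟩
    _ ≤ ∫ t in Set.Ioc 0 M, k * ((S.filter fun i => t ≤ y i).card : ℝ) := by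
        refine setIntegral_mono_on (hcard _) ((hcard S).const_mul k) measurableSet_Ioc
          fun t ht => le_trans ?_ (h t ht.1)
        exact_mod_cast Finset.card_le_card
          (Finset.filter_subset_filter _ (Finset.filter_subset _ _))
    _ = k * ∑ i ∈ S, y i := by
        rw [integral_const_mul, ← hlayer S fun i hi =>
          ⟨hS i hi, hM i (Finset.mem_union_right _ hi)⟩]

namespace IsGreedy

variable {F : Set (Finset (Fin n))} {wt y : Fin n → ℝ} {S : Finset (Fin n)}

theorem sum_nonneg (h : IsGreedy F wt y S) : 0 ≤ ∑ i ∈ S, y i :=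
  Finset.sum_nonneg fun i hi => (h.pos i hi).le

/-- For t > 0, an element outside `S` with `t ≤ y i` is blocked by the selected elements of at least
its value, all of which lie in the level set `Y`. So `S` restricted to `Y` is maximal there and
compares with a maximal extension of `O` restricted to `Y`. -/
theorem sum_le_of_isKSystem (h : IsGreedy F (fun _ => 1) y S)
    (hF : ∀ A ∈ F, ∀ B ⊆ A, B ∈ F) {k : ℝ} (hk : IsKSystem F k) {O : Finset (Fin n)}
    (hO : O ∈ F) : ∑ i ∈ O, y i ≤ k * ∑ i ∈ S, y i := by
  refine sum_le_mul_sum_of_card_le h.pos fun t ht => ?_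
  set Y : Finset (Fin n) := Finset.univ.filter fun i => t ≤ y i with hY
  have hsub : ∀ T : Finset (Fin n), (T.filter fun i => t ≤ y i) ⊆ Y := fun T =>
    Finset.filter_subset_filter _ (Finset.subset_univ T)
  obtain ⟨A, hOA, hA⟩ := Set.Finite.exists_le_maximal
    (s := {T : Finset (Fin n) | T ∈ F ∧ T ⊆ Y}) (Set.toFinite _)
    (a := O.filter fun i => t ≤ y i) ⟨hF _ hO _ (Finset.filter_subset _ _), hsub O⟩
  have hB : Maximal (fun T => T ∈ F ∧ T ⊆ Y) (S.filter fun i => t ≤ y i) := by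
    refine ⟨⟨hF _ h.mem _ (Finset.filter_subset _ _), hsub S⟩, fun C hC hBC i hi => ?_⟩
    have hiY : t ≤ y i := (Finset.mem_filter.1 (hC.2 hi)).2
    rw [Finset.mem_filter]
    refine ⟨?_, hiY⟩
    by_contra hiS
    refine h.blocked i hiS (ht.trans_le hiY) (hF C hC.1 _ (Finset.insert_subset hi ?_))
    intro j hj
    rw [Finset.mem_filter] at hj
    exact hBC (Finset.mem_filter.2 ⟨hj.1, by linarith [hj.2]⟩)
  refine le_trans ?_ (hk Y A _ hA hB)
  exact_mod_cast Finset.card_le_card hOA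

/-- Let `i` have the largest density `d` among the positive items of `O \ S`, and let `T` be the
selected items of density at least `d`. Since `i` is blocked by `T` while `O` fits, the size of `O \
S` is at most that of `i` plus that of `T \ O`. Multiplied by `d`, this bounds the value of `O \ S`
by `y i` plus the value of `S \ O`, so `O` beats `S` by at most one item. -/
theorem sum_le_of_knapsack {B : ℝ} {size : Fin n → ℝ} (hsize : ∀ i, 0 ≤ size i)
    (h : IsGreedy (knapsackSets B size) size y S) {m : ℝ} (hm : 0 ≤ m) (hym : ∀ i, y i ≤ m)
    {O : Finset (Fin n)} (hO : O ∈ knapsackSets B size) :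
    ∑ i ∈ O, y i ≤ ∑ i ∈ S, y i + m := by
  have hsplit := Finset.sum_inter_add_sum_sdiff O S y
  have hsplitS := Finset.sum_inter_add_sum_sdiff S O y
  have hSO : 0 ≤ ∑ i ∈ S \ O, y i :=
    Finset.sum_nonneg fun i hi => (h.pos i (Finset.mem_sdiff.1 hi).1).le
  rw [Finset.inter_comm] at hsplitS
  have hpos : ∑ i ∈ O \ S, y i ≤ ∑ i ∈ (O \ S).filter (0 < y ·), y i := by
    rw [← Finset.sum_filter_add_sum_filter_not (O \ S) (0 < y ·)]
    have : ∑ i ∈ (O \ S).filter (¬ 0 < y ·), y i ≤ 0 :=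
      Finset.sum_nonpos fun i hi => not_lt.1 (Finset.mem_filter.1 hi).2
    linarith
  rcases ((O \ S).filter (0 < y ·)).eq_empty_or_nonempty with hempty | hne
  · rw [hempty, Finset.sum_empty] at hpos
    linarith
  have hlarge : ∀ i ∈ (O \ S).filter (0 < y ·),
      B < size i + ∑ j ∈ S.filter (fun j => y i * size j ≤ y j * size i), size j := by
    intro i hi
    rw [Finset.mem_filter, Finset.mem_sdiff] at hi
    have := h.blocked i hi.1.2 hi.2
    rw [knapsackSets, Set.mem_ofPred_eq, not_le, Finset.sum_insert fun hmem =>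
      hi.1.2 (Finset.mem_filter.1 hmem).1] at this
    exact this
  have hB : ∀ T ⊆ S, ∑ j ∈ T, size j ≤ B := fun T hT =>
    (Finset.sum_le_sum_of_subset_of_nonneg hT fun j _ _ => hsize j).trans h.mem
  -- An item of size `0` always fits beside selected items and cannot be blocked, so the densities
  -- are well defined.
  have hspos : ∀ i ∈ (O \ S).filter (0 < y ·), 0 < size i := fun i hi => by
    linarith [hlarge i hi, hB _ (Finset.filter_subset
      (fun j => y i * size j ≤ y j * size i) S)]
  obtain ⟨i, hi, hmax⟩ := Finset.exists_max_image _ (fun i => y i / size i) hne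
  have hsi := hspos i hi
  have hyi : 0 < y i := (Finset.mem_filter.1 hi).2
  set d := y i / size i with hd
  have hd0 : 0 < d := div_pos hyi hsi
  set T := S.filter fun j => y i * size j ≤ y j * size i with hT
  have h1 : ∑ j ∈ (O \ S).filter (0 < y ·), y j ≤ d * ∑ j ∈ O \ S, size j := by
    rw [Finset.mul_sum]
    refine (Finset.sum_le_sum fun j hj => ?_).trans
      (Finset.sum_le_sum_of_subset_of_nonneg (Finset.filter_subset _ _) fun j _ _ =>
        mul_nonneg hd0.le (hsize j))
    exact (div_le_iff₀ (hspos j hj)).1 (hmax j hj)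
  have h2 : d * ∑ j ∈ T \ O, size j ≤ ∑ j ∈ S \ O, y j := by
    rw [Finset.mul_sum]
    refine (Finset.sum_le_sum fun j hj => ?_).trans
      (Finset.sum_le_sum_of_subset_of_nonneg
        (Finset.sdiff_subset_sdiff (Finset.filter_subset _ _) le_rfl) fun j hj _ =>
          (h.pos j (Finset.mem_sdiff.1 hj).1).le)
    have := (Finset.mem_filter.1 (Finset.mem_sdiff.1 hj).1).2
    rw [hd, div_mul_eq_mul_div, div_le_iff₀ hsi]
    exact this
  have h3 : ∑ j ∈ O \ S, size j ≤ size i + ∑ j ∈ T \ O, size j := by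
    have e1 := Finset.sum_inter_add_sum_sdiff O S size
    have e2 := Finset.sum_inter_add_sum_sdiff T O size
    have e3 : ∑ j ∈ T ∩ O, size j ≤ ∑ j ∈ O ∩ S, size j :=
      Finset.sum_le_sum_of_subset_of_nonneg (fun j hj => by
        rw [Finset.mem_inter] at hj ⊢
        exact ⟨hj.2, Finset.filter_subset _ _ hj.1⟩) fun j _ _ => hsize j
    have e4 : ∑ j ∈ O, size j ≤ B := hO
    linarith [hlarge i hi]
  have h4 : d * size i = y i := div_mul_cancel₀ _ hsi.ne'
  have h5 := mul_le_mul_of_nonneg_left h3 hd0.le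
  rw [mul_add, h4] at h5
  linarith [hym i]

theorem mem_unit_knapsack {O : Finset (Fin n)} :
    O ∈ knapsackSets 1 (fun _ : Fin n => (1 : ℝ)) ↔ O.card ≤ 1 := by
  simp [knapsackSets]

/-- With unit sizes and capacity `1` the feasible sets have at most one element, so greedy picks a
best single element whenever some capped value is positive. -/
theorem sum_le_of_unit_knapsack (h : IsGreedy (knapsackSets 1 fun _ => 1) (fun _ => 1) y S)
    {O : Finset (Fin n)} (hO : O ∈ knapsackSets 1 (fun _ : Fin n => (1 : ℝ))) :
    ∑ i ∈ O, y i ≤ ∑ i ∈ S, y i := by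
  rw [mem_unit_knapsack] at hO
  rcases Nat.le_one_iff_eq_zero_or_eq_one.1 hO with hO | hO
  · rw [Finset.card_eq_zero.1 hO, Finset.sum_empty]
    exact h.sum_nonneg
  · obtain ⟨i, rfl⟩ := Finset.card_eq_one.1 hO
    rw [Finset.sum_singleton]
    have hge : ∀ j ∈ S, y j ≤ ∑ i ∈ S, y i := fun j hj =>
      Finset.single_le_sum (fun i hi => (h.pos i hi).le) hj
    by_cases hiS : i ∈ S
    · exact hge i hiS
    rcases le_or_gt (y i) 0 with hy | hy
    · exact hy.trans h.sum_nonneg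
    have := h.blocked i hiS hy
    rw [mem_unit_knapsack, Finset.card_insert_of_notMem fun hmem =>
      hiS (Finset.mem_filter.1 hmem).1] at this
    obtain ⟨j, hj⟩ := Finset.card_pos.1 (show 0 < (S.filter fun j => y i * 1 ≤ y j * 1).card by
      omega)
    rw [Finset.mem_filter] at hj
    linarith [hge j hj.1, hj.2]

end IsGreedy

/-! ## Matroids and matchings -/

/-- If the maximal set `B` were smaller than `A`, augmentation would extend it by an element of `A`,
still inside `Y`. -/
theorem isKSystem_matroidSets (M : Matroid (Fin n)) : IsKSystem (matroidSets M) 1 := by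
  intro Y A B hA hB
  rw [one_mul, Nat.cast_le]
  by_contra! hlt
  obtain ⟨e, he, hins⟩ := Matroid.Indep.augment (M := M) (I := (B : Set (Fin n)))
    (J := (A : Set (Fin n))) hB.1.1 hA.1.1 (by simpa [Set.encard_coe_eq_coe_finsetCard] using hlt)
  rw [Set.mem_sdiff, Finset.mem_coe, Finset.mem_coe] at he
  refine he.2 (hB.2 (y := insert e B) ⟨?_, Finset.insert_subset (hA.1.2 he.1) hB.1.2⟩
    (Finset.subset_insert _ _) (Finset.mem_insert_self _ _))
  rw [← Finset.coe_insert] at hins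
  exact hins

section Matching

variable {m : ℕ} {G : SimpleGraph (Fin m)} {e : Fin n ≃ G.edgeSet} {u v : Fin n → Fin m}

theorem mem_matchingSets (huv : ∀ i, s(u i, v i) = (e i : Sym2 (Fin m))) (I : Finset (Fin n)) :
    I ∈ matchingSets e ↔ ∀ i ∈ I, ∀ j ∈ I, i ≠ j →
      u i ≠ u j ∧ u i ≠ v j ∧ v i ≠ u j ∧ v i ≠ v j := by
  simp only [matchingSets, Set.mem_ofPred_eq, ← huv, Sym2.mem_iff]
  refine forall₅_congr fun i _ j _ _ => ⟨fun h => ⟨?_, ?_, ?_, ?_⟩, ?_⟩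
  · exact fun h' => h (u i) ⟨Or.inl rfl, Or.inl h'⟩
  · exact fun h' => h (u i) ⟨Or.inl rfl, Or.inr h'⟩
  · exact fun h' => h (v i) ⟨Or.inr rfl, Or.inl h'⟩
  · exact fun h' => h (v i) ⟨Or.inr rfl, Or.inr h'⟩
  · rintro ⟨h1, h2, h3, h4⟩ c ⟨rfl | rfl, h | h⟩
    exacts [h1 h, h2 h, h3 h, h4 h]

/-- Every edge of `A` meets the set `W` of at most 2|B| end points of `B`, as otherwise it could be
added to `B`. Edges of the matching `A` share no end point, so choosing for each a vertex in `W` is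
injective. -/
theorem isKSystem_matchingSets (huv : ∀ i, s(u i, v i) = (e i : Sym2 (Fin m))) :
    IsKSystem (matchingSets e) 2 := by
  classical
  intro Y A B hA hB
  have hAm := (mem_matchingSets huv A).1 hA.1.1
  have hBm := (mem_matchingSets huv B).1 hB.1.1
  set W : Finset (Fin m) := B.image u ∪ B.image v with hW
  have hmeet : ∀ i ∈ A, u i ∈ W ∨ v i ∈ W := by
    intro i hi
    by_contra! hno
    simp only [hW, Finset.mem_union, Finset.mem_image, not_or, not_exists, not_and] at hno
    have hiB : i ∉ B := fun h => hno.1.1 i h rfl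
    refine hiB (hB.2 (y := insert i B) ⟨(mem_matchingSets huv _).2 ?_,
      Finset.insert_subset (hA.1.2 hi) hB.1.2⟩ (Finset.subset_insert _ _)
      (Finset.mem_insert_self _ _))
    intro a ha c hc hac
    rw [Finset.mem_insert] at ha hc
    rcases ha with rfl | ha <;> rcases hc with rfl | hc
    · exact absurd rfl hac
    · exact ⟨fun h => hno.1.1 c hc h.symm, fun h => hno.1.2 c hc h.symm,
        fun h => hno.2.1 c hc h.symm, fun h => hno.2.2 c hc h.symm⟩
    · exact ⟨hno.1.1 a ha, hno.2.1 a ha, hno.1.2 a ha, hno.2.2 a ha⟩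
    · exact hBm a ha c hc hac
  have hcard : A.card ≤ W.card := by
    refine Finset.card_le_card_of_injOn (fun i => if u i ∈ W then u i else v i) ?_ ?_
    · intro i hi
      simp only
      split_ifs with h
      exacts [h, (hmeet i hi).resolve_left h]
    · intro i hi j hj hij
      by_contra hne
      obtain ⟨h1, h2, h3, h4⟩ := hAm i hi j hj hne
      simp only at hij
      split_ifs at hij
      exacts [h1 hij, h2 hij, h3 hij, h4 hij]
  have hW2 : W.card ≤ 2 * B.card := by
    refine (Finset.card_union_le _ _).trans ?_
    have h1 := Finset.card_image_le (s := B) (f := u)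
    have h2 := Finset.card_image_le (s := B) (f := v)
    omega
  exact_mod_cast hcard.trans hW2

end Matching

/-! ## Programs that prepare the weights and call the greedy program -/

section Prepare

variable {P : Market n} {D : Description n} {F : Set (Finset (Fin n))} {wt : Fin n → ℝ}
  {prepare check : Program}

/-- Vectors `3` and `5` of the description occupy the natural cells of region `5` (the chosen set)
and the real cells of region `8` (the indices). They have to vanish for the greedy program to start
with an empty choice and a zero sentinel. -/
theorem startState_loaded (hN : ∀ i, D.nats 3 i = 0) (hR : ∀ i, D.reals 5 i = 0) {s : State n}
    (hf : prepare.Frame (startState P D) s) (hsilent : prepare.Silent)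
    (hprepN : ∀ a, prepare.WritesNat a → 13 ≤ a)
    (hprepR : ∀ a, prepare.WritesReal a → a = 5 ∨ a = 6)
    (hwt : ∀ i : Fin n, s.realMem 5 i 0 = wt i) (hsent : s.realMem 5 n 0 = 1) :
    Loaded P wt s ∧ (∀ i : Fin n, s.natMem 5 i 0 = 0) ∧ s.realMem 8 n 0 = 0 ∧
      s.probed = ∅ ∧ s.selected = ∅ := by
  have hn : ∀ a ≤ 12, s.natMem a = (startState P D).natMem a := fun a ha =>
    hf.natMem a fun h => by have := hprepN a h; omega
  have hr : ∀ a, a ≠ 5 → a ≠ 6 → s.realMem a = (startState P D).realMem a := fun a h5 h6 =>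
    hf.realMem a fun h => by have := hprepR a h; omega
  refine ⟨⟨?_, fun i => ?_, fun i => ?_, fun i => ?_, fun i => ?_, hwt, hsent⟩, fun i => ?_, ?_,
    hf.probed hsilent, hf.selected hsilent⟩
  · rw [hn 0 (by simp)]; rfl
  · rw [hn 1 (by simp)]; simp [startState, pad]
  · rw [hr 0 (by simp) (by simp)]; simp [startState, pad]
  · rw [hr 1 (by simp) (by simp)]; funext j; simp [startState, pad, Market.rowValue]
  · rw [hr 2 (by simp) (by simp)]; funext j; simp [startState, pad, Market.rowProb]
  · rw [hn 5 (by simp)]; exact hN i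
  · rw [hr 8 (by simp) (by simp)]; exact hR n

theorem final_isGreedy (hN : ∀ i, D.nats 3 i = 0) (hR : ∀ i, D.reals 5 i = 0)
    (hsilent : prepare.Silent) (hprepN : ∀ a, prepare.WritesNat a → 13 ≤ a)
    (hprepR : ∀ a, prepare.WritesReal a → a = 5 ∨ a = 6)
    (hF : ∀ A ∈ F, ∀ B ⊆ A, B ∈ F) (h0 : ∅ ∈ F) (hwt0 : ∀ i, 0 ≤ wt i)
    {ω : ℕ → Bool} {x : Fin n → ℝ} {s : State n}
    (hs : s = prepare.exec ⟨P.dist, D.feasible, ω, x⟩ (startState P D))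
    (hwt : ∀ i : Fin n, s.realMem 5 i 0 = wt i) (hsent : s.realMem 5 n 0 = 1)
    (hC : Checks ⟨P.dist, D.feasible, ω, x⟩ s F check) :
    let f := Program.final (.seq prepare (greedyProgram check)) P D ω x
    IsGreedy F wt (fun i => P.capped i (x i)) f.selected ∧ f.selected ⊆ f.probed ∧
      ∀ i ∈ f.probed, P.capped i (x i) < x i → i ∈ f.selected := by
  have hf := Program.exec_frame ⟨P.dist, D.feasible, ω, x⟩ prepare (startState P D)
  rw [← hs] at hf
  obtain ⟨hL, h5, h8, hp, hsel⟩ := startState_loaded hN hR hf hsilent hprepN hprepR hwt hsent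
  have := greedyProgram_exec (P := P) (w := ⟨P.dist, D.feasible, ω, x⟩) rfl rfl hL hwt0 hC hF h0
    h5 h8 hp hsel
  simp only [Program.final, Program.exec]
  rw [← hs]
  exact this

/-- Gives weight `1` to every element. -/
def unitWeights : Program :=
  .loop 13 (.add (.var 0) (.lit 1)) (.setReal 5 (.var 13) (.lit 0) (.lit 1))

/-- The range includes `n`, so that the sentinel gets its weight too. -/
theorem unitWeights_exec (w : World n) {s : State n} (hs : s.natMem 0 0 0 = n) :
    ∀ i ≤ n, (unitWeights.exec w s).realMem 5 i 0 = 1 := by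
  have := Program.exec_loop_frame_induct (w := w) (a := 13) (e := .add (.var 0) (.lit 1))
    (c := .setReal 5 (.var 13) (.lit 0) (.lit 1)) (s := s) (m := n + 1) (by simp [hs])
    (fun t s' => ∀ i < t, s'.realMem 5 i 0 = 1) (by simp) fun t s' _ _ hI i hi => by
      by_cases hit : i = t
      · simp [State.writeReal_realMem, State.writeNat_natMem, hit]
      · simp [State.writeReal_realMem, State.writeNat_natMem, hit, hI i (by omega)]
  exact fun i hi => this i (Nat.lt_succ_of_le hi)

/-- The k-system bound holds for every outcome of bits and values; integrating it gives the
hypothesis on expectations. -/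
theorem unit_greedy_approximates (hN : ∀ i, D.nats 3 i = 0) (hR : ∀ i, D.reals 5 i = 0)
    (hF : ∀ A ∈ F, ∀ B ⊆ A, B ∈ F) (h0 : ∅ ∈ F) {k : ℝ} (hk0 : 0 < k) (hk : IsKSystem F k)
    (hC : ∀ ω x, Checks ⟨P.dist, D.feasible, ω, x⟩
      (unitWeights.exec ⟨P.dist, D.feasible, ω, x⟩ (startState P D)) F check) {N : ℕ}
    (htime : ∀ ω x, (Program.final (.seq unitWeights (greedyProgram check)) P D ω x).steps ≤ N) :
    Program.Approximates (.seq unitWeights (greedyProgram check)) P F D k N := by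
  have key := fun (ω : ℕ → Bool) (x : Fin n → ℝ) => final_isGreedy hN hR (by simp [unitWeights])
    (by simp [unitWeights]) (by simp [unitWeights]) hF h0 (wt := fun _ => 1)
    (fun _ => zero_le_one) rfl
    (fun i => unitWeights_exec ⟨P.dist, D.feasible, ω, x⟩ rfl i i.2.le)
    (unitWeights_exec _ rfl n le_rfl) (hC ω x)
  refine Program.approximates_of_capped hk0 (fun ω x => (key ω x).2.1)
    (fun ω x => (key ω x).1.mem) htime (fun ω x => (key ω x).2.2) ?_
  obtain ⟨h1, h2⟩ := integral_snd_eq fairBits P (P.integrable_optimum F)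
  rw [← h2, ← integral_const_mul]
  refine integral_mono h1 ((Program.integrable_capped_selected _ P D).const_mul k) fun z => ?_
  exact P.optimum_le h0 fun O hO => (key z.1 z.2).1.sum_le_of_isKSystem hF hk hO

theorem tame_greedyProgram (hc : check.Tame) : (greedyProgram check).Tame := by
  simp [greedyProgram, setupProgram, gradeProgram, rowProgram, tailProgram, raiseProgram,
    argmaxProgram, processProgram, acceptProgram, discardProgram, Program.Tame, NatExpr.IsInput, hc]

theorem tame_unitWeights : unitWeights.Tame := by
  simp [unitWeights, Program.Tame, NatExpr.IsInput]

end Prepare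

/-! ## Feasibility checks -/

theorem checks_askFeasible (w : World n) (b : State n) : Checks w b w.feasible (.askFeasible 6 5) where
  answer s S _ hS := by
    have : Finset.univ.filter (fun i : Fin n => s.natMem 5 i 0 ≠ 0) = S := by
      ext i; simp only [Finset.mem_filter, Finset.mem_univ, true_and, hS]
    simp only [Program.exec, State.tick_natMem, State.writeNat_natMem, and_self, if_true]
    split_ifs with h <;> rw [this] at h <;> simp [h]
  silent := trivial
  writesNat a h := Or.inl h
  writesReal a h := h.elim

/-- Decides whether the real size of the chosen set is at most the real cell `(6, 0, 0)`. -/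
def knapsackCheck : Program :=
  .seq (.setRealVar 12 (.lit 0))
    (.seq (.loop 14 (.var 0)
        (.ite (.natLe (.lit 1) (.entry 5 (.var 14)))
          (.setRealVar 12 (.add (.var 12) (.entry 5 (.var 14)))) .skip))
      (.ite (.realLe (.var 12) (.var 6)) (.setNatVar 6 (.lit 1)) (.setNatVar 6 (.lit 0))))

/-- Sizes and capacity are read from the cells that hold the greedy weights and cell `(6, 0, 0)`, so
one check serves both the true knapsack and the unit one chosen by the coin. -/
theorem checks_knapsackCheck (w : World n) (b : State n) (hn : b.natMem 0 0 0 = n) {B : ℝ}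
    {wt : Fin n → ℝ} (hB : b.realMem 6 0 0 = B) (hwt : ∀ i : Fin n, b.realMem 5 i 0 = wt i) :
    Checks w b (knapsackSets B wt) knapsackCheck where
  answer s S hs hS := by
    have key : ∀ s1 : State n, SameInput b s1 → (∀ i : Fin n, s1.natMem 5 i 0 ≠ 0 ↔ i ∈ S) →
        s1.realMem 12 0 0 = 0 →
        (Program.exec w (.loop 14 (.var 0)
          (.ite (.natLe (.lit 1) (.entry 5 (.var 14)))
            (.setRealVar 12 (.add (.var 12) (.entry 5 (.var 14)))) .skip)) s1).realMem 12 0 0 =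
          ∑ i ∈ S, wt i := by
      intro s1 hin hS h12
      have := Program.exec_loop_frame_induct (w := w) (a := 14) (e := .var 0)
        (c := .ite (.natLe (.lit 1) (.entry 5 (.var 14)))
            (.setRealVar 12 (.add (.var 12) (.entry 5 (.var 14)))) .skip) (s := s1) (m := n)
        (by simp [hin.1 0 (by simp), hn])
        (fun t s' => s'.realMem 12 0 0 = ∑ i ∈ S.filter fun i : Fin n => (i : ℕ) < t, wt i)
        (by simp [h12]) fun t s' ht hf hI => by
          obtain ⟨i, rfl⟩ : ∃ i : Fin n, (i : ℕ) = t := ⟨⟨t, ht⟩, rfl⟩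
          have g5 : s'.natMem 5 = s1.natMem 5 := hf.natMem 5 (by simp)
          have gw : s'.realMem 5 i 0 = wt i := by
            rw [hf.realMem 5 (by simp), hin.2 5 (by simp), hwt]
          have hcase : ∀ j : Fin n, (j : ℕ) < i + 1 ↔ j = i ∨ (j : ℕ) < i := fun j => by
            rw [Nat.lt_succ_iff_lt_or_eq, or_comm, Fin.ext_iff]
          rw [Program.exec]
          split_ifs with hc
          · have hi : i ∈ S := by
              rw [← hS i]
              simp [State.writeNat_natMem, g5] at hc
              omega
            have : (S.filter fun j : Fin n => (j : ℕ) < i + 1) =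
                insert i (S.filter fun j : Fin n => (j : ℕ) < i) := by
              ext j
              simp only [Finset.mem_filter, Finset.mem_insert, hcase]
              constructor
              · rintro ⟨h1, rfl | h2⟩
                exacts [Or.inl rfl, Or.inr ⟨h1, h2⟩]
              · rintro (rfl | h)
                exacts [⟨hi, Or.inl rfl⟩, ⟨h.1, Or.inr h.2⟩]
            rw [this, Finset.sum_insert (by simp), ← hI]
            simp [State.writeReal_realMem, State.writeNat_natMem, gw, add_comm]
          · have hi : i ∉ S := by
              rw [← hS i]
              simp [State.writeNat_natMem, g5] at hc
              omega
            have : (S.filter fun j : Fin n => (j : ℕ) < i + 1) =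
                S.filter fun j : Fin n => (j : ℕ) < i := by
              ext j
              simp only [Finset.mem_filter, hcase]
              constructor
              · rintro ⟨h1, rfl | h2⟩
                exacts [absurd h1 hi, ⟨h1, h2⟩]
              · exact fun h => ⟨h.1, Or.inr h.2⟩
            rw [this, ← hI]
            simp
      rw [this, Finset.filter_true_of_mem fun i _ => i.2]
    have h12 := key (s.writeReal 12 0 0 0).tick
      (hs.trans ⟨fun _ _ => rfl, fun a ha => by
        rw [State.tick_realMem, State.writeReal_realMem_of_ne _ _ _ _ (by omega)]⟩) hS
      (by simp [State.writeReal_realMem])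
    have h6 : (Program.exec w (.loop 14 (.var 0)
          (.ite (.natLe (.lit 1) (.entry 5 (.var 14)))
            (.setRealVar 12 (.add (.var 12) (.entry 5 (.var 14)))) .skip))
          (s.writeReal 12 0 0 0).tick).realMem 6 0 0 = B := by
      rw [Program.exec_realMem (by simp), State.tick_realMem,
        State.writeReal_realMem_of_ne _ _ _ _ (by simp), hs.2 6 (by simp), hB]
    have hexec : knapsackCheck.exec w s = Program.exec w
        (.ite (.realLe (.var 12) (.var 6)) (.setNatVar 6 (.lit 1)) (.setNatVar 6 (.lit 0)))
        (Program.exec w (.loop 14 (.var 0)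
          (.ite (.natLe (.lit 1) (.entry 5 (.var 14)))
            (.setRealVar 12 (.add (.var 12) (.entry 5 (.var 14)))) .skip))
          (s.writeReal 12 0 0 0).tick) := by
      rw [knapsackCheck, Program.exec, Program.exec, Program.exec]
      simp only [RealExpr.eval, NatExpr.eval, Nat.cast_zero]
    rw [hexec, Program.exec]
    split_ifs with hc
    · simp only [Test.holds, RealExpr.eval, NatExpr.eval, h12, h6] at hc
      simp [State.writeNat_natMem, knapsackSets, hc]
    · simp only [Test.holds, RealExpr.eval, NatExpr.eval, h12, h6] at hc
      simp [State.writeNat_natMem, knapsackSets, hc]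
  silent := by simp [knapsackCheck]
  writesNat a h := by
    simp [knapsackCheck] at h
    omega
  writesReal a h := by
    simp [knapsackCheck] at h
    omega

/-- Equality of natural numbers. -/
def Test.natEq (e f : NatExpr) : Test := .and (.natLe e f) (.natLe f e)

@[simp]
theorem Test.natEq_holds (s : State n) (e f : NatExpr) :
    (Test.natEq e f).holds s ↔ e.eval s = f.eval s := by
  simp [Test.natEq, le_antisymm_iff]

/-- Elements `(13, 0, 0)` and `(14, 0, 0)` are different chosen edges that share an end point. -/
def conflictTest : Test :=
  .and (.natLe (.lit 1) (.entry 5 (.var 13))) (.and (.natLe (.lit 1) (.entry 5 (.var 14)))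
    (.and (.not (.natEq (.var 13) (.var 14)))
      (.not (.and (.not (.natEq (.entry 2 (.var 13)) (.entry 2 (.var 14))))
        (.and (.not (.natEq (.entry 2 (.var 13)) (.entry 3 (.var 14))))
          (.and (.not (.natEq (.entry 3 (.var 13)) (.entry 2 (.var 14))))
            (.not (.natEq (.entry 3 (.var 13)) (.entry 3 (.var 14))))))))))

/-- Decides whether the chosen edges form a matching. -/
def matchingCheck : Program :=
  .seq (.setNatVar 6 (.lit 1))
    (.loop 13 (.var 0) (.loop 14 (.var 0) (.ite conflictTest (.setNatVar 6 (.lit 0)) .skip)))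

theorem checks_matchingCheck {m : ℕ} {G : SimpleGraph (Fin m)} {e : Fin n ≃ G.edgeSet}
    {u v : Fin n → Fin m} (huv : ∀ i, s(u i, v i) = (e i : Sym2 (Fin m))) (w : World n)
    (b : State n) (hn : b.natMem 0 0 0 = n) (hu : ∀ i : Fin n, b.natMem 2 i 0 = u i)
    (hv : ∀ i : Fin n, b.natMem 3 i 0 = v i) :
    Checks w b (matchingSets e) matchingCheck where
  answer s S hs hS := by
    -- Compatibility of a pair is kept opaque. The answer cell starts at `1` and is only ever reset
    -- to `0`, so it survives exactly if all ordered pairs are compatible.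
    obtain ⟨ok, hok⟩ : ∃ ok : Fin n → Fin n → Prop, ok = fun i j => i ∈ S → j ∈ S → i ≠ j →
      u i ≠ u j ∧ u i ≠ v j ∧ v i ≠ u j ∧ v i ≠ v j := ⟨_, rfl⟩
    have hmem : S ∈ matchingSets e ↔ ∀ i j, ok i j := by
      rw [mem_matchingSets huv, hok]
      exact ⟨fun h i j hi hj => h i hi j hj, fun h i hi j hj => h i j hi hj⟩
    have hinput : ∀ s1 : State n, (∀ a ≤ 5, s1.natMem a = s.natMem a) →
        s1.natMem 0 0 0 = n ∧ (∀ i : Fin n, s1.natMem 2 i 0 = u i) ∧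
          (∀ i : Fin n, s1.natMem 3 i 0 = v i) ∧ (∀ i : Fin n, s1.natMem 5 i 0 ≠ 0 ↔ i ∈ S) := by
      intro s1 h
      refine ⟨?_, fun i => ?_, fun i => ?_, fun i => ?_⟩
      · rw [h 0 (by simp), hs.1 0 (by simp), hn]
      · rw [h 2 (by simp), hs.1 2 (by simp), hu]
      · rw [h 3 (by simp), hs.1 3 (by simp), hv]
      · rw [h 5 (by simp), hS]
    have inner : ∀ (s1 : State n) (i : Fin n), (∀ a ≤ 5, s1.natMem a = s.natMem a) →
        s1.natMem 13 0 0 = i →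
        ((Program.exec w (.loop 14 (.var 0) (.ite conflictTest (.setNatVar 6 (.lit 0)) .skip))
          s1).natMem 6 0 0 ≠ 0 ↔ s1.natMem 6 0 0 ≠ 0 ∧ ∀ j, ok i j) := by
      intro s1 i hs1 h13
      have := Program.exec_loop_frame_induct (w := w) (a := 14) (e := .var 0)
        (c := .ite conflictTest (.setNatVar 6 (.lit 0)) .skip) (s := s1) (m := n)
        (by simp [(hinput s1 hs1).1])
        (fun t s' => s'.natMem 6 0 0 ≠ 0 ↔
          s1.natMem 6 0 0 ≠ 0 ∧ ∀ j : Fin n, (j : ℕ) < t → ok i j)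
        (by simp) fun t s' ht hf hI => by
          obtain ⟨j, rfl⟩ : ∃ j : Fin n, (j : ℕ) = t := ⟨⟨t, ht⟩, rfl⟩
          obtain ⟨-, g2, g3, g5⟩ := hinput s' fun a ha => by
            rw [hf.natMem a (by simp; omega), hs1 a ha]
          have g13 : s'.natMem 13 0 0 = i := by rw [hf.natMem 13 (by simp), h13]
          have hconf : conflictTest.holds (s'.writeNat 14 0 0 j).tick ↔ ¬ ok i j := by
            have h1 : ∀ l : Fin n, 1 ≤ s'.natMem 5 l 0 ↔ l ∈ S := fun l => by
              rw [← g5 l, Nat.one_le_iff_ne_zero]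
            simp only [conflictTest, Test.holds, Test.natEq_holds, NatExpr.eval, State.tick_natMem,
              State.writeNat_natMem]
            simp [g13, g2, g3, h1, hok, Fin.val_inj]
          have hcase : (∀ l : Fin n, (l : ℕ) < j + 1 → ok i l) ↔
              (∀ l : Fin n, (l : ℕ) < j → ok i l) ∧ ok i j := by
            refine ⟨fun h => ⟨fun l hl => h l (by omega), h j (by omega)⟩, fun h l hl => ?_⟩
            rcases Nat.lt_succ_iff_lt_or_eq.1 hl with hl | hl
            · exact h.1 l hl
            · rw [Fin.ext hl]; exact h.2
          rw [hcase, ← and_assoc, ← hI, Program.exec]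
          split_ifs with hc
          · rw [hconf] at hc
            simp [State.writeNat_natMem, hc]
          · rw [hconf, not_not] at hc
            simp [State.writeNat_natMem, hc]
      rw [this]
      simp
    have outer := Program.exec_loop_frame_induct (w := w) (a := 13) (e := .var 0)
      (c := .loop 14 (.var 0) (.ite conflictTest (.setNatVar 6 (.lit 0)) .skip))
      (s := (s.writeNat 6 0 0 1).tick) (m := n)
      (by simp [State.writeNat_natMem, (hinput s fun _ _ => rfl).1])
      (fun t s' => s'.natMem 6 0 0 ≠ 0 ↔ ∀ i : Fin n, (i : ℕ) < t → ∀ j, ok i j)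
      (by simp [State.writeNat_natMem]) fun t s' ht hf hI => by
        obtain ⟨i, rfl⟩ : ∃ i : Fin n, (i : ℕ) = t := ⟨⟨t, ht⟩, rfl⟩
        rw [inner (s'.writeNat 13 0 0 i).tick i (fun a ha => by
            rw [State.tick_natMem, State.writeNat_natMem_of_ne _ _ _ _ (by omega),
              hf.natMem a (by simp; omega), State.tick_natMem,
              State.writeNat_natMem_of_ne _ _ _ _ (by omega)])
          (by simp [State.writeNat_natMem])]
        have h6 : (s'.writeNat 13 0 0 i).tick.natMem 6 0 0 = s'.natMem 6 0 0 := by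
          simp [State.writeNat_natMem]
        rw [h6, hI]
        refine ⟨fun h l hl => ?_, fun h => ⟨fun l hl => h l (by omega), h i (by omega)⟩⟩
        rcases Nat.lt_succ_iff_lt_or_eq.1 hl with hl | hl
        · exact h.1 l hl
        · rw [Fin.ext hl]; exact h.2
    rw [hmem]
    refine outer.trans ?_
    simp
  silent := by simp [matchingCheck]
  writesNat a h := by
    simp [matchingCheck] at h
    omega
  writesReal a h := by
    simp [matchingCheck] at h

/-! ## Knapsack -/

/-- Flips a fair coin; keeps the sizes and the capacity as they are, or replaces all of them
by `1`. -/
def coinWeights : Program :=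
  .seq (.flip 13)
    (.seq
      (.ite (.natLe (.var 13) (.lit 0))
        (.seq (.loop 14 (.var 0) (.setReal 5 (.var 14) (.lit 0) (.entry 4 (.var 14))))
          (.setRealVar 6 (.var 3)))
        (.seq (.loop 14 (.var 0) (.setReal 5 (.var 14) (.lit 0) (.lit 1)))
          (.setRealVar 6 (.lit 1))))
      (.setReal 5 (.var 0) (.lit 0) (.lit 1)))

/-- The sizes that the greedy program works with, depending on the coin. -/
def coinSize (c : Bool) (size : Fin n → ℝ) : Fin n → ℝ := if c then fun _ => 1 else size

/-- The capacity that the greedy program works with, depending on the coin. -/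
def coinCapacity (c : Bool) (B : ℝ) : ℝ := if c then 1 else B

theorem setWeights_exec (w : World n) (e : RealExpr) {s : State n} {wt : Fin n → ℝ}
    (hn : s.natMem 0 0 0 = n)
    (he : ∀ (s' : State n) (i : Fin n), s'.realMem 4 = s.realMem 4 → s'.natMem 14 0 0 = i →
      e.eval s' = wt i) :
    ∀ i : Fin n, (Program.exec w (.loop 14 (.var 0) (.setReal 5 (.var 14) (.lit 0) e))
      s).realMem 5 i 0 = wt i := by
  have := Program.exec_loop_frame_induct (w := w) (a := 14) (e := .var 0)
    (c := .setReal 5 (.var 14) (.lit 0) e) (s := s) (m := n) (by simp [hn])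
    (fun t s' => ∀ i : Fin n, (i : ℕ) < t → s'.realMem 5 i 0 = wt i) (by simp)
    fun t s' ht hf hI i hi => by
      have h14 : (s'.writeNat 14 0 0 t).tick.natMem 14 0 0 = t := by simp [State.writeNat_natMem]
      by_cases hit : (i : ℕ) = t
      · simp only [Program.exec, NatExpr.eval, h14, State.tick_realMem, State.writeReal_realMem,
          hit, and_self, if_true]
        exact he _ i (hf.realMem 4 (by simp)) (by rw [h14, hit])
      · simp [State.writeReal_realMem, State.writeNat_natMem, hit, hI i (by omega)]
  exact fun i => this i i.2

/-- The only flip is the first one, so it reads bit `0`; `false` keeps the true knapsack. The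
sentinel weight is written last, in either case. -/
theorem coinWeights_exec (P : Market n) (B : ℝ) (size : Fin n → ℝ) (ω : ℕ → Bool)
    (x : Fin n → ℝ) :
    let s := coinWeights.exec ⟨P.dist, (knapsackDescription B size).feasible, ω, x⟩
      (startState P (knapsackDescription B size))
    (∀ i : Fin n, s.realMem 5 i 0 = coinSize (ω 0) size i) ∧ s.realMem 5 n 0 = 1 ∧
      s.realMem 6 0 0 = coinCapacity (ω 0) B ∧ s.natMem 0 0 0 = n := by
  intro s
  have hn : s.natMem 0 0 0 = n := by
    change (coinWeights.exec _ _).natMem 0 0 0 = n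
    rw [Program.exec_natMem (by simp [coinWeights])]
    rfl
  have key : ∀ s1 : State n, s1.natMem 0 0 0 = n →
      let s2 := Program.exec ⟨P.dist, (knapsackDescription B size).feasible, ω, x⟩
        (.setReal 5 (.var 0) (.lit 0) (.lit 1)) s1
      (∀ i : Fin n, s2.realMem 5 i 0 = s1.realMem 5 i 0) ∧ s2.realMem 5 n 0 = 1 ∧
        s2.realMem 6 0 0 = s1.realMem 6 0 0 := by
    intro s1 h1
    refine ⟨fun i => ?_, ?_, ?_⟩
    · simp [State.writeReal_realMem, h1, i.2.ne]
    · simp [State.writeReal_realMem, h1]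
    · simp [State.writeReal_realMem]
  obtain ⟨s0, hs0⟩ : ∃ s0 : State n, s0 = Program.exec
    ⟨P.dist, (knapsackDescription B size).feasible, ω, x⟩ (.flip 13)
      (startState P (knapsackDescription B size)) := ⟨_, rfl⟩
  have h0 : s0.natMem 0 0 0 = n := by
    rw [hs0]; exact congrFun (congrFun (Program.exec_natMem (by simp) _) 0) 0
  have h13 : s0.natMem 13 0 0 = (ω 0).toNat := by
    rw [hs0]; simp [State.writeNat_natMem, startState]
  have h3 : s0.realMem 3 0 0 = B := by
    rw [hs0]; exact congrFun (congrFun (Program.exec_realMem (by simp) _) 0) 0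
  have h4 : ∀ i : Fin n, s0.realMem 4 i 0 = size i := fun i => by
    rw [hs0, Program.exec_realMem (by simp)]
    simp [startState, knapsackDescription, pad]
  have hite : ∀ s1 : State n, s1 = Program.exec
      ⟨P.dist, (knapsackDescription B size).feasible, ω, x⟩
      (.ite (.natLe (.var 13) (.lit 0))
        (.seq (.loop 14 (.var 0) (.setReal 5 (.var 14) (.lit 0) (.entry 4 (.var 14))))
          (.setRealVar 6 (.var 3)))
        (.seq (.loop 14 (.var 0) (.setReal 5 (.var 14) (.lit 0) (.lit 1)))
          (.setRealVar 6 (.lit 1)))) s0 →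
      s1.natMem 0 0 0 = n ∧ (∀ i : Fin n, s1.realMem 5 i 0 = coinSize (ω 0) size i) ∧
        s1.realMem 6 0 0 = coinCapacity (ω 0) B := by
    rintro s1 rfl
    refine ⟨by rw [Program.exec_natMem (by simp), h0], ?_⟩
    rw [Program.exec]
    cases hω : ω 0 with
    | false =>
      rw [if_pos (by simp [h13, hω]), Program.exec]
      have hset := setWeights_exec
        ⟨P.dist, (knapsackDescription B size).feasible, ω, x⟩ (.entry 4 (.var 14))
        (s := s0.tick) (wt := size) h0
        (fun s' i h h' => by simp [h, h', h4])
      refine ⟨fun i => ?_, ?_⟩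
      · rw [Program.exec_realMem (by simp), hset]; rfl
      · rw [Program.exec]
        simp only [State.tick_realMem, State.writeReal_realMem, RealExpr.eval, NatExpr.eval,
          and_self, if_true]
        rw [Program.exec_realMem (by simp), State.tick_realMem, h3]
        rfl
    | true =>
      rw [if_neg (by simp [h13, hω]), Program.exec]
      have hset := setWeights_exec
        ⟨P.dist, (knapsackDescription B size).feasible, ω, x⟩ (.lit 1)
        (s := s0.tick) (wt := fun _ => 1) h0 (fun s' i h h' => by simp)
      refine ⟨fun i => ?_, ?_⟩
      · rw [Program.exec_realMem (by simp), hset]; rfl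
      · simp [State.writeReal_realMem, coinCapacity]
  obtain ⟨g0, g5, g6⟩ := hite _ rfl
  obtain ⟨k5, kn, k6⟩ := key _ g0
  have hs : s = Program.exec ⟨P.dist, (knapsackDescription B size).feasible, ω, x⟩
      (.setReal 5 (.var 0) (.lit 0) (.lit 1)) (Program.exec
      ⟨P.dist, (knapsackDescription B size).feasible, ω, x⟩
      (.ite (.natLe (.var 13) (.lit 0))
        (.seq (.loop 14 (.var 0) (.setReal 5 (.var 14) (.lit 0) (.entry 4 (.var 14))))
          (.setRealVar 6 (.var 3)))
        (.seq (.loop 14 (.var 0) (.setReal 5 (.var 14) (.lit 0) (.lit 1)))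
          (.setRealVar 6 (.lit 1)))) s0) := by
    rw [hs0]
    exact (by rw [coinWeights, Program.exec, Program.exec] :
      coinWeights.exec ⟨P.dist, (knapsackDescription B size).feasible, ω, x⟩
        (startState P (knapsackDescription B size)) = _)
  rw [hs] at hn ⊢
  exact ⟨fun i => (k5 i).trans (g5 i), kn, k6.trans g6, hn⟩

theorem fairBits_real_coin (c : Bool) : fairBits.real {ω | ω 0 = c} = 1 / 2 := by
  have h : MeasurePreserving (fun ω : ℕ → Bool => ω 0) fairBits
      (PMF.uniformOfFintype Bool).toMeasure :=
    measurePreserving_eval_infinitePi (fun _ : ℕ => (PMF.uniformOfFintype Bool).toMeasure) 0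
  have hset : {ω : ℕ → Bool | ω 0 = c} = (fun ω : ℕ → Bool => ω 0) ⁻¹' {c} := rfl
  rw [hset, measureReal_def, h.measure_preimage (MeasurableSet.singleton c).nullMeasurableSet,
    PMF.toMeasure_apply_singleton _ _ (MeasurableSet.singleton c)]
  simp

/-- The coin is independent of the values and each side has probability 1/2, so 𝔼 h is at least half
of 𝔼 a plus half of 𝔼 b. -/
theorem le_integral_of_coin {P : Market n} {a b : (Fin n → ℝ) → ℝ}
    {h : (ℕ → Bool) × (Fin n → ℝ) → ℝ} (ha : Integrable a P.joint) (hb : Integrable b P.joint)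
    (hh : Integrable h (fairBits.prod P.joint)) (hah : ∀ z, z.1 0 = false → a z.2 ≤ h z)
    (hbh : ∀ z, z.1 0 = true → b z.2 ≤ h z) :
    ∫ x, (a x + b x) ∂P.joint ≤ 2 * ∫ z, h z ∂(fairBits.prod P.joint) := by
  have hmeas : ∀ c : Bool, MeasurableSet {ω : ℕ → Bool | ω 0 = c} := fun c =>
    (measurable_pi_apply (X := fun _ : ℕ => Bool) 0) (MeasurableSet.singleton c)
  have hind : ∀ c : Bool,
      Integrable ({ω : ℕ → Bool | ω 0 = c}.indicator fun _ => (1 : ℝ)) fairBits := fun c =>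
    (integrable_const 1).indicator (hmeas c)
  have hval : ∀ (c : Bool) (f : (Fin n → ℝ) → ℝ),
      ∫ z : (ℕ → Bool) × (Fin n → ℝ), {ω : ℕ → Bool | ω 0 = c}.indicator (fun _ => (1 : ℝ)) z.1 *
        f z.2 ∂(fairBits.prod P.joint) = 1 / 2 * ∫ x, f x ∂P.joint := fun c f => by
    rw [integral_prod_mul, integral_indicator (hmeas c), setIntegral_const, fairBits_real_coin]
    simp
  have hle : ∫ z : (ℕ → Bool) × (Fin n → ℝ),
      ({ω : ℕ → Bool | ω 0 = false}.indicator (fun _ => (1 : ℝ)) z.1 * a z.2 +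
        {ω : ℕ → Bool | ω 0 = true}.indicator (fun _ => (1 : ℝ)) z.1 * b z.2)
          ∂(fairBits.prod P.joint) ≤ ∫ z, h z ∂(fairBits.prod P.joint) := by
    refine integral_mono (((hind false).mul_prod ha).add ((hind true).mul_prod hb)) hh fun z => ?_
    cases hz : z.1 0 with
    | false => simpa [Set.indicator_apply, hz] using hah z hz
    | true => simpa [Set.indicator_apply, hz] using hbh z hz
  rw [integral_add ((hind false).mul_prod ha) ((hind true).mul_prod hb), hval, hval] at hle
  rw [integral_add ha hb]
  linarith

/-- The program for knapsack constraints. -/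
def knapsackProgram : Program := .seq coinWeights (greedyProgram knapsackCheck)

theorem knapsackProgram_approximates (P : Market n) {B : ℝ} {size : Fin n → ℝ} (hB : 0 ≤ B)
    (hsize : ∀ i, 0 ≤ size i) (hsB : ∀ i, size i ≤ B) {N : ℕ}
    (htime : ∀ ω x,
      (knapsackProgram.final P (knapsackDescription B size) ω x).steps ≤ N) :
    knapsackProgram.Approximates P (knapsackSets B size) (knapsackDescription B size) 2 N := by
  have hempty : ∀ {C : ℝ} (wt : Fin n → ℝ), 0 ≤ C → ∅ ∈ knapsackSets C wt := fun wt hC => by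
    simpa [knapsackSets] using hC
  have key := fun (ω : ℕ → Bool) (x : Fin n → ℝ) => by
    have hc := coinWeights_exec P B size ω x
    have hw0 : ∀ i, 0 ≤ coinSize (ω 0) size i := fun i => by
      unfold coinSize; split_ifs; exacts [zero_le_one, hsize i]
    have hc0 : 0 ≤ coinCapacity (ω 0) B := by
      unfold coinCapacity; split_ifs; exacts [zero_le_one, hB]
    exact final_isGreedy (P := P) (D := knapsackDescription B size) (prepare := coinWeights)
      (check := knapsackCheck) (F := knapsackSets (coinCapacity (ω 0) B) (coinSize (ω 0) size))
      (fun _ => rfl) (fun _ => rfl) (by simp [coinWeights])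
      (fun a h => by simp [coinWeights] at h; omega)
      (fun a h => by simp [coinWeights] at h; omega)
      (fun A hA T hT => (Finset.sum_le_sum_of_subset_of_nonneg hT fun i _ _ => hw0 i).trans hA)
      (hempty _ hc0) hw0 rfl hc.1 hc.2.1
      (checks_knapsackCheck _ _ hc.2.2.2 hc.2.2.1 hc.1)
  have hfalse : ∀ ω x, ω 0 = false → IsGreedy (knapsackSets B size) size
      (fun i => P.capped i (x i))
      (knapsackProgram.final P (knapsackDescription B size) ω x).selected := fun ω x hω => by
    have := (key ω x).1
    simp only [hω] at this
    exact this
  have htrue : ∀ ω x, ω 0 = true → IsGreedy (knapsackSets 1 fun _ => 1) (fun _ => 1)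
      (fun i => P.capped i (x i))
      (knapsackProgram.final P (knapsackDescription B size) ω x).selected := fun ω x hω => by
    have := (key ω x).1
    simp only [hω] at this
    exact this
  refine Program.approximates_of_capped two_pos (fun ω x => (key ω x).2.1) (fun ω x => ?_) htime
    (fun ω x => (key ω x).2.2) ?_
  · cases hω : ω 0 with
    | false => exact (hfalse ω x hω).mem
    -- The unit knapsack is not the true constraint, but its sets have at most one item, and each
    -- single item fits since `size i ≤ B`.
    | true =>
      have := IsGreedy.mem_unit_knapsack.1 (htrue ω x hω).mem
      rcases Nat.le_one_iff_eq_zero_or_eq_one.1 this with h | h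
      · rw [Finset.card_eq_zero.1 h]; exact hempty _ hB
      · obtain ⟨i, hi⟩ := Finset.card_eq_one.1 h
        rw [hi]
        simpa [knapsackSets] using hsB i
  -- With `a` the optimum minus the best single item, and `b` the best single item, `a + b` is the
  -- optimum. Greedy by density is worth at least `a`, and the single-item greedy at least `b`.
  · have hsub := (P.integrable_optimum (knapsackSets B size)).sub
      (P.integrable_optimum (knapsackSets 1 fun _ => 1))
    have := le_integral_of_coin hsub (P.integrable_optimum (knapsackSets 1 fun _ => 1))
      (Program.integrable_capped_selected knapsackProgram P (knapsackDescription B size))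
      (fun z hz => ?_) fun z hz => ?_
    · simpa using this
    · rw [Pi.sub_apply, sub_le_iff_le_add]
      refine P.optimum_le (hempty _ hB) fun O hO => ?_
      refine (hfalse z.1 z.2 hz).sum_le_of_knapsack hsize ?_ (fun i => ?_) hO
      -- The bound `m` on single items is the unit-knapsack optimum, which is non-negative because
      -- of the empty set and at least each capped value because of the singletons.
      · simpa using P.le_optimum (hempty (fun _ => 1) zero_le_one) z.2
      · simpa using P.le_optimum (F := knapsackSets 1 fun _ => 1) (O := {i})
          (IsGreedy.mem_unit_knapsack.2 (by simp)) z.2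
    · exact P.optimum_le (hempty _ zero_le_one) fun O hO =>
        (htrue z.1 z.2 hz).sum_le_of_unit_knapsack hO

/-! ## The main theorem -/

/-- The program for constraints that are given by a feasibility oracle. -/
def oracleProgram : Program := .seq unitWeights (greedyProgram (.askFeasible 6 5))

theorem oracleProgram_approximates (P : Market n) {F : Set (Finset (Fin n))} {k : ℝ}
    (h0 : ∅ ∈ F) (hF : ∀ A ∈ F, ∀ B ⊆ A, B ∈ F) (hk0 : 0 < k) (hk : IsKSystem F k) {N : ℕ}
    (htime : ∀ ω x, (oracleProgram.final P (byOracle F) ω x).steps ≤ N) :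
    oracleProgram.Approximates P F (byOracle F) k N :=
  unit_greedy_approximates (fun _ => rfl) (fun _ => rfl) hF h0 hk0 hk
    (fun _ _ => checks_askFeasible _ _) htime

/-- The program for matchings. -/
def matchingProgram : Program := .seq unitWeights (greedyProgram matchingCheck)

theorem matchingProgram_approximates (P : Market n) {m : ℕ} {G : SimpleGraph (Fin m)}
    {e : Fin n ≃ G.edgeSet} {u v : Fin n → Fin m}
    (huv : ∀ i, s(u i, v i) = (e i : Sym2 (Fin m))) {N : ℕ}
    (htime : ∀ ω x, (matchingProgram.final P (graphDescription u v) ω x).steps ≤ N) :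
    matchingProgram.Approximates P (matchingSets e) (graphDescription u v) 2 N := by
  refine unit_greedy_approximates (F := matchingSets e) (fun _ => rfl) (fun _ => rfl)
    (fun A hA B hBA i hi j hj => hA i (hBA hi) j (hBA hj))
    (fun i hi => absurd hi (Finset.notMem_empty i)) two_pos (isKSystem_matchingSets huv)
    (fun ω x => checks_matchingCheck huv _ _ ?_ (fun i => ?_) fun i => ?_) htime
  · rw [Program.exec_natMem (by simp [unitWeights])]; rfl
  · rw [Program.exec_natMem (by simp [unitWeights])]
    simp [startState, graphDescription, pad]
  · rw [Program.exec_natMem (by simp [unitWeights])]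
    simp [startState, graphDescription, pad]

theorem tame_oracleProgram : oracleProgram.Tame :=
  ⟨tame_unitWeights, tame_greedyProgram (by simp [Program.Tame])⟩

theorem tame_matchingProgram : matchingProgram.Tame :=
  ⟨tame_unitWeights, tame_greedyProgram (by
    simp [matchingCheck, Program.Tame, NatExpr.IsInput])⟩

theorem tame_knapsackProgram : knapsackProgram.Tame :=
  ⟨by simp [coinWeights, Program.Tame, NatExpr.IsInput], tame_greedyProgram (by
    simp [knapsackCheck, Program.Tame, NatExpr.IsInput])⟩

end PriceOfInfo

end

theorem mainTheorem2 :
    -- k-systems, given by a feasibility oracle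
    (∃ (p : Program) (C d : ℕ), ∀ (n : ℕ) (P : Market n) (F : Set (Finset (Fin n))) (k : ℝ),
      ∅ ∈ F → (∀ A ∈ F, ∀ B ⊆ A, B ∈ F) → 1 ≤ k → IsKSystem F k →
        p.Approximates P F (byOracle F) k (C * (P.size + 1) ^ d)) ∧
    -- knapsack
    (∃ (p : Program) (C d : ℕ), ∀ (n : ℕ) (P : Market n) (B : ℝ) (size : Fin n → ℝ),
      0 ≤ B → (∀ i, 0 ≤ size i) → (∀ i, size i ≤ B) →
        p.Approximates P (knapsackSets B size) (knapsackDescription B size) 2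
          (C * (P.size + 1) ^ d)) ∧
    -- matroids, given by an independence oracle
    (∃ (p : Program) (C d : ℕ), ∀ (n : ℕ) (P : Market n) (M : Matroid (Fin n)),
      p.Approximates P (matroidSets M) (byOracle (matroidSets M)) 1 (C * (P.size + 1) ^ d)) ∧
    -- matchings in a graph
    (∃ (p : Program) (C d : ℕ), ∀ (n : ℕ) (P : Market n) (m : ℕ) (G : SimpleGraph (Fin m))
      (e : Fin n ≃ G.edgeSet) (u v : Fin n → Fin m),
      (∀ i, s(u i, v i) = (e i : Sym2 (Fin m))) →
        p.Approximates P (matchingSets e) (graphDescription u v) 2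
          (C * (P.size + 1) ^ d)) := by
  obtain ⟨C, d, hO⟩ := tame_oracleProgram.exists_polynomial_time
  obtain ⟨C', d', hK⟩ := tame_knapsackProgram.exists_polynomial_time
  obtain ⟨C'', d'', hM⟩ := tame_matchingProgram.exists_polynomial_time
  refine ⟨⟨oracleProgram, C, d, fun n P F k h0 hF hk hks => ?_⟩,
    ⟨knapsackProgram, C', d', fun n P B size hB hs hsB => ?_⟩,
    -- The program for k-systems does not depend on `k`; for a matroid it is used with `k = 1` and
    -- is therefore optimal.
    ⟨oracleProgram, C, d, fun n P M => ?_⟩,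
    ⟨matchingProgram, C'', d'', fun n P m G e u v huv => ?_⟩⟩
  · exact oracleProgram_approximates P h0 hF (zero_lt_one.trans_le hk) hks (hO n P _)
  · exact knapsackProgram_approximates P hB hs hsB (hK n P _)
  · refine oracleProgram_approximates P ?_ (fun A hA B hBA => ?_) one_pos
      (isKSystem_matroidSets M) (hO n P _)
    · simp [matroidSets]
    · exact Matroid.Indep.subset hA (Finset.coe_subset.2 hBA)
  · exact matchingProgram_approximates P huv (hM n P _)
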